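/- Let $T>0$ and $N>4$ be real numbers, and let $\mathfrak E=C^\infty([0,T]\times[0,1])$ be the Fréchet space of real-valued smooth functions $u(t,x)$, with the topology of uniform convergence of all derivatives. Fix $\omega\in C^\infty(\mathbb R)$ with $\omega(x)=1$ for $x\le 1/3$, $0<\omega(x)<1$ for $1/3<x<2/3$, and $\omega(x)=0$ for $x\ge 2/3$, and put $u^{[0]}=\omega(x)u$, $u^{[1]}=(1-\omega(x))u$. Let $$\mathfrak E_{[0]}=\{u\in\mathfrak E: u=0\text{ for }5/6\le x\le 1\},\qquad \mathfrak E_{[1]}=\{u\in\mathfrak E: u=0\text{ for }0\le x\le 1/6\},$$ $$\triangle_{[0]}=x\frac{\partial^2}{\partial x^2}+\frac52\frac{\partial}{\partial x},\qquad \triangle_{[1]}=X\frac{\partial^2}{\partial X^2}+\frac N2\frac{\partial}{\partial X}\quad (X=1-x),$$ $$\|u\|^{(\infty)}_{[\mu]n}=\sup_{j+k\le n}\|(-\partial_t^2)^j(-\triangle_{[\mu]})^ku\|_{L^\infty},\qquad \|u\|^{(2)}_{[\mu]n}=\Big(\sum_{j+k\le n}\int_0^T\!\!\int_0^1|(-\partial_t^2)^j(-\triangle_{[\mu]})^ku|^2\,w_\mu(x)\,dx\,dt\Big)^{1/2},$$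 where $w_0(x)=x^{3/2}$ and $w_1(x)=(1-x)^{N/2-1}$. On $\mathfrak E$ define the combined gradings $$\|u\|_n^{(\infty)}=\sup_{\mu=0,1}\|u^{[\mu]}\|^{(\infty)}_{[\mu]n},\qquad \|u\|_n^{(2)}=\Big(\sum_{\mu=0,1}\big(\|u^{[\mu]}\|^{(2)}_{[\mu]n}\big)^2\Big)^{1/2}.$$ A linear map $L$ between graded spaces is called tame if there are $r,b\in\mathbb N$ such that for every $n\ge b$ there is a constant $C$ with $\|Lf\|_n\le C\|f\|_{n+r}$ for all $f$. Two gradings on the same space are equivalent if the identity is tame in both directions. A graded space $F$ is a tame direct summand of $G$ via $L:F\to G$ and $M:G\to F$ if $L$ and $M$ are tame linear maps and $ML=\mathrm{Id}_F$. A Fréchet space whose topology is defined by an increasing sequence of seminorms (its grading) is a tame space if it is a tame direct summand, via some $L$ and $M$, of the space $\Sigma(B)$ of sequences $(f_k)_{k\ge0}$ in some Banach space $B$ with $\sum_k e^{nk}\|f_k\|_B<\infty$ for all $n\in\mathbb N$, graded by these sums. Then the gradings $(\|\cdot\|_n^{(\infty)})_n$ and $(\|\cdot\|_n^{(2)})_n$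 on $\mathfrak E$ are equivalent, and $\mathfrak E$ is a tame space with each of them. Moreover, with each of the two gradings, where $\mathfrak E_{[\mu]}$ carries the corresponding grading $(\|\cdot\|_{[\mu]n})_n$ and the product carries the sum grading $\|u_0\|_{[0]n}+\|u_1\|_{[1]n}$, the space $\mathfrak E$ is a tame direct summand of $\mathfrak E_{[0]}\times\mathfrak E_{[1]}$ via $u\mapsto(u^{[0]},u^{[1]})$ and $(u_0,u_1)\mapsto u_0+u_1$. -/

import Mathlib

noncomputable section

/-! ### Graded Fréchet spaces and tame spaces in the sense of Hamilton -/

/-- A linear map `L` is tame: for some degree `r` and base `b` it satisfies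
`‖L f‖_n ≤ C ‖f‖_{n+r}` for all `n ≥ b`, with a constant `C` that may depend on `n`. -/
def IsTameMap {F G : Type*} [AddCommGroup F] [Module ℝ F] [AddCommGroup G] [Module ℝ G]
    (p : ℕ → F → ℝ) (q : ℕ → G → ℝ) (L : F →ₗ[ℝ] G) : Prop :=
  ∃ r b : ℕ, ∀ n, b ≤ n → ∃ C : ℝ, ∀ f : F, q n (L f) ≤ C * p (n + r) f

/-- Two gradings on the same space are (tamely) equivalent, of some degree `r` and base `b`. -/
def TamelyEquivalent {F : Type*} (p q : ℕ → F → ℝ) : Prop :=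
  ∃ r b : ℕ, ∀ n, b ≤ n → ∃ C : ℝ, ∀ f : F, p n f ≤ C * q (n + r) f ∧ q n f ≤ C * p (n + r) f

/-- `(F, p)` is a tame direct summand of `(G, q)` through the linear maps `L : F → G`
and `M : G → F`. -/
structure IsTameDirectSummandVia {F G : Type*} [AddCommGroup F] [Module ℝ F] [AddCommGroup G]
    [Module ℝ G] (p : ℕ → F → ℝ) (q : ℕ → G → ℝ) (L : F →ₗ[ℝ] G) (M : G →ₗ[ℝ] F) : Prop where
  tame_left : IsTameMap p q L
  tame_right : IsTameMap q p M
  comp_eq_id : M ∘ₗ L = LinearMap.id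

/-- The space `Σ(B)` of exponentially decreasing sequences in `B`. -/
def ExpDecSeq (B : Type*) [NormedAddCommGroup B] [NormedSpace ℝ B] : Submodule ℝ (ℕ → B) where
  carrier := {f | ∀ n : ℕ, Summable fun k : ℕ => Real.exp (n * k) * ‖f k‖}
  zero_mem' := fun n => by simp
  add_mem' := by
    intro f g hf hg n
    refine Summable.of_nonneg_of_le (fun k => by positivity) (fun k => ?_) ((hf n).add (hg n))
    rw [← mul_add]
    exact mul_le_mul_of_nonneg_left (norm_add_le _ _) (Real.exp_pos _).le
  smul_mem' := by
    intro c f hf n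
    refine ((hf n).mul_left ‖c‖).congr fun k => ?_
    rw [Pi.smul_apply, norm_smul]
    ring

/-- The norms `∑_k e^{nk} ‖f_k‖` on `Σ(B)`. -/
def expDecNorm (B : Type*) [NormedAddCommGroup B] [NormedSpace ℝ B] (n : ℕ)
    (f : ExpDecSeq B) : ℝ :=
  ∑' k : ℕ, Real.exp (n * k) * ‖f.1 k‖

/-- The topological vector space `F` with the functions `p n` is a graded Fréchet space: the `p n`
are seminorms, increasing in `n`, that define the topology of `F`, and `F` is Hausdorff and
complete. -/
structure IsGradedFrechet {F : Type*} [AddCommGroup F] [Module ℝ F] [TopologicalSpace F]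
    (p : ℕ → F → ℝ) : Prop where
  monotone : ∀ f, Monotone fun n => p n f
  defines_topology : ∃ P : SeminormFamily ℝ F ℕ, (∀ n f, P n f = p n f) ∧ WithSeminorms P
  hausdorff : T2Space F
  complete : ∀ f : ℕ → F,
    (∀ n, ∀ ε : ℝ, 0 < ε → ∃ K, ∀ k l, K ≤ k → K ≤ l → p n (f k - f l) < ε) →
      ∃ g : F, Filter.Tendsto f Filter.atTop (nhds g)

/-- A graded Fréchet space is tame if it is a tame direct summand of `Σ(B)` for some
Banach space `B`. -/
def IsTameSpace {F : Type*} [AddCommGroup F] [Module ℝ F] [TopologicalSpace F]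
    (p : ℕ → F → ℝ) : Prop :=
  IsGradedFrechet p ∧
    ∃ (B : Type) (_ : NormedAddCommGroup B) (_ : NormedSpace ℝ B) (_ : CompleteSpace B)
      (L : F →ₗ[ℝ] ExpDecSeq B) (M : ExpDecSeq B →ₗ[ℝ] F),
      IsTameDirectSummandVia p (expDecNorm B) L M

/-- The grading of a Cartesian product. -/
def prodGrading {F G : Type*} (p : ℕ → F → ℝ) (q : ℕ → G → ℝ) (n : ℕ) (f : F × G) : ℝ :=
  p n f.1 + q n f.2

/-! ### The space of smooth functions on `[0,T] × [0,1]` -/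

/-- The rectangle `[0,T] × [0,1]`; its points are written `(t, x)`. -/
def rect (T : ℝ) : Set (ℝ × ℝ) := Set.Icc 0 T ×ˢ Set.Icc 0 1

/-- Smooth functions on the closed rectangle. A function on the rectangle is represented
by its extension by zero to the plane; the values outside carry no information. -/
def smoothSubmodule (T : ℝ) : Submodule ℝ (ℝ × ℝ → ℝ) where
  carrier := {u | ContDiffOn ℝ ((⊤ : ℕ∞) : WithTop ℕ∞) u (rect T) ∧ ∀ z, z ∉ rect T → u z = 0}
  zero_mem' := ⟨contDiffOn_const, fun _ _ => rfl⟩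
  add_mem' := fun hu hv => ⟨hu.1.add hv.1, fun z hz => by simp [hu.2 z hz, hv.2 z hz]⟩
  smul_mem' := fun c _ hu => ⟨contDiffOn_const.smul hu.1, fun z hz => by simp [hu.2 z hz]⟩

/-- The space `C^∞([0,T] × [0,1])`. -/
def SmoothRect (T : ℝ) : Type := smoothSubmodule T

instance (T : ℝ) : AddCommGroup (SmoothRect T) := inferInstanceAs (AddCommGroup (smoothSubmodule T))

instance (T : ℝ) : Module ℝ (SmoothRect T) := inferInstanceAs (Module ℝ (smoothSubmodule T))

/-- The derivative `∂/∂t` on the rectangle (one-sided at `t = 0` and `t = T`). -/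
def dt (T : ℝ) (f : ℝ × ℝ → ℝ) (z : ℝ × ℝ) : ℝ :=
  derivWithin (fun s => f (s, z.2)) (Set.Icc 0 T) z.1

/-- The derivative `∂/∂x` on the rectangle (one-sided at `x = 0` and `x = 1`). -/
def dx (f : ℝ × ℝ → ℝ) (z : ℝ × ℝ) : ℝ :=
  derivWithin (fun y => f (z.1, y)) (Set.Icc 0 1) z.2

/-- The usual topology of `C^∞([0,T] × [0,1])`: uniform convergence of every derivative
`∂_t^j ∂_x^k u` on the rectangle. -/
instance (T : ℝ) : TopologicalSpace (SmoothRect T) :=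
  TopologicalSpace.induced
    (fun (u : SmoothRect T) (i : ℕ × ℕ) =>
      UniformFun.ofFun fun z : rect T => ((dt T)^[i.1] (dx^[i.2] u.1)) z)
    inferInstance

/-! ### The cut-off decomposition -/

/-- Cut-off functions `ω`. -/
structure Cutoff where
  toFun : ℝ → ℝ
  smooth : ContDiff ℝ ((⊤ : ℕ∞) : WithTop ℕ∞) toFun
  eq_one : ∀ x, x ≤ 1 / 3 → toFun x = 1
  mem_Ioo : ∀ x, 1 / 3 < x → x < 2 / 3 → 0 < toFun x ∧ toFun x < 1
  eq_zero : ∀ x, 2 / 3 ≤ x → toFun x = 0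

/-- The functions `ω` (for `μ = 0`) and `1 - ω` (for `μ = 1`). -/
def Cutoff.part (ω : Cutoff) : Fin 2 → ℝ → ℝ
  | 0 => ω.toFun
  | 1 => fun x => 1 - ω.toFun x

lemma Cutoff.contDiff_part (ω : Cutoff) (μ : Fin 2) : ContDiff ℝ ((⊤ : ℕ∞) : WithTop ℕ∞) (ω.part μ) := by
  fin_cases μ
  · exact ω.smooth
  · exact contDiff_const.sub ω.smooth

/-- The linear map `u ↦ u^{[μ]}`, that is `u ↦ ω u` for `μ = 0` and `u ↦ (1 - ω) u`
for `μ = 1`. -/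
def cut (T : ℝ) (ω : Cutoff) (μ : Fin 2) : SmoothRect T →ₗ[ℝ] SmoothRect T where
  toFun u := ⟨fun z => ω.part μ z.2 * u.1 z,
    ((ω.contDiff_part μ).comp contDiff_snd).contDiffOn.mul u.2.1,
    fun z hz => by simp [u.2.2 z hz]⟩
  map_add' u v := Subtype.ext (funext fun z => mul_add (ω.part μ z.2) (u.1 z) (v.1 z))
  map_smul' c u := Subtype.ext (funext fun z => mul_left_comm (ω.part μ z.2) c (u.1 z))

/-- The interval of `x` on which the elements of `𝔈_{[μ]}` have to vanish. -/
def vanishSet : Fin 2 → Set ℝ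
  | 0 => Set.Icc (5 / 6) 1
  | 1 => Set.Icc 0 (1 / 6)

/-- The spaces `𝔈_{[0]}` and `𝔈_{[1]}`. -/
def sideSpace (T : ℝ) (μ : Fin 2) : Submodule ℝ (SmoothRect T) where
  carrier := {u | ∀ t x, x ∈ vanishSet μ → u.1 (t, x) = 0}
  zero_mem' := fun _ _ _ => rfl
  add_mem' := by
    intro u v hu hv t x hx
    change u.1 (t, x) + v.1 (t, x) = 0
    rw [hu t x hx, hv t x hx, add_zero]
  smul_mem' := by
    intro c u hu t x hx
    change c * u.1 (t, x) = 0
    rw [hu t x hx, mul_zero]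

lemma cut_mem (T : ℝ) (ω : Cutoff) (μ : Fin 2) (u : SmoothRect T) :
    cut T ω μ u ∈ sideSpace T μ := by
  intro t x hx
  change ω.part μ x * u.1 (t, x) = 0
  have h : ω.part μ x = 0 := by
    fin_cases μ
    · exact ω.eq_zero x (by have h := hx.1; linarith)
    · have h := ω.eq_one x (by have h := hx.2; linarith)
      change 1 - ω.toFun x = 0
      rw [h, sub_self]
  rw [h, zero_mul]

/-- The map `u ↦ (u^{[0]}, u^{[1]})`. -/
def splitMap (T : ℝ) (ω : Cutoff) : SmoothRect T →ₗ[ℝ] sideSpace T 0 × sideSpace T 1 :=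
  LinearMap.prod ((cut T ω 0).codRestrict _ (cut_mem T ω 0))
    ((cut T ω 1).codRestrict _ (cut_mem T ω 1))

/-- The map `(u₀, u₁) ↦ u₀ + u₁`. -/
def sumMap (T : ℝ) : sideSpace T 0 × sideSpace T 1 →ₗ[ℝ] SmoothRect T :=
  LinearMap.coprod (sideSpace T 0).subtype (sideSpace T 1).subtype

/-! ### The gradings -/

/-- The operators `△_{[0]} = x d²/dx² + (5/2) d/dx` and `△_{[1]} = X d²/dX² + (N/2) d/dX` with
`X = 1 - x`; the latter uses `d/dX = - d/dx`. -/
def lap (N : ℝ) : Fin 2 → (ℝ × ℝ → ℝ) → (ℝ × ℝ → ℝ)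
  | 0 => fun f z => z.2 * dx (dx f) z + 5 / 2 * dx f z
  | 1 => fun f z => (1 - z.2) * dx (dx f) z - N / 2 * dx f z

/-- The function `(-∂_t²)^j (-△_{[μ]})^k f`. -/
def mixed (T N : ℝ) (μ : Fin 2) (j k : ℕ) (f : ℝ × ℝ → ℝ) : ℝ × ℝ → ℝ :=
  (fun g z => -dt T (dt T g) z)^[j] ((fun g z => -lap N μ g z)^[k] f)

/-- The weights `x^{3/2}` and `(1-x)^{N/2-1}`. -/
def weight (N : ℝ) : Fin 2 → ℝ → ℝ
  | 0 => fun x => x ^ (3 / 2 : ℝ)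
  | 1 => fun x => (1 - x) ^ (N / 2 - 1)

/-- The pairs `(j, k)` with `j + k ≤ n`. -/
def pairs (n : ℕ) : Finset (ℕ × ℕ) :=
  (Finset.range (n + 1) ×ˢ Finset.range (n + 1)).filter fun i => i.1 + i.2 ≤ n

/-- The supremum norm over the rectangle. -/
def supNorm (T : ℝ) (f : ℝ × ℝ → ℝ) : ℝ := ⨆ z : rect T, |f z|

/-- The norm `‖u‖_{[μ]n}^{(∞)}`. -/
def sideSup (T N : ℝ) (μ : Fin 2) (n : ℕ) (u : SmoothRect T) : ℝ :=
  ⨆ i : pairs n, supNorm T (mixed T N μ i.1.1 i.1.2 u.1)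

/-- The norm `‖u‖_{[μ]n}^{(2)}`. -/
def sideL2 (T N : ℝ) (μ : Fin 2) (n : ℕ) (u : SmoothRect T) : ℝ :=
  √(∑ i ∈ pairs n, ∫ t in (0 : ℝ)..T, ∫ x in (0 : ℝ)..1,
      |mixed T N μ i.1 i.2 u.1 (t, x)| ^ 2 * weight N μ x)

/-- The combined norm `‖u‖_n^{(∞)}`. -/
def combSup (T N : ℝ) (ω : Cutoff) (n : ℕ) (u : SmoothRect T) : ℝ :=
  ⨆ μ : Fin 2, sideSup T N μ n (cut T ω μ u)

/-- The combined norm `‖u‖_n^{(2)}`. -/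
def combL2 (T N : ℝ) (ω : Cutoff) (n : ℕ) (u : SmoothRect T) : ℝ :=
  √(∑ μ : Fin 2, sideL2 T N μ n (cut T ω μ u) ^ 2)

/-- The grading `‖·‖_{[μ]n}^{(∞)}` on `𝔈_{[μ]}`. -/
def sideGradingSup (T N : ℝ) (μ : Fin 2) (n : ℕ) (u : sideSpace T μ) : ℝ := sideSup T N μ n u.1

/-- The grading `‖·‖_{[μ]n}^{(2)}` on `𝔈_{[μ]}`. -/
def sideGradingL2 (T N : ℝ) (μ : Fin 2) (n : ℕ) (u : sideSpace T μ) : ℝ := sideL2 T N μ n u.1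

end

/-!
All gradings are compared with one grading `W n` by weighted derivatives: it consists of the
supremum norms of `(x (1 - x))^j ∂_x^m ∂_t^a u` for `j ≤ k`, `m ≤ k + j`, `a + 2 k ≤ 2 n`. In this
scale `∂_x` and `x (1 - x) ∂_x²` have the same order as `∂_t²`, namely `1`.

*Supremum norms.* The operators `△ = x ∂_x² + ν ∂_x` have order `1`, so `W n` bounds the norms of
index `n`. Conversely `∂_x u` is bounded by `△ u`, as `x^ν ∂_x u` has the derivative `x^{ν-1} △ u`;
since `∂_x^m △ = (x ∂_x² + (ν + m) ∂_x) ∂_x^m`, the powers of `△` bound all weighted derivatives in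
`x` (`dom_pow_Dx`), and an elementary interpolation inequality yields the odd derivatives in `t`
(`dom_nrm_Dt`). So the combined supremum grading is equivalent to `W`, without loss of derivatives;
as `W` does not see the side `μ`, addition `𝔈_{[0]} × 𝔈_{[1]} → 𝔈` is tame.

*Square norms.* On functions that vanish near `x = 1`, the square norms of `△ u` and `∂_t² △ u`,
with weight `x^{ν-1}`, give `∂_x u = O(x^{-ν})`. Each further power of `△` improves the exponent of
the resulting bound `u = O(x^{-a})` by `1/2` (`exists_abs_le_l2sum`), so after finitely many steps
`u` is bounded in the supremum norm. The square norms therefore dominate the supremum norms with a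
loss of a fixed number of derivatives, and the converse is trivial.

*The topology.* The weighted grading is equivalent to the family `‖∂_t^j ∂_x^k u‖_∞`, because
unweighted derivatives occur in `W` as the terms with `j = 0`. Completeness follows by Taylor's
formula for the limits of the derivatives (`exists_tendsto_of_cauchy`).

*Tameness.* A graded Fréchet space is tame if its elements have expansions `∑ c_i(u) e_i` with
weights `w_i` such that `w_i^n |c_i(u)|` is bounded by a norm of `u` of index `n + r`, and
`‖e_i‖_n` by `w_i^{n+r}` (`IsGradedFrechet.isTameSpace`): the coefficients are sorted by the size of
the weights into sequences in `ℓ^∞`. For `𝔈` such an expansion is built as follows.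

- A cut-off in `t` and the reflection `t ↦ T - t` reduce to functions that vanish for `t > 2T/3`.
- These are extended beyond `t = 0` by `u(-t) = ∑ a_k u(2^k t)` with Seeley's sequence, whose
  moments `∑ a_k 2^{kn} = (-1)^n` come from the zeros of Euler's product (`exists_seeley`), and
  expanded in a Fourier series in `t`. The coefficients are integrals over `[0,T]` against a kernel
  whose iterated primitives vanish at `0`; integration by parts shows that they decrease rapidly.
- In `x` the functions are expanded in Chebyshev polynomials `T_m (1 - 2x)`, that is in cosines of
  `θ` with `x = (1 - cos θ) / 2`. They are eigenfunctions, with eigenvalues `-m²`, of the operator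
  `x (1 - x) ∂_x² + (1/2 - x) ∂_x`, which has order `1`; so the coefficients decrease rapidly with
  respect to `W`. Conversely, Chebyshev's differential equation bounds the weighted derivatives of
  `T_m` by the right powers of `1 + m²` (`exists_chebPoly_le`).

With the weights `1 + m² + j²` both estimates hold without loss.
-/

noncomputable section

open Set Filter Topology
open scoped ContDiff

set_option linter.unusedSectionVars false

theorem two_le_infty : (2 : WithTop ℕ∞) ≤ ∞ :=
  WithTop.coe_le_coe.2 (le_top : (2 : ℕ∞) ≤ ⊤)

/-! ### Smooth functions on the rectangle and the operators acting on them -/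

section Operators

variable {T : ℝ}

theorem uniqueDiffOn_rect (hT : 0 < T) : UniqueDiffOn ℝ (rect T) :=
  (uniqueDiffOn_Icc hT).prod (uniqueDiffOn_Icc one_pos)

theorem mem_closure_interior_rect (hT : 0 < T) {z : ℝ × ℝ} (hz : z ∈ rect T) :
    z ∈ closure (interior (rect T)) := by
  rw [rect, interior_prod_eq, interior_Icc, interior_Icc, closure_prod_eq, closure_Ioo hT.ne,
    closure_Ioo one_ne_zero.symm]
  exact hz

theorem isCompact_rect : IsCompact (rect T) := isCompact_Icc.prod isCompact_Icc

theorem rect_eq_zero_or {f : ℝ × ℝ → ℝ} (hf : ∀ z, z ∉ rect T → f z = 0) {z : ℝ × ℝ}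
    (hz : z ∉ rect T) : dt T f z = 0 ∧ dx f z = 0 := by
  constructor
  · by_cases h1 : z.1 ∈ Icc 0 T
    · have h2 : z.2 ∉ Icc (0 : ℝ) 1 := fun h => hz ⟨h1, h⟩
      have : (fun s => f (s, z.2)) = fun _ => 0 := funext fun s => hf _ fun h => h2 h.2
      simp [dt, this]
    · exact derivWithin_zero_of_notMem_closure (by rwa [isClosed_Icc.closure_eq])
  · by_cases h1 : z.2 ∈ Icc (0 : ℝ) 1
    · have h2 : z.1 ∉ Icc 0 T := fun h => hz ⟨h, h1⟩
      have : (fun s => f (z.1, s)) = fun _ => 0 := funext fun s => hf _ fun h => h2 h.1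
      simp [dx, this]
    · exact derivWithin_zero_of_notMem_closure (by rwa [isClosed_Icc.closure_eq])

theorem hasDerivWithinAt_fst {f : ℝ × ℝ → ℝ} {f' : ℝ × ℝ →L[ℝ] ℝ} {z : ℝ × ℝ} (hz : z ∈ rect T)
    (h : HasFDerivWithinAt f f' (rect T) z) :
    HasDerivWithinAt (fun s => f (s, z.2)) (f' (1, 0)) (Icc 0 T) z.1 := by
  have h1 : HasDerivWithinAt (fun s : ℝ => (s, z.2)) ((1 : ℝ), (0 : ℝ)) (Icc 0 T) z.1 :=
    (hasDerivWithinAt_id _ _).prodMk (hasDerivWithinAt_const _ _ _)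
  exact h.comp_hasDerivWithinAt (t := rect T) z.1 h1 (fun s hs => ⟨hs, hz.2⟩)

theorem hasDerivWithinAt_snd {f : ℝ × ℝ → ℝ} {f' : ℝ × ℝ →L[ℝ] ℝ} {z : ℝ × ℝ} (hz : z ∈ rect T)
    (h : HasFDerivWithinAt f f' (rect T) z) :
    HasDerivWithinAt (fun s => f (z.1, s)) (f' (0, 1)) (Icc 0 1) z.2 := by
  have h1 : HasDerivWithinAt (fun s : ℝ => (z.1, s)) ((0 : ℝ), (1 : ℝ)) (Icc 0 1) z.2 :=
    (hasDerivWithinAt_const _ _ _).prodMk (hasDerivWithinAt_id _ _)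
  exact h.comp_hasDerivWithinAt (t := rect T) z.2 h1 (fun s hs => ⟨hz.1, hs⟩)

namespace SmoothRect

theorem hasFDerivWithinAt (u : SmoothRect T) {z : ℝ × ℝ} (hz : z ∈ rect T) :
    HasFDerivWithinAt u.1 (fderivWithin ℝ u.1 (rect T) z) (rect T) z :=
  (u.2.1.differentiableOn (by simp) z hz).hasFDerivWithinAt

/-- Elements are determined by their values on the rectangle, as they vanish outside. -/
@[ext]
theorem ext {u v : SmoothRect T} (h : ∀ z ∈ rect T, u.1 z = v.1 z) : u = v := by
  refine Subtype.ext (funext fun z => ?_)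
  by_cases hz : z ∈ rect T
  · exact h z hz
  · rw [u.2.2 z hz, v.2.2 z hz]

@[simp] theorem add_val (u v : SmoothRect T) (z : ℝ × ℝ) : (u + v).1 z = u.1 z + v.1 z := rfl
@[simp] theorem neg_val (u : SmoothRect T) (z : ℝ × ℝ) : (-u).1 z = -u.1 z := rfl
@[simp] theorem sub_val (u v : SmoothRect T) (z : ℝ × ℝ) : (u - v).1 z = u.1 z - v.1 z := rfl
@[simp] theorem smul_val (c : ℝ) (u : SmoothRect T) (z : ℝ × ℝ) : (c • u).1 z = c * u.1 z := rfl
@[simp] theorem zero_val (z : ℝ × ℝ) : (0 : SmoothRect T).1 z = 0 := rfl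

/-- The element of `C^∞([0,T] × [0,1])` given by a function that is smooth on the rectangle: the
values outside are replaced by `0`. -/
def ofContDiffOn (f : ℝ × ℝ → ℝ) (hf : ContDiffOn ℝ ∞ f (rect T)) :
    SmoothRect T :=
  ⟨(rect T).indicator f, hf.congr fun _ hz => indicator_of_mem hz f,
    fun _ hz => indicator_of_notMem hz f⟩

theorem ofContDiffOn_val {f : ℝ × ℝ → ℝ}
    (hf : ContDiffOn ℝ ∞ f (rect T)) {z : ℝ × ℝ} (hz : z ∈ rect T) :
    (ofContDiffOn f hf).1 z = f z := indicator_of_mem hz f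

variable [hT : Fact (0 < T)]

theorem dt_eq (u : SmoothRect T) {z : ℝ × ℝ} (hz : z ∈ rect T) :
    dt T u.1 z = fderivWithin ℝ u.1 (rect T) z (1, 0) :=
  (hasDerivWithinAt_fst hz (u.hasFDerivWithinAt hz)).derivWithin
    (uniqueDiffOn_Icc hT.out _ hz.1)

theorem dx_eq (u : SmoothRect T) {z : ℝ × ℝ} (hz : z ∈ rect T) :
    dx u.1 z = fderivWithin ℝ u.1 (rect T) z (0, 1) :=
  (hasDerivWithinAt_snd hz (u.hasFDerivWithinAt hz)).derivWithin
    (uniqueDiffOn_Icc one_pos _ hz.2)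

theorem hasDerivWithinAt_dt (u : SmoothRect T) {z : ℝ × ℝ} (hz : z ∈ rect T) :
    HasDerivWithinAt (fun s => u.1 (s, z.2)) (dt T u.1 z) (Icc 0 T) z.1 := by
  rw [dt_eq u hz]
  exact hasDerivWithinAt_fst hz (u.hasFDerivWithinAt hz)

theorem hasDerivWithinAt_dx (u : SmoothRect T) {z : ℝ × ℝ} (hz : z ∈ rect T) :
    HasDerivWithinAt (fun s => u.1 (z.1, s)) (dx u.1 z) (Icc 0 1) z.2 := by
  rw [dx_eq u hz]
  exact hasDerivWithinAt_snd hz (u.hasFDerivWithinAt hz)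

theorem contDiffOn_fderivWithin_apply (u : SmoothRect T) (v : ℝ × ℝ) :
    ContDiffOn ℝ ∞ (fun z => fderivWithin ℝ u.1 (rect T) z v) (rect T) :=
  (u.2.1.fderivWithin (uniqueDiffOn_rect hT.out) (by simp)).clm_apply contDiffOn_const

theorem dt_unique {u : SmoothRect T} {z : ℝ × ℝ} (hz : z ∈ rect T) {c : ℝ}
    (h : HasDerivWithinAt (fun s => u.1 (s, z.2)) c (Icc 0 T) z.1) : dt T u.1 z = c :=
  h.derivWithin (uniqueDiffOn_Icc hT.out _ hz.1)

theorem dx_unique {u : SmoothRect T} {z : ℝ × ℝ} (hz : z ∈ rect T) {c : ℝ}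
    (h : HasDerivWithinAt (fun s => u.1 (z.1, s)) c (Icc 0 1) z.2) : dx u.1 z = c :=
  h.derivWithin (uniqueDiffOn_Icc one_pos _ hz.2)

/-- The operator `∂/∂t` on `C^∞([0,T] × [0,1])`. -/
def Dt : Module.End ℝ (SmoothRect T) where
  toFun u := ⟨dt T u.1, (contDiffOn_fderivWithin_apply u (1, 0)).congr fun _ hz => dt_eq u hz,
    fun _ hz => (rect_eq_zero_or u.2.2 hz).1⟩
  map_add' u v := ext fun _ hz =>
    dt_unique hz ((u.hasDerivWithinAt_dt hz).add (v.hasDerivWithinAt_dt hz))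
  map_smul' c u := ext fun _ hz => dt_unique hz ((u.hasDerivWithinAt_dt hz).const_mul c)

/-- The operator `∂/∂x` on `C^∞([0,T] × [0,1])`. -/
def Dx : Module.End ℝ (SmoothRect T) where
  toFun u := ⟨dx u.1, (contDiffOn_fderivWithin_apply u (0, 1)).congr fun _ hz => dx_eq u hz,
    fun _ hz => (rect_eq_zero_or u.2.2 hz).2⟩
  map_add' u v := ext fun _ hz =>
    dx_unique hz ((u.hasDerivWithinAt_dx hz).add (v.hasDerivWithinAt_dx hz))
  map_smul' c u := ext fun _ hz => dx_unique hz ((u.hasDerivWithinAt_dx hz).const_mul c)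

/-- Multiplication by a smooth function of `x`. -/
def mulX (φ : ℝ → ℝ) (hφ : ContDiff ℝ ∞ φ) :
    Module.End ℝ (SmoothRect T) where
  toFun u := ⟨fun z => φ z.2 * u.1 z, (hφ.comp contDiff_snd).contDiffOn.mul u.2.1,
    fun z hz => by simp [u.2.2 z hz]⟩
  map_add' u v := ext fun z _ => mul_add (φ z.2) (u.1 z) (v.1 z)
  map_smul' c u := ext fun z _ => mul_left_comm (φ z.2) c (u.1 z)

theorem mem_rect_reflect {z : ℝ × ℝ} : (z.1, 1 - z.2) ∈ rect T ↔ z ∈ rect T := by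
  simp only [rect, mem_prod, mem_Icc]
  constructor <;> rintro ⟨h1, h2, h3⟩ <;> exact ⟨h1, by linarith, by linarith⟩

/-- The reflection `x ↦ 1 - x`. -/
def reflect : Module.End ℝ (SmoothRect T) where
  toFun u := ⟨fun z => u.1 (z.1, 1 - z.2),
    u.2.1.comp (t := rect T) (contDiff_fst.prodMk (contDiff_const.sub contDiff_snd)).contDiffOn
      fun _ hz => mem_rect_reflect.2 hz,
    fun _ hz => u.2.2 _ fun h => hz (mem_rect_reflect.1 h)⟩
  map_add' _ _ := rfl
  map_smul' _ _ := rfl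

theorem Dt_val (u : SmoothRect T) : (Dt u).1 = dt T u.1 := rfl
theorem Dx_val (u : SmoothRect T) : (Dx u).1 = dx u.1 := rfl
@[simp] theorem mulX_val (φ : ℝ → ℝ) (hφ) (u : SmoothRect T) (z : ℝ × ℝ) :
    (mulX φ hφ u).1 z = φ z.2 * u.1 z := rfl
@[simp] theorem reflect_val (u : SmoothRect T) (z : ℝ × ℝ) :
    (reflect u).1 z = u.1 (z.1, 1 - z.2) := rfl

theorem hasDerivWithinAt_Dt (u : SmoothRect T) {t x : ℝ} (ht : t ∈ Icc 0 T)
    (hx : x ∈ Icc (0 : ℝ) 1) :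
    HasDerivWithinAt (fun s => u.1 (s, x)) ((Dt u).1 (t, x)) (Icc 0 T) t :=
  u.hasDerivWithinAt_dt (z := (t, x)) ⟨ht, hx⟩

theorem hasDerivWithinAt_Dx (u : SmoothRect T) {t x : ℝ} (ht : t ∈ Icc 0 T)
    (hx : x ∈ Icc (0 : ℝ) 1) :
    HasDerivWithinAt (fun y => u.1 (t, y)) ((Dx u).1 (t, x)) (Icc 0 1) x :=
  u.hasDerivWithinAt_dx (z := (t, x)) ⟨ht, hx⟩

theorem contDiff_deriv {φ : ℝ → ℝ} (hφ : ContDiff ℝ ∞ φ) :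
    ContDiff ℝ ∞ (deriv φ) :=
  (contDiff_infty_iff_deriv.1 hφ).2

theorem Dx_mulX (φ : ℝ → ℝ) (hφ : ContDiff ℝ ∞ φ) (u : SmoothRect T) :
    Dx (mulX φ hφ u) = mulX (deriv φ) (contDiff_deriv hφ) u + mulX φ hφ (Dx u) :=
  ext fun z hz => dx_unique hz
    (((hφ.differentiable (by simp) z.2).hasDerivAt.hasDerivWithinAt).mul (u.hasDerivWithinAt_dx hz))

theorem Dt_mulX (φ : ℝ → ℝ) (hφ : ContDiff ℝ ∞ φ) (u : SmoothRect T) :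
    Dt (mulX φ hφ u) = mulX φ hφ (Dt u) :=
  ext fun z hz => dt_unique hz ((u.hasDerivWithinAt_dt hz).const_mul (φ z.2))

theorem mulX_congr {φ ψ : ℝ → ℝ} (hφ hψ) {u : SmoothRect T}
    (h : ∀ t ∈ Icc 0 T, ∀ x ∈ Icc (0 : ℝ) 1, φ x * u.1 (t, x) = ψ x * u.1 (t, x)) :
    mulX φ hφ u = mulX ψ hψ u := ext fun z hz => h z.1 hz.1 z.2 hz.2

theorem mulX_mulX {φ ψ : ℝ → ℝ} (hφ hψ) (u : SmoothRect T) :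
    mulX φ hφ (mulX ψ hψ u) = mulX (fun x => φ x * ψ x) (hφ.mul hψ) u :=
  ext fun z _ => (mul_assoc (φ z.2) (ψ z.2) (u.1 z)).symm

theorem reflect_reflect (u : SmoothRect T) : reflect (reflect u) = u :=
  ext fun z _ => by simp

theorem Dt_reflect (u : SmoothRect T) : Dt (reflect u) = reflect (Dt u) :=
  ext fun _ hz => dt_unique hz (u.hasDerivWithinAt_dt (mem_rect_reflect.2 hz))

theorem Dx_reflect (u : SmoothRect T) : Dx (reflect u) = -reflect (Dx u) := by
  refine ext fun z hz => dx_unique hz ?_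
  have h := u.hasDerivWithinAt_dx (mem_rect_reflect.2 hz)
  have h1 : HasDerivWithinAt (fun y : ℝ => 1 - y) (-1) (Icc 0 1) z.2 :=
    (hasDerivWithinAt_id _ _).const_sub 1
  have := HasDerivWithinAt.comp (s' := Icc 0 1) z.2 h h1
    (fun y hy => ⟨by linarith [hy.2], by linarith [hy.1]⟩)
  simpa [Function.comp_def, Dx_val] using this

/-- The mixed one-sided derivatives agree: at the edges too, the second derivative within the
rectangle is symmetric, as the rectangle is the closure of its interior. -/
theorem Dt_Dx (u : SmoothRect T) : Dt (Dx u) = Dx (Dt u) := by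
  ext z hz
  have hs := uniqueDiffOn_rect hT.out
  have hsymm : IsSymmSndFDerivWithinAt ℝ u.1 (rect T) z :=
    (u.2.1 z hz).isSymmSndFDerivWithinAt (by simpa using two_le_infty) hs
      (mem_closure_interior_rect hT.out hz) hz
  have hd : DifferentiableWithinAt ℝ (fderivWithin ℝ u.1 (rect T)) (rect T) z :=
    (u.2.1.fderivWithin (m := ∞) hs (by simp)).differentiableOn (by simp) z hz
  have key : ∀ v : ℝ × ℝ, fderivWithin ℝ (fun z => fderivWithin ℝ u.1 (rect T) z v) (rect T) z =
      (fderivWithin ℝ (fderivWithin ℝ u.1 (rect T)) (rect T) z).flip v := by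
    intro v
    rw [fderivWithin_clm_apply (hs z hz) hd (differentiableWithinAt_const v)]
    simp
  change dt T (Dx u).1 z = dx (Dt u).1 z
  rw [dt_eq _ hz, dx_eq _ hz,
    fderivWithin_congr (f₁ := (Dx u).1) (fun y hy => dx_eq u hy) (dx_eq u hz),
    fderivWithin_congr (f₁ := (Dt u).1) (fun y hy => dt_eq u hy) (dt_eq u hz), key, key]
  exact hsymm _ _

theorem continuousOn (u : SmoothRect T) : ContinuousOn u.1 (rect T) := u.2.1.continuousOn

theorem bddAbove_abs (u : SmoothRect T) : BddAbove (range fun z : rect T => |u.1 z|) := by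
  have h := isCompact_rect.bddAbove_image u.2.1.continuousOn.abs
  rwa [image_eq_range] at h

end SmoothRect
end Operators

/-! ### Domination of functions up to a constant -/

/-- `f` is bounded by a constant multiple of `g`. All estimates between gradings are stated in this
form, the constants being irrelevant for tameness. -/
def Dom {α : Type*} (f g : α → ℝ) : Prop := ∃ C : ℝ, 0 ≤ C ∧ ∀ a, f a ≤ C * g a

namespace Dom

variable {α β ι : Type*} {f g h : α → ℝ}

theorem of_le (H : ∀ a, f a ≤ g a) : Dom f g := ⟨1, zero_le_one, fun a => by simpa using H a⟩

theorem trans (H : Dom f g) (H' : Dom g h) : Dom f h := by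
  obtain ⟨C, hC, H⟩ := H
  obtain ⟨D, hD, H'⟩ := H'
  exact ⟨C * D, mul_nonneg hC hD, fun a =>
    (H a).trans ((mul_le_mul_of_nonneg_left (H' a) hC).trans_eq (mul_assoc _ _ _).symm)⟩

theorem trans_le (H : Dom f g) (H' : ∀ a, g a ≤ h a) : Dom f h := H.trans (of_le H')

theorem le_trans (H : ∀ a, f a ≤ g a) (H' : Dom g h) : Dom f h := (of_le H).trans H'

theorem comp (H : Dom f g) (L : β → α) : Dom (fun b => f (L b)) fun b => g (L b) := by
  obtain ⟨C, hC, H⟩ := H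
  exact ⟨C, hC, fun b => H (L b)⟩

theorem add (H : Dom f h) (H' : Dom g h) : Dom (fun a => f a + g a) h := by
  obtain ⟨C, hC, H⟩ := H
  obtain ⟨D, hD, H'⟩ := H'
  exact ⟨C + D, add_nonneg hC hD, fun a => by rw [add_mul]; exact add_le_add (H a) (H' a)⟩

theorem const_mul (H : Dom f g) {c : ℝ} (hc : 0 ≤ c) : Dom (fun a => c * f a) g := by
  obtain ⟨C, hC, H⟩ := H
  exact ⟨c * C, mul_nonneg hc hC, fun a => by
    rw [mul_assoc]; exact mul_le_mul_of_nonneg_left (H a) hc⟩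

theorem sum {s : Finset ι} {F : ι → α → ℝ} (H : ∀ i ∈ s, Dom (F i) g) :
    Dom (fun a => ∑ i ∈ s, F i a) g := by
  classical
  induction s using Finset.induction_on with
  | empty => exact ⟨0, le_rfl, fun a => by simp⟩
  | insert i s hi ih =>
    simp only [Finset.sum_insert hi]
    exact (H i (Finset.mem_insert_self i s)).add
      (ih fun j hj => H j (Finset.mem_insert_of_mem hj))

end Dom

namespace SmoothRect

variable {T : ℝ} [hT : Fact (0 < T)]

/-! ### The supremum norm -/

/-- The supremum norm on `C^∞([0,T] × [0,1])`. -/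
def nrm (u : SmoothRect T) : ℝ := supNorm T u.1

theorem abs_le_nrm (u : SmoothRect T) {z : ℝ × ℝ} (hz : z ∈ rect T) : |u.1 z| ≤ nrm u :=
  le_ciSup u.bddAbove_abs ⟨z, hz⟩

theorem nrm_le {u : SmoothRect T} {C : ℝ}
    (h : ∀ t ∈ Icc 0 T, ∀ x ∈ Icc (0 : ℝ) 1, |u.1 (t, x)| ≤ C) : nrm u ≤ C := by
  have : Nonempty (rect T) := ⟨⟨(0, 0), ⟨le_rfl, hT.out.le⟩, ⟨le_rfl, zero_le_one⟩⟩⟩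
  exact ciSup_le fun z => h z.1.1 z.2.1 z.1.2 z.2.2

theorem nrm_nonneg (u : SmoothRect T) : 0 ≤ nrm u := Real.iSup_nonneg fun _ => abs_nonneg _

@[simp] theorem nrm_zero : nrm (0 : SmoothRect T) = 0 :=
  (nrm_le fun t _ x _ => by simp).antisymm (nrm_nonneg _)

theorem nrm_add_le (u v : SmoothRect T) : nrm (u + v) ≤ nrm u + nrm v :=
  nrm_le fun _ ht _ hx => (abs_add_le _ _).trans
    (add_le_add (u.abs_le_nrm ⟨ht, hx⟩) (v.abs_le_nrm ⟨ht, hx⟩))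

theorem nrm_smul (c : ℝ) (u : SmoothRect T) : nrm (c • u) = |c| * nrm u := by
  simp only [nrm, supNorm, smul_val, abs_mul]
  exact (Real.mul_iSup_of_nonneg (abs_nonneg c) _).symm

@[simp] theorem nrm_neg (u : SmoothRect T) : nrm (-u) = nrm u := by
  simp only [nrm, supNorm, neg_val, abs_neg]

theorem nrm_sub_le (u v : SmoothRect T) : nrm (u - v) ≤ nrm u + nrm v := by
  rw [sub_eq_add_neg, ← nrm_neg v]
  exact nrm_add_le _ _

@[simp] theorem nrm_reflect (u : SmoothRect T) : nrm (reflect u) = nrm u := by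
  have key : ∀ v : SmoothRect T, nrm (reflect v) ≤ nrm v := fun v => nrm_le fun t ht x hx =>
    v.abs_le_nrm (z := (t, 1 - x)) (mem_rect_reflect (z := (t, x)).2 ⟨ht, hx⟩)
  refine (key u).antisymm ?_
  simpa only [reflect_reflect] using key (reflect u)

theorem nrm_mulX_le_of_abs_le {φ ψ : ℝ → ℝ} (hφ hψ) {c : ℝ}
    (h : ∀ x ∈ Icc (0 : ℝ) 1, |φ x| ≤ c * |ψ x|) (u : SmoothRect T) :
    nrm (mulX φ hφ u) ≤ c * nrm (mulX ψ hψ u) := by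
  have hc : 0 ≤ c ∨ ∀ x ∈ Icc (0 : ℝ) 1, ψ x = 0 := by
    by_contra! H
    obtain ⟨hc, x, hx, hψx⟩ := H
    have := h x hx
    nlinarith [abs_nonneg (φ x), abs_pos.2 hψx]
  rcases hc with hc | h0
  · refine nrm_le fun t ht x hx => ?_
    have h2 := (mulX ψ hψ u).abs_le_nrm (z := (t, x)) ⟨ht, hx⟩
    rw [mulX_val, abs_mul] at h2 ⊢
    calc |φ x| * |u.1 (t, x)| ≤ (c * |ψ x|) * |u.1 (t, x)| :=
          mul_le_mul_of_nonneg_right (h x hx) (abs_nonneg _)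
      _ = c * (|ψ x| * |u.1 (t, x)|) := mul_assoc _ _ _
      _ ≤ _ := mul_le_mul_of_nonneg_left h2 hc
  · have h1 : mulX ψ hψ u = 0 := ext fun z hz => by simp [h0 z.2 hz.2]
    have h2 : mulX φ hφ u = 0 := ext fun z hz => by
      have := h z.2 hz.2
      rw [h0 z.2 hz.2, abs_zero, mul_zero] at this
      simp [abs_nonpos_iff.1 this]
    simp [h1, h2]

theorem exists_bound_of_contDiff {φ : ℝ → ℝ} (hφ : ContDiff ℝ ∞ φ) :
    ∃ C : ℝ, 0 ≤ C ∧ ∀ x ∈ Icc (0 : ℝ) 1, |φ x| ≤ C := by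
  obtain ⟨C, hC⟩ := isCompact_Icc.exists_bound_of_continuousOn (s := Icc (0 : ℝ) 1)
    hφ.continuous.continuousOn
  exact ⟨C, (norm_nonneg _).trans (hC 0 ⟨le_rfl, zero_le_one⟩), hC⟩

theorem dom_nrm_mulX {φ : ℝ → ℝ} (hφ : ContDiff ℝ ∞ φ) :
    Dom (fun u : SmoothRect T => nrm (mulX φ hφ u)) nrm := by
  obtain ⟨C, hC, h⟩ := exists_bound_of_contDiff hφ
  refine ⟨C, hC, fun u => nrm_le fun t ht x hx => ?_⟩
  rw [mulX_val, abs_mul]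
  exact mul_le_mul (h x hx) (u.abs_le_nrm ⟨ht, hx⟩) (abs_nonneg _) hC

theorem mulX_comm {φ ψ : ℝ → ℝ} (hφ hψ) (u : SmoothRect T) :
    mulX φ hφ (mulX ψ hψ u) = mulX ψ hψ (mulX φ hφ u) :=
  ext fun z _ => mul_left_comm (φ z.2) (ψ z.2) (u.1 z)

theorem pow_apply_self (A : Module.End ℝ (SmoothRect T)) (m : ℕ) (u : SmoothRect T) :
    (A ^ m) (A u) = (A ^ (m + 1)) u := by
  rw [pow_succ, Module.End.mul_apply]

/-! ### Weighted norms and the Leibniz rule -/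

/-- The commutator of `∂_x^m` with the multiplication by a smooth function has order
less than `m`. -/
theorem dom_commutator {χ : ℝ → ℝ} (hχ : ContDiff ℝ ∞ χ) (m : ℕ) :
    ∀ {φ : ℝ → ℝ} (hφ : ContDiff ℝ ∞ φ),
    Dom (fun u : SmoothRect T =>
        nrm (mulX χ hχ ((Dx ^ m) (mulX φ hφ u)) - mulX φ hφ (mulX χ hχ ((Dx ^ m) u))))
      fun u => ∑ i ∈ Finset.range m, nrm (mulX χ hχ ((Dx ^ i) u)) := by
  induction m with
  | zero =>
    intro φ hφ
    refine Dom.of_le fun u => ?_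
    simp [mulX_comm hχ hφ]
  | succ m ih =>
    intro φ hφ
    have h1 := (ih (contDiff_deriv hφ)).trans_le
      (h := fun u => ∑ i ∈ Finset.range (m + 1), nrm (mulX χ hχ ((Dx ^ i) u)))
      fun u => Finset.sum_le_sum_of_subset_of_nonneg
        (Finset.range_mono (Nat.le_succ m)) fun _ _ _ => nrm_nonneg _
    have h2 := ((ih hφ).comp Dx).trans_le
      (h := fun u => ∑ i ∈ Finset.range (m + 1), nrm (mulX χ hχ ((Dx ^ i) u))) fun u => by
        rw [Finset.sum_range_succ']
        exact le_add_of_le_of_nonneg (le_of_eq (by simp [pow_succ])) (nrm_nonneg _)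
    have h3 := ((dom_nrm_mulX (T := T) (contDiff_deriv hφ)).comp
      fun u => mulX χ hχ ((Dx ^ m) u)).trans_le
      (h := fun u => ∑ i ∈ Finset.range (m + 1), nrm (mulX χ hχ ((Dx ^ i) u)))
      fun u => Finset.single_le_sum (f := fun i => nrm (mulX χ hχ ((Dx ^ i) u)))
        (fun _ _ => nrm_nonneg _) (Finset.self_mem_range_succ m)
    refine Dom.le_trans (fun u => ?_) ((h1.add h2).add h3)
    have hD : (Dx ^ (m + 1)) (mulX φ hφ u) = (Dx ^ m) (mulX (deriv φ) (contDiff_deriv hφ) u) +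
        (Dx ^ m) (mulX φ hφ (Dx u)) := by
      rw [pow_succ, Module.End.mul_apply, Dx_mulX, map_add]
    have hE : mulX χ hχ ((Dx ^ (m + 1)) (mulX φ hφ u)) -
        mulX φ hφ (mulX χ hχ ((Dx ^ (m + 1)) u)) =
        ((mulX χ hχ ((Dx ^ m) (mulX (deriv φ) (contDiff_deriv hφ) u)) -
          mulX (deriv φ) (contDiff_deriv hφ) (mulX χ hχ ((Dx ^ m) u))) +
        (mulX χ hχ ((Dx ^ m) (mulX φ hφ (Dx u))) -
          mulX φ hφ (mulX χ hχ ((Dx ^ m) (Dx u))))) +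
          mulX (deriv φ) (contDiff_deriv hφ) (mulX χ hχ ((Dx ^ m) u)) := by
      rw [hD, map_add, pow_succ, Module.End.mul_apply]
      abel
    rw [hE]
    exact (nrm_add_le _ _).trans (add_le_add_left (nrm_add_le _ _) _)

theorem dom_leibniz {χ : ℝ → ℝ} (hχ : ContDiff ℝ ∞ χ) (m : ℕ) {φ : ℝ → ℝ}
    (hφ : ContDiff ℝ ∞ φ) :
    Dom (fun u : SmoothRect T => nrm (mulX χ hχ ((Dx ^ m) (mulX φ hφ u))))
      fun u => ∑ i ∈ Finset.range (m + 1), nrm (mulX χ hχ ((Dx ^ i) u)) := by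
  have h1 := (dom_commutator (T := T) hχ m hφ).trans_le
      (h := fun u => ∑ i ∈ Finset.range (m + 1), nrm (mulX χ hχ ((Dx ^ i) u)))
      fun u => Finset.sum_le_sum_of_subset_of_nonneg
        (Finset.range_mono (Nat.le_succ m)) fun _ _ _ => nrm_nonneg _
  have h3 := ((dom_nrm_mulX (T := T) hφ).comp
      fun u => mulX χ hχ ((Dx ^ m) u)).trans_le
      (h := fun u => ∑ i ∈ Finset.range (m + 1), nrm (mulX χ hχ ((Dx ^ i) u)))
      fun u => Finset.single_le_sum (f := fun i => nrm (mulX χ hχ ((Dx ^ i) u)))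
        (fun _ _ => nrm_nonneg _) (Finset.self_mem_range_succ m)
  refine Dom.le_trans (fun u => ?_) (h1.add h3)
  refine le_trans (le_of_eq ?_) (nrm_add_le _ _)
  rw [sub_add_cancel]

/-- The weighted norm `∑ ‖σ^j ∂_x^m u‖_∞` over `j ≤ k` and `m ≤ k + j`. With `σ = x` or
`σ = x (1 - x)` the operator `σ ∂_x²` has the same order `1` as `∂_x` with respect to the index
`k`. -/
def wnrm (σ : ℝ → ℝ) (hσ : ContDiff ℝ ∞ σ) (k : ℕ) (u : SmoothRect T) : ℝ :=
  ∑ j ∈ Finset.range (k + 1), ∑ m ∈ Finset.range (k + j + 1),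
    nrm (mulX (fun x => σ x ^ j) (hσ.pow j) ((Dx ^ m) u))

section wnrm

variable {σ : ℝ → ℝ} (hσ : ContDiff ℝ ∞ σ)

theorem nrm_le_wnrm {k j m : ℕ} (hj : j ≤ k) (hm : m ≤ k + j) (u : SmoothRect T) :
    nrm (mulX (fun x => σ x ^ j) (hσ.pow j) ((Dx ^ m) u)) ≤ wnrm σ hσ k u := by
  refine le_trans ?_ (Finset.single_le_sum (f := fun j => ∑ m ∈ Finset.range (k + j + 1),
    nrm (mulX (fun x => σ x ^ j) (hσ.pow j) ((Dx ^ m) u)))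
    (fun _ _ => Finset.sum_nonneg fun _ _ => nrm_nonneg _)
    (Finset.mem_range.2 (Nat.lt_succ_of_le hj)))
  exact Finset.single_le_sum (f := fun m =>
    nrm (mulX (fun x => σ x ^ j) (hσ.pow j) ((Dx ^ m) u)))
    (fun _ _ => nrm_nonneg _) (Finset.mem_range.2 (Nat.lt_succ_of_le hm))

theorem dom_wnrm {α : Type*} {k : ℕ} {P : α → SmoothRect T} {g : α → ℝ}
    (h : ∀ j ≤ k, ∀ m ≤ k + j,
      Dom (fun a => nrm (mulX (fun x => σ x ^ j) (hσ.pow j) ((Dx ^ m) (P a)))) g) :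
    Dom (fun a => wnrm σ hσ k (P a)) g :=
  Dom.sum fun j hj => Dom.sum fun m hm => h j (by simpa [Nat.lt_succ_iff] using hj) m
    (by simpa [Nat.lt_succ_iff] using hm)

theorem wnrm_nonneg (k : ℕ) (u : SmoothRect T) : 0 ≤ wnrm σ hσ k u :=
  Finset.sum_nonneg fun _ _ => Finset.sum_nonneg fun _ _ => nrm_nonneg _

theorem wnrm_add_le (k : ℕ) (u v : SmoothRect T) :
    wnrm σ hσ k (u + v) ≤ wnrm σ hσ k u + wnrm σ hσ k v := by
  simp only [wnrm, ← Finset.sum_add_distrib, map_add]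
  exact Finset.sum_le_sum fun _ _ => Finset.sum_le_sum fun _ _ => nrm_add_le _ _

theorem wnrm_smul (k : ℕ) (c : ℝ) (u : SmoothRect T) :
    wnrm σ hσ k (c • u) = |c| * wnrm σ hσ k u := by
  simp only [wnrm, map_smul, nrm_smul, Finset.mul_sum]

theorem dom_wnrm_mulX (k : ℕ) {φ : ℝ → ℝ} (hφ : ContDiff ℝ ∞ φ) :
    Dom (fun u : SmoothRect T => wnrm σ hσ k (mulX φ hφ u)) (wnrm σ hσ k) :=
  dom_wnrm hσ fun j hj m hm => (dom_leibniz (hσ.pow j) m hφ).trans <| Dom.sum fun i hi =>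
    Dom.of_le (nrm_le_wnrm hσ hj (by have := Finset.mem_range.1 hi; lia))

theorem dom_wnrm_Dx (k : ℕ) :
    Dom (fun u : SmoothRect T => wnrm σ hσ k (Dx u)) (wnrm σ hσ (k + 1)) :=
  dom_wnrm hσ fun j hj m hm => Dom.of_le fun u => by
    rw [pow_apply_self]
    exact nrm_le_wnrm hσ (by lia) (by lia) u

/-- The commutator of `∂_x^m` with `σ` has lower order, and `σ · σ^j ∂_x^m ∂_x²` is one of the terms
of the norm of index `k + 1`. -/
theorem dom_wnrm_sq (k : ℕ) :
    Dom (fun u : SmoothRect T => wnrm σ hσ k (mulX σ hσ (Dx (Dx u)))) (wnrm σ hσ (k + 1)) := by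
  refine dom_wnrm hσ fun j hj m hm => ?_
  have h1 := ((dom_commutator (T := T) (hσ.pow j) m hσ).comp fun u => Dx (Dx u)).trans
    (h := wnrm σ hσ (k + 1)) (Dom.sum fun i hi => Dom.of_le fun u => by
      rw [pow_apply_self, pow_apply_self]
      exact nrm_le_wnrm hσ (by lia) (by have := Finset.mem_range.1 hi; lia) u)
  have h2 : Dom (fun u : SmoothRect T =>
      nrm (mulX σ hσ (mulX (fun x => σ x ^ j) (hσ.pow j) ((Dx ^ m) (Dx (Dx u))))))
      (wnrm σ hσ (k + 1)) := Dom.of_le fun u => by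
    rw [pow_apply_self, pow_apply_self, mulX_mulX]
    refine le_trans (le_of_eq ?_) (nrm_le_wnrm hσ (j := j + 1) (m := m + 2) (by lia) (by lia) u)
    congr 1
    exact mulX_congr _ _ fun _ _ x _ => by ring
  refine Dom.le_trans (fun u => ?_) (h1.add h2)
  refine le_trans (le_of_eq ?_) (nrm_add_le _ _)
  rw [sub_add_cancel]

theorem dom_wnrm_pow {P : Module.End ℝ (SmoothRect T)}
    (hP : ∀ k, Dom (fun u => wnrm σ hσ k (P u)) (wnrm σ hσ (k + 1))) (k : ℕ) :
    Dom (fun u => nrm ((P ^ k) u)) (wnrm σ hσ k) := by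
  have key : ∀ k i, Dom (fun u => wnrm σ hσ i ((P ^ k) u)) (wnrm σ hσ (i + k)) := by
    intro k
    induction k with
    | zero => exact fun i => Dom.of_le fun u => le_of_eq (by simp)
    | succ k ih =>
      intro i
      simp only [pow_succ, Module.End.mul_apply]
      exact ((ih i).comp P).trans (hP (i + k))
  have := key k 0
  rw [zero_add] at this
  refine Dom.le_trans (fun u => ?_) this
  refine le_trans (le_of_eq ?_) (nrm_le_wnrm hσ (j := 0) (m := 0) le_rfl le_rfl _)
  congr 1
  ext z _
  simp

end wnrm

end SmoothRect

/-! ### The operators `x ∂² + ν ∂` -/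

/-- One half of `abs_le_of_abs_mul_add_le`: the function `x^ν g - K x^{ν-a} / (ν - a)` is
nonincreasing and vanishes at `0`. -/
theorem le_of_mul_add_le {ν a K : ℝ} (ha : 0 ≤ a) (hν : a < ν) {g g' : ℝ → ℝ}
    (hg : ∀ x ∈ Icc (0 : ℝ) 1, HasDerivWithinAt g (g' x) (Icc 0 1) x)
    (h : ∀ x ∈ Ioo (0 : ℝ) 1, x * g' x + ν * g x ≤ K * x ^ (-a)) {x : ℝ} (hx : x ∈ Ioc (0 : ℝ) 1) :
    g x ≤ K / (ν - a) * x ^ (-a) := by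
  have hνa : 0 < ν - a := sub_pos.2 hν
  have hν0 : 0 < ν := ha.trans_lt hν
  set φ : ℝ → ℝ := fun x => x ^ ν * g x - K / (ν - a) * x ^ (ν - a) with hφ
  have hanti : AntitoneOn φ (Icc 0 1) := by
    refine antitoneOn_of_deriv_nonpos (convex_Icc 0 1) ?_ ?_ ?_
    · refine ContinuousOn.sub (ContinuousOn.mul ?_ fun y hy => (hg y hy).continuousWithinAt)
        (continuousOn_const.mul ?_)
      · exact (Real.continuous_rpow_const hν0.le).continuousOn
      · exact (Real.continuous_rpow_const hνa.le).continuousOn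
    all_goals
      rw [interior_Icc]
      intro y hy
      have hd : HasDerivAt φ (ν * y ^ (ν - 1) * g y + y ^ ν * g' y -
          K / (ν - a) * ((ν - a) * y ^ (ν - a - 1))) y :=
        ((Real.hasDerivAt_rpow_const (Or.inl hy.1.ne')).mul
          ((hg y (Ioo_subset_Icc_self hy)).hasDerivAt (Icc_mem_nhds hy.1 hy.2))).sub
          ((Real.hasDerivAt_rpow_const (Or.inl hy.1.ne')).const_mul _)
    · exact hd.differentiableAt.differentiableWithinAt
    · rw [hd.deriv]
      have e1 : y ^ ν = y ^ (ν - 1) * y := by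
        rw [← Real.rpow_add_one hy.1.ne', sub_add_cancel]
      have e2 : y ^ (ν - a - 1) = y ^ (ν - 1) * y ^ (-a) := by
        rw [← Real.rpow_add hy.1]; congr 1; ring
      have e3 : ν * y ^ (ν - 1) * g y + y ^ ν * g' y - K / (ν - a) * ((ν - a) * y ^ (ν - a - 1)) =
          y ^ (ν - 1) * (y * g' y + ν * g y - K * y ^ (-a)) := by
        rw [e1, e2]; field_simp; ring
      rw [e3]
      exact mul_nonpos_of_nonneg_of_nonpos (Real.rpow_nonneg hy.1.le _) (sub_nonpos.2 (h y hy))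
  have h0 : φ 0 = 0 := by simp [hφ, Real.zero_rpow hν0.ne', Real.zero_rpow hνa.ne']
  have h1 := hanti ⟨le_rfl, zero_le_one⟩ (Ioc_subset_Icc_self hx) hx.1.le
  rw [h0, hφ] at h1
  have e : x ^ (ν - a) = x ^ ν * x ^ (-a) := by
    rw [← Real.rpow_add hx.1, sub_eq_add_neg]
  simp only [e] at h1
  have hp : 0 < x ^ ν := Real.rpow_pos_of_pos hx.1 _
  refine le_of_mul_le_mul_left ?_ hp
  linarith

/-- If `x g' + ν g = O(x^{-a})` with `a < ν`, then `g = O(x^{-a})`. -/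
theorem abs_le_of_abs_mul_add_le {ν a K : ℝ} (ha : 0 ≤ a) (hν : a < ν) {g g' : ℝ → ℝ}
    (hg : ∀ x ∈ Icc (0 : ℝ) 1, HasDerivWithinAt g (g' x) (Icc 0 1) x)
    (h : ∀ x ∈ Ioo (0 : ℝ) 1, |x * g' x + ν * g x| ≤ K * x ^ (-a)) {x : ℝ}
    (hx : x ∈ Ioc (0 : ℝ) 1) : |g x| ≤ K / (ν - a) * x ^ (-a) := by
  refine abs_le'.2 ⟨le_of_mul_add_le ha hν hg (fun y hy => (le_abs_self _).trans (h y hy)) hx,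
    le_of_mul_add_le (g := -g) (g' := -g') ha hν (fun y hy => (hg y hy).neg) (fun y hy => ?_) hx⟩
  refine le_trans (le_of_eq ?_) ((neg_le_abs _).trans (h y hy))
  simp only [Pi.neg_apply]
  ring

namespace SmoothRect

variable {T : ℝ} [hT : Fact (0 < T)]

/-- The operator `x ∂_x² + ν ∂_x`. -/
def Delta (ν : ℝ) : Module.End ℝ (SmoothRect T) :=
  mulX (fun x => x) contDiff_id * (Dx * Dx) + ν • Dx

theorem Delta_apply (ν : ℝ) (u : SmoothRect T) :
    Delta ν u = mulX (fun x => x) contDiff_id (Dx (Dx u)) + ν • Dx u := rfl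

theorem Dx_Delta (ν : ℝ) (u : SmoothRect T) : Dx (Delta ν u) = Delta (ν + 1) (Dx u) := by
  have h1 : mulX (deriv fun x : ℝ => x) (contDiff_deriv contDiff_id) (Dx (Dx u)) = Dx (Dx u) :=
    ext fun z _ => by simp
  rw [Delta_apply, Delta_apply, map_add, Dx_mulX, map_smul, add_smul, one_smul, h1]
  abel

theorem Dx_pow_Delta (m : ℕ) (ν : ℝ) (u : SmoothRect T) :
    (Dx ^ m) (Delta ν u) = Delta (ν + m) ((Dx ^ m) u) := by
  induction m generalizing ν u with
  | zero => simp
  | succ m ih =>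
    rw [← pow_apply_self, ← pow_apply_self, Dx_Delta, ih, Nat.cast_succ, add_assoc,
      add_comm (1 : ℝ)]

theorem Dt_Delta (ν : ℝ) (u : SmoothRect T) : Dt (Delta ν u) = Delta ν (Dt u) := by
  rw [Delta_apply, Delta_apply, map_add, Dt_mulX, map_smul, Dt_Dx, Dt_Dx]

theorem nrm_Dx_le {ν : ℝ} (hν : 0 < ν) (u : SmoothRect T) :
    nrm (Dx u) ≤ ν⁻¹ * nrm (Delta ν u) := by
  refine nrm_le fun t ht x hx => ?_
  have hval : ∀ y, (Delta ν u).1 (t, y) = y * (Dx (Dx u)).1 (t, y) + ν * (Dx u).1 (t, y) :=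
    fun y => rfl
  rcases hx.1.eq_or_lt with rfl | h0
  · have h1 := (Delta ν u).abs_le_nrm (z := (t, 0)) ⟨ht, hx⟩
    rw [hval, zero_mul, zero_add, abs_mul, abs_of_pos hν] at h1
    rwa [inv_mul_eq_div, le_div_iff₀' hν]
  · have := abs_le_of_abs_mul_add_le (ν := ν) (a := 0) (K := nrm (Delta ν u))
      (g := fun y => (Dx u).1 (t, y)) (g' := fun y => (Dx (Dx u)).1 (t, y)) le_rfl hν
      (fun y hy => (Dx u).hasDerivWithinAt_Dx ht hy) (fun y hy => ?_) (x := x) ⟨h0, hx.2⟩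
    · simpa [inv_mul_eq_div] using this
    · rw [neg_zero, Real.rpow_zero, mul_one, ← hval]
      exact (Delta ν u).abs_le_nrm ⟨ht, Ioo_subset_Icc_self hy⟩

theorem dom_nrm_Dx_pow (m : ℕ) : ∀ {ν : ℝ}, 0 < ν →
    Dom (fun u : SmoothRect T => nrm ((Dx ^ m) u)) fun u => nrm ((Delta ν ^ m) u) := by
  induction m with
  | zero => exact fun _ => Dom.of_le fun u => by simp
  | succ m ih =>
    intro ν hν
    have hν' : 0 < ν + m := by positivity
    have h1 : Dom (fun u : SmoothRect T => nrm ((Dx ^ (m + 1)) u))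
        fun u => nrm ((Dx ^ m) (Delta ν u)) :=
      ⟨(ν + m)⁻¹, (inv_pos.2 hν').le, fun u => by
        simp only [Dx_pow_Delta, pow_succ' Dx, Module.End.mul_apply]
        exact nrm_Dx_le hν' _⟩
    exact h1.trans (((ih hν).comp (Delta ν)).trans_le fun u => by rw [pow_apply_self])

/-- The powers of `x ∂_x² + ν ∂_x` control `x^j ∂_x^m u`: the `x`-derivatives because of
`∂_x^m (x ∂_x² + ν ∂_x) = (x ∂_x² + (ν + m) ∂_x) ∂_x^m`, the others by
`x ∂_x² = (x ∂_x² + ν ∂_x) - ν ∂_x`. -/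
theorem dom_pow_Dx {ν : ℝ} (hν : 0 < ν) (k : ℕ) : ∀ j ≤ k, ∀ m ≤ k + j,
    Dom (fun u : SmoothRect T => nrm (mulX (fun x => x ^ j) (contDiff_id.pow j) ((Dx ^ m) u)))
      fun u => ∑ i ∈ Finset.range (k + 1), nrm ((Delta ν ^ i) u) := by
  induction k with
  | zero =>
    intro j hj m hm
    obtain rfl : j = 0 := by lia
    obtain rfl : m = 0 := by lia
    exact (dom_nrm_mulX (contDiff_id.pow 0)).trans_le fun u => by simp
  | succ k ihk =>
    -- derivatives up to the order `k + 1` need no weight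
    have hlow : ∀ j, ∀ m ≤ k + 1, Dom (fun u : SmoothRect T =>
        nrm (mulX (fun x => x ^ j) (contDiff_id.pow j) ((Dx ^ m) u)))
        fun u => ∑ i ∈ Finset.range (k + 1 + 1), nrm ((Delta ν ^ i) u) := fun j m hm =>
      ((dom_nrm_mulX (contDiff_id.pow j)).comp (Dx ^ m)).trans
        ((dom_nrm_Dx_pow m hν).trans_le fun u => Finset.single_le_sum
          (f := fun i => nrm ((Delta ν ^ i) u)) (fun _ _ => nrm_nonneg _)
          (Finset.mem_range.2 (Nat.lt_succ_of_le hm)))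
    intro j
    induction j with
    | zero => exact fun _ m hm => hlow 0 m hm
    | succ j ihj =>
      intro hj m hm
      rcases m with _ | _ | m
      · exact hlow _ _ (by lia)
      · exact hlow _ _ (by lia)
      have h1 := ((ihk j (by lia) m (by lia)).comp (Delta ν)).trans_le
        (h := fun u => ∑ i ∈ Finset.range (k + 1 + 1), nrm ((Delta ν ^ i) u)) fun u => by
          rw [Finset.sum_range_succ' _ (k + 1)]
          exact le_add_of_le_of_nonneg (le_of_eq (by simp only [pow_apply_self])) (nrm_nonneg _)
      have h2 := (ihj (by lia) (m + 1) (by lia)).const_mul (c := ν + m) (by positivity)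
      refine Dom.le_trans (fun u => ?_) (h1.add h2)
      have e : mulX (fun x => x ^ (j + 1)) (contDiff_id.pow (j + 1)) ((Dx ^ (m + 1 + 1)) u) =
          mulX (fun x => x ^ j) (contDiff_id.pow j) ((Dx ^ m) (Delta ν u)) -
          (ν + m) • mulX (fun x => x ^ j) (contDiff_id.pow j) ((Dx ^ (m + 1)) u) := by
        rw [Dx_pow_Delta, Delta_apply, map_add, map_smul, pow_succ', pow_succ',
          Module.End.mul_apply, Module.End.mul_apply, add_sub_cancel_right, mulX_mulX]
        exact mulX_congr _ _ fun _ _ x _ => by ring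
      rw [e]
      refine (nrm_sub_le _ _).trans (le_of_eq ?_)
      rw [nrm_smul, abs_of_pos (by positivity)]

/-- The function `x (1 - x)`, which vanishes to first order on both degenerate edges. -/
def rho (x : ℝ) : ℝ := x * (1 - x)

theorem contDiff_rho : ContDiff ℝ ∞ rho := contDiff_id.mul (contDiff_const.sub contDiff_id)

theorem rho_nonneg {x : ℝ} (hx : x ∈ Icc (0 : ℝ) 1) : 0 ≤ rho x :=
  mul_nonneg hx.1 (sub_nonneg.2 hx.2)

theorem rho_le {x : ℝ} (hx : x ∈ Icc (0 : ℝ) 1) : rho x ≤ x :=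
  mul_le_of_le_one_right hx.1 (by linarith [hx.1])

theorem rho_reflect (x : ℝ) : rho (1 - x) = rho x := by rw [rho, rho]; ring

/-- The weighted norm with `σ = x (1 - x)`. -/
abbrev V (k : ℕ) (u : SmoothRect T) : ℝ := wnrm rho contDiff_rho k u

theorem V_mono (u : SmoothRect T) : Monotone fun k => V k u := by
  refine monotone_nat_of_le_succ fun k => ?_
  refine le_trans ?_ (Finset.sum_le_sum_of_subset_of_nonneg
    (Finset.range_mono (Nat.le_succ (k + 1)))
    fun _ _ _ => Finset.sum_nonneg fun _ _ => nrm_nonneg _)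
  exact Finset.sum_le_sum fun j _ => Finset.sum_le_sum_of_subset_of_nonneg
    (Finset.range_mono (by lia)) fun _ _ _ => nrm_nonneg _

theorem dom_V_Delta {ν : ℝ} (hν : 0 < ν) (k : ℕ) :
    Dom (V k) fun u : SmoothRect T => ∑ i ∈ Finset.range (k + 1), nrm ((Delta ν ^ i) u) := by
  refine dom_wnrm contDiff_rho fun j hj m hm =>
    Dom.le_trans (fun u => ?_) (dom_pow_Dx hν k j hj m hm)
  refine (nrm_mulX_le_of_abs_le _ (contDiff_id.pow j) (c := 1) (fun x hx => ?_) _).trans_eq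
    (one_mul _)
  rw [one_mul, abs_pow, abs_pow, abs_of_nonneg (rho_nonneg hx), id_eq, abs_of_nonneg hx.1]
  exact pow_le_pow_left₀ (rho_nonneg hx) (rho_le hx) j

/-- On functions that vanish for `x > 2/3` the weights `x^j` and `(x (1 - x))^j` are
equivalent. -/
theorem dom_pow_Dx_mulX (j m : ℕ) : ∀ {φ : ℝ → ℝ} (hφ : ContDiff ℝ ∞ φ),
    (∀ x, 2 / 3 < x → φ x = 0) →
    Dom (fun u : SmoothRect T =>
      nrm (mulX (fun x => x ^ j) (contDiff_id.pow j) ((Dx ^ m) (mulX φ hφ u))))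
      fun u => ∑ i ∈ Finset.range (m + 1),
        nrm (mulX (fun x => rho x ^ j) (contDiff_rho.pow j) ((Dx ^ i) u)) := by
  induction m with
  | zero =>
    intro φ hφ h0
    obtain ⟨C, hC, hb⟩ := exists_bound_of_contDiff hφ
    refine ⟨C * 3 ^ j, by positivity, fun u => ?_⟩
    simp only [pow_zero, Module.End.one_apply, zero_add, Finset.range_one, Finset.sum_singleton]
    rw [mulX_mulX]
    refine nrm_mulX_le_of_abs_le _ _ (fun x hx => ?_) u
    rw [abs_mul, abs_pow, abs_pow, abs_of_nonneg (rho_nonneg hx), abs_of_nonneg hx.1]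
    rcases le_or_gt x (2 / 3) with h | h
    · have h3 : x ≤ 3 * rho x := by rw [rho]; nlinarith [hx.1]
      calc x ^ j * |φ x| ≤ (3 * rho x) ^ j * C :=
            mul_le_mul (pow_le_pow_left₀ hx.1 h3 j) (hb x hx) (abs_nonneg _)
              (pow_nonneg (hx.1.trans h3) j)
        _ = _ := by rw [mul_pow]; ring
    · rw [h0 x h, abs_zero, mul_zero]
      have := rho_nonneg hx
      positivity
  | succ m ih =>
    intro φ hφ h0
    have h0' : ∀ x, 2 / 3 < x → deriv φ x = 0 := fun x hx => by
      have : φ =ᶠ[𝓝 x] fun _ => 0 := by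
        filter_upwards [Ioi_mem_nhds hx] with y hy using h0 y hy
      rw [this.deriv_eq, deriv_const]
    have h1 := (ih (contDiff_deriv hφ) h0').trans_le
      (h := fun u => ∑ i ∈ Finset.range (m + 1 + 1),
        nrm (mulX (fun x => rho x ^ j) (contDiff_rho.pow j) ((Dx ^ i) u)))
      fun u => Finset.sum_le_sum_of_subset_of_nonneg
        (Finset.range_mono (Nat.le_succ (m + 1))) fun _ _ _ => nrm_nonneg _
    have h2 := ((ih hφ h0).comp Dx).trans_le
      (h := fun u => ∑ i ∈ Finset.range (m + 1 + 1),
        nrm (mulX (fun x => rho x ^ j) (contDiff_rho.pow j) ((Dx ^ i) u))) fun u => by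
        rw [Finset.sum_range_succ' _ (m + 1)]
        exact le_add_of_le_of_nonneg (le_of_eq (by simp only [pow_apply_self])) (nrm_nonneg _)
    refine Dom.le_trans (fun u => ?_) (h1.add h2)
    rw [← pow_apply_self, Dx_mulX, map_add, map_add]
    exact nrm_add_le _ _

theorem dom_Delta_pow_mulX (ν : ℝ) (k : ℕ) {φ : ℝ → ℝ} (hφ : ContDiff ℝ ∞ φ)
    (h0 : ∀ x, 2 / 3 < x → φ x = 0) :
    Dom (fun u : SmoothRect T => nrm ((Delta ν ^ k) (mulX φ hφ u))) (V k) := by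
  have h1 : Dom (fun u : SmoothRect T => nrm ((Delta ν ^ k) u))
      (wnrm (fun x => x) contDiff_id k) := by
    refine dom_wnrm_pow _ (fun k => ?_) k
    refine Dom.le_trans (fun u => wnrm_add_le _ _ _ _) ((dom_wnrm_sq contDiff_id k).add ?_)
    exact Dom.le_trans (fun u => (wnrm_smul _ _ _ _).le)
      ((dom_wnrm_Dx contDiff_id k).const_mul (abs_nonneg ν))
  refine (h1.comp (mulX φ hφ)).trans (dom_wnrm _ fun j hj m hm => ?_)
  exact (dom_pow_Dx_mulX j m hφ h0).trans (Dom.sum fun i hi =>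
    Dom.of_le (nrm_le_wnrm contDiff_rho hj (by have := Finset.mem_range.1 hi; lia)))

theorem Dx_pow_reflect (m : ℕ) (u : SmoothRect T) :
    (Dx ^ m) (reflect u) = (-1 : ℝ) ^ m • reflect ((Dx ^ m) u) := by
  induction m generalizing u with
  | zero => simp
  | succ m ih =>
    rw [← pow_apply_self, Dx_reflect, map_neg, ih, pow_apply_self, pow_succ (-1 : ℝ)]
    simp

theorem V_reflect (k : ℕ) (u : SmoothRect T) : V k (reflect u) = V k u := by
  refine Finset.sum_congr rfl fun j _ => Finset.sum_congr rfl fun m _ => ?_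
  rw [Dx_pow_reflect, map_smul, nrm_smul, abs_pow, abs_neg, abs_one, one_pow, one_mul,
    ← nrm_reflect]
  congr 1
  ext z _
  simp [rho_reflect]

/-! ### The operators of the two sides -/

/-- The change of variable that turns the degenerate edge of the side `μ` into `x = 0`. -/
def side : Fin 2 → Module.End ℝ (SmoothRect T)
  | 0 => 1
  | 1 => reflect

/-- The coefficients of `∂_x` in the operators of the two sides. -/
def ord (N : ℝ) : Fin 2 → ℝ
  | 0 => 5 / 2
  | 1 => N / 2

theorem side_side (μ : Fin 2) (u : SmoothRect T) : side μ (side μ u) = u := by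
  fin_cases μ
  · rfl
  · exact reflect_reflect u

theorem nrm_side (μ : Fin 2) (u : SmoothRect T) : nrm (side μ u) = nrm u := by
  fin_cases μ
  · rfl
  · exact nrm_reflect u

theorem V_side (μ : Fin 2) (k : ℕ) (u : SmoothRect T) : V k (side μ u) = V k u := by
  fin_cases μ
  · rfl
  · exact V_reflect k u

theorem Dt_side (μ : Fin 2) (u : SmoothRect T) : Dt (side μ u) = side μ (Dt u) := by
  fin_cases μ
  · rfl
  · exact Dt_reflect u

/-- The operator `△_{[μ]}` on `C^∞([0,T] × [0,1])`. -/
def Lap (N : ℝ) (μ : Fin 2) : Module.End ℝ (SmoothRect T) :=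
  side μ * Delta (ord N μ) * side μ

theorem Lap_val (N : ℝ) (μ : Fin 2) (u : SmoothRect T) : (Lap N μ u).1 = lap N μ u.1 := by
  fin_cases μ
  · rfl
  · change (reflect (Delta (N / 2) (reflect u))).1 = _
    rw [Delta_apply, Dx_reflect, map_neg, Dx_reflect, neg_neg]
    funext z
    simp [lap, Dx_val]
    ring

theorem Lap_pow (N : ℝ) (μ : Fin 2) (k : ℕ) (u : SmoothRect T) :
    (Lap N μ ^ k) u = side μ ((Delta (ord N μ) ^ k) (side μ u)) := by
  induction k generalizing u with
  | zero => simp [side_side]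
  | succ k ih =>
    rw [← pow_apply_self, ih]
    simp only [Lap, Module.End.mul_apply, side_side, pow_apply_self]

theorem Dt_Lap (N : ℝ) (μ : Fin 2) : Commute (Dt : Module.End ℝ (SmoothRect T)) (Lap N μ) :=
  LinearMap.ext fun u => by simp [Lap, Dt_side, Dt_Delta]

theorem Dt_cut (c : Cutoff) (μ : Fin 2) : Commute (Dt : Module.End ℝ (SmoothRect T)) (cut T c μ) :=
  LinearMap.ext fun u => Dt_mulX _ (c.contDiff_part μ) u

theorem mixed_val (N : ℝ) (μ : Fin 2) (j k : ℕ) (u : SmoothRect T) :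
    mixed T N μ j k u.1 =
      (((-(Dt * Dt)) ^ j * (-Lap N μ) ^ k : Module.End ℝ (SmoothRect T)) u).1 := by
  have h1 : ∀ k, ∀ u : SmoothRect T,
      ((fun g z => -lap N μ g z)^[k] u.1) = (((-Lap N μ) ^ k) u).1 := by
    intro k
    induction k with
    | zero => exact fun _ => rfl
    | succ k ih =>
      intro u
      rw [Function.iterate_succ_apply, ← pow_apply_self, ← ih, LinearMap.neg_apply]
      congr 1
      funext z
      rw [neg_val, Lap_val]
  have h2 : ∀ j, ∀ u : SmoothRect T,
      ((fun g z => -dt T (dt T g) z)^[j] u.1) =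
        (((-(Dt * Dt)) ^ j : Module.End ℝ (SmoothRect T)) u).1 := by
    intro j
    induction j with
    | zero => exact fun _ => rfl
    | succ k ih =>
      intro u
      rw [Function.iterate_succ_apply, ← pow_apply_self, ← ih]
      rfl
  rw [mixed, h1, h2, Module.End.mul_apply]

theorem neg_pow_apply (A : Module.End ℝ (SmoothRect T)) (k : ℕ) (u : SmoothRect T) :
    ((-A) ^ k) u = (A ^ k) u ∨ ((-A) ^ k) u = -(A ^ k) u := by
  rw [neg_pow]
  rcases neg_one_pow_eq_or (Module.End ℝ (SmoothRect T)) k with h | h <;> rw [h]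
  · exact Or.inl (by simp)
  · exact Or.inr (by simp)

theorem supNorm_mixed (N : ℝ) (μ : Fin 2) (j k : ℕ) (u : SmoothRect T) :
    supNorm T (mixed T N μ j k u.1) = nrm ((Dt ^ (2 * j)) ((Lap N μ ^ k) u)) := by
  rw [mixed_val, Module.End.mul_apply, pow_mul, sq]
  change nrm _ = _
  rcases neg_pow_apply (Lap N μ) k u with h | h <;>
    rcases neg_pow_apply (Dt * Dt) j (((-Lap N μ) ^ k) u) with h' | h' <;> rw [h', h] <;> simp

end SmoothRect

/-! ### Interpolation in `t` -/

/-- The function and its first derivative are controlled by the `L¹` norms of the function and of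
its second derivative. -/
theorem abs_le_integral_abs_add {T : ℝ} (hT : 0 < T) {g g' g'' : ℝ → ℝ}
    (hg : ∀ t ∈ Icc 0 T, HasDerivWithinAt g (g' t) (Icc 0 T) t)
    (hg' : ∀ t ∈ Icc 0 T, HasDerivWithinAt g' (g'' t) (Icc 0 T) t)
    (hg'' : ContinuousOn g'' (Icc 0 T)) {t : ℝ} (ht : t ∈ Icc 0 T) :
    |g t| ≤
      (18 / T ^ 2 + 1 + 21 / T + T) * ((∫ s in (0 : ℝ)..T, |g s|) + ∫ s in (0 : ℝ)..T, |g'' s|)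
    ∧ |g' t| ≤
      (18 / T ^ 2 + 1 + 21 / T + T) *
        ((∫ s in (0 : ℝ)..T, |g s|) + ∫ s in (0 : ℝ)..T, |g'' s|) := by
  have hgc : ContinuousOn g (Icc 0 T) := fun s hs => (hg s hs).continuousWithinAt
  have hgc' : ContinuousOn g' (Icc 0 T) := fun s hs => (hg' s hs).continuousWithinAt
  set I := ∫ s in (0 : ℝ)..T, |g s| with hI
  set J := ∫ s in (0 : ℝ)..T, |g'' s| with hJ
  have hJ0 : 0 ≤ J := intervalIntegral.integral_nonneg hT.le fun _ _ => abs_nonneg _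
  have hI0 : 0 ≤ I := intervalIntegral.integral_nonneg hT.le fun _ _ => abs_nonneg _
  have hint : IntervalIntegrable (fun s => |g s|) MeasureTheory.volume 0 T :=
    ContinuousOn.intervalIntegrable_of_Icc hT.le hgc.abs
  -- on every third of the interval there is a point where `|g|` is at most three times its mean
  have hpt : ∀ a b, 0 ≤ a → b ≤ T → b - a = T / 3 → ∃ s ∈ Icc a b, |g s| ≤ 3 / T * I := by
    intro a b ha hb hab
    have hab' : a ≤ b := by linarith [div_pos hT three_pos]
    have hsub : Icc a b ⊆ Icc 0 T := Icc_subset_Icc ha hb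
    obtain ⟨s, hs, hmin⟩ := isCompact_Icc.exists_isMinOn (nonempty_Icc.2 hab') (hgc.abs.mono hsub)
    refine ⟨s, hs, ?_⟩
    have hint' : IntervalIntegrable (fun s => |g s|) MeasureTheory.volume a b :=
      ContinuousOn.intervalIntegrable_of_Icc hab' (hgc.abs.mono hsub)
    have h1 : ∫ _ in a..b, |g s| ≤ ∫ r in a..b, |g r| :=
      intervalIntegral.integral_mono_on hab' intervalIntegrable_const hint' fun r hr => hmin hr
    have h2 : ∫ r in a..b, |g r| ≤ I :=
      intervalIntegral.integral_mono_interval ha hab' hb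
        (Filter.Eventually.of_forall fun _ => abs_nonneg _) hint
    rw [intervalIntegral.integral_const, smul_eq_mul, hab] at h1
    rw [div_mul_eq_mul_div, le_div_iff₀ hT]
    linarith
  obtain ⟨t₁, ht₁, h₁⟩ := hpt 0 (T / 3) le_rfl (by linarith) (by ring)
  obtain ⟨t₂, ht₂, h₂⟩ := hpt (2 * T / 3) T (by positivity) le_rfl (by ring)
  have h12 : t₁ + T / 3 ≤ t₂ := by linarith [ht₁.2, ht₂.1]
  have hlt : t₁ < t₂ := by linarith [div_pos hT three_pos]
  have hsub : Icc t₁ t₂ ⊆ Icc 0 T := Icc_subset_Icc ht₁.1 ht₂.2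
  -- between two such points, in the outer thirds, the derivative takes the value of the slope
  obtain ⟨ξ, hξ, hslope⟩ := exists_hasDerivAt_eq_slope g g' hlt (hgc.mono hsub) fun s hs =>
    (hg s (hsub (Ioo_subset_Icc_self hs))).hasDerivAt
      (Icc_mem_nhds (by linarith [ht₁.1, hs.1]) (by linarith [ht₂.2, hs.2]))
  have hξT : ξ ∈ Icc 0 T := hsub (Ioo_subset_Icc_self hξ)
  have hξ' : |g' ξ| ≤ 18 / T ^ 2 * I := by
    rw [hslope, abs_div, abs_of_pos (sub_pos.2 hlt), div_le_iff₀ (sub_pos.2 hlt)]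
    calc |g t₂ - g t₁| ≤ |g t₂| + |g t₁| := abs_sub _ _
      _ ≤ 3 / T * I + 3 / T * I := add_le_add h₂ h₁
      _ = 18 / T ^ 2 * I * (T / 3) := by field_simp; ring
      _ ≤ 18 / T ^ 2 * I * (t₂ - t₁) := by gcongr; linarith
  have hd : ∀ s ∈ Icc 0 T, |g' s| ≤ 18 / T ^ 2 * I + J := by
    intro s hs
    have hus : uIcc ξ s ⊆ Icc 0 T := uIcc_subset_Icc hξT hs
    have hftc : ∫ r in ξ..s, g'' r = g' s - g' ξ := by
      refine intervalIntegral.integral_eq_sub_of_hasDeriv_right (hgc'.mono hus) (fun r hr => ?_)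
        ((hg''.mono hus).intervalIntegrable)
      have hr' : r ∈ Ioo 0 T :=
        ⟨(le_min hξT.1 hs.1).trans_lt hr.1, hr.2.trans_le (max_le hξT.2 hs.2)⟩
      exact ((hg' r (Ioo_subset_Icc_self hr')).hasDerivAt
        (Icc_mem_nhds hr'.1 hr'.2)).hasDerivWithinAt
    have hle : |g' s - g' ξ| ≤ J := by
      rw [← hftc]
      refine (intervalIntegral.norm_integral_le_integral_norm_uIoc (f := g'')).trans ?_
      rw [hJ, intervalIntegral.integral_of_le hT.le]
      refine MeasureTheory.setIntegral_mono_set ?_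
        (Filter.Eventually.of_forall fun _ => abs_nonneg _)
        (LE.le.eventuallyLE ?_)
      · exact (ContinuousOn.intervalIntegrable_of_Icc (μ := MeasureTheory.volume) hT.le hg''.abs).1
      · exact Ioc_subset_Ioc (le_min hξT.1 hs.1) (max_le hξT.2 hs.2)
    calc |g' s| = |g' ξ + (g' s - g' ξ)| := by rw [add_sub_cancel]
      _ ≤ _ := (abs_add_le _ _).trans (add_le_add hξ' hle)
  have hdg : |g t - g t₁| ≤ (18 / T ^ 2 * I + J) * T := by
    have ht₁T : t₁ ∈ Icc 0 T := hsub ⟨le_rfl, hlt.le⟩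
    refine (Convex.norm_image_sub_le_of_norm_hasDerivWithin_le hg hd (convex_Icc 0 T)
      ht₁T ht).trans ?_
    refine mul_le_mul_of_nonneg_left ?_ (by positivity)
    rw [Real.norm_eq_abs, abs_le]
    constructor <;> linarith [ht.1, ht.2, ht₁T.1, ht₁T.2]
  constructor
  · calc |g t| = |g t₁ + (g t - g t₁)| := by rw [add_sub_cancel]
      _ ≤ 3 / T * I + (18 / T ^ 2 * I + J) * T := (abs_add_le _ _).trans (add_le_add h₁ hdg)
      _ = 21 / T * I + T * J := by field_simp; ring
      _ ≤ (18 / T ^ 2 + 1 + 21 / T + T) * I + (18 / T ^ 2 + 1 + 21 / T + T) * J := by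
        gcongr
        · have : 0 ≤ 18 / T ^ 2 := by positivity
          linarith
        · have : 0 ≤ 18 / T ^ 2 + 1 + 21 / T := by positivity
          linarith
      _ = _ := by ring
  · calc |g' t| ≤ 18 / T ^ 2 * I + 1 * J := by rw [one_mul]; exact hd t ht
      _ ≤ (18 / T ^ 2 + 1 + 21 / T + T) * I + (18 / T ^ 2 + 1 + 21 / T + T) * J := by
        gcongr
        · have : 0 ≤ 1 + 21 / T + T := by positivity
          linarith
        · have : 0 ≤ 18 / T ^ 2 + 21 / T + T := by positivity
          linarith
      _ = _ := by ring

namespace SmoothRect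

variable {T : ℝ} [hT : Fact (0 < T)]

theorem continuousOn_t (u : SmoothRect T) {x : ℝ} (hx : x ∈ Icc (0 : ℝ) 1) :
    ContinuousOn (fun t => u.1 (t, x)) (Icc 0 T) := fun _ ht =>
  (u.hasDerivWithinAt_Dt ht hx).continuousWithinAt

theorem continuousOn_x (u : SmoothRect T) {t : ℝ} (ht : t ∈ Icc 0 T) :
    ContinuousOn (fun x => u.1 (t, x)) (Icc 0 1) := fun _ hx =>
  (u.hasDerivWithinAt_Dx ht hx).continuousWithinAt

theorem dom_nrm_Dt :
    Dom (fun u : SmoothRect T => nrm (Dt u)) fun u => nrm u + nrm (Dt (Dt u)) := by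
  have hTp := hT.out
  refine ⟨(18 / T ^ 2 + 1 + 21 / T + T) * T, by positivity, fun u => nrm_le fun t ht x hx => ?_⟩
  have h := (abs_le_integral_abs_add hT.out (g := fun s => u.1 (s, x))
    (fun s hs => u.hasDerivWithinAt_Dt hs hx) (fun s hs => (Dt u).hasDerivWithinAt_Dt hs hx)
    ((Dt (Dt u)).continuousOn_t hx) ht).2
  have hint : ∀ v : SmoothRect T, ∫ s in (0 : ℝ)..T, |v.1 (s, x)| ≤ T * nrm v := by
    intro v
    have := intervalIntegral.integral_mono_on (μ := MeasureTheory.volume) hT.out.le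
      (ContinuousOn.intervalIntegrable_of_Icc hT.out.le (v.continuousOn_t hx).abs)
      (intervalIntegrable_const (c := nrm v)) fun s hs => v.abs_le_nrm (z := (s, x)) ⟨hs, hx⟩
    simpa using this
  refine h.trans ?_
  rw [mul_assoc, mul_add T]
  exact mul_le_mul_of_nonneg_left (add_le_add (hint u) (hint _)) (by positivity)

/-! ### The grading by weighted derivatives -/

/-- The grading to which all others are compared: it bounds `(x (1 - x))^j ∂_x^m ∂_t^a u` for
`j ≤ k`, `m ≤ k + j` and `a + 2 k ≤ 2 n`. -/
def W (n : ℕ) (u : SmoothRect T) : ℝ :=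
  ∑ a ∈ Finset.range (2 * n + 1), V ((2 * n - a) / 2) ((Dt ^ a) u)

theorem V_Dt_le_W {n a k : ℕ} (h : a + 2 * k ≤ 2 * n) (u : SmoothRect T) :
    V k ((Dt ^ a) u) ≤ W n u :=
  (V_mono _ (by lia : k ≤ (2 * n - a) / 2)).trans <|
    Finset.single_le_sum (f := fun a => V ((2 * n - a) / 2) ((Dt ^ a) u))
      (fun _ _ => wnrm_nonneg _ _ _) (Finset.mem_range.2 (by lia))

theorem dom_W {α : Type*} {n : ℕ} {P : α → SmoothRect T} {g : α → ℝ}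
    (h : ∀ a k, a + 2 * k ≤ 2 * n → Dom (fun b => V k ((Dt ^ a) (P b))) g) :
    Dom (fun b => W n (P b)) g :=
  Dom.sum fun a ha => h a _ (by have := Finset.mem_range.1 ha; lia)

theorem W_nonneg (n : ℕ) (u : SmoothRect T) : 0 ≤ W n u :=
  Finset.sum_nonneg fun _ _ => wnrm_nonneg _ _ _

theorem W_add_le (n : ℕ) (u v : SmoothRect T) : W n (u + v) ≤ W n u + W n v := by
  simp only [W, ← Finset.sum_add_distrib, map_add]
  exact Finset.sum_le_sum fun _ _ => wnrm_add_le _ _ _ _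

theorem nrm_le_V (k : ℕ) (u : SmoothRect T) : nrm u ≤ V k u := by
  refine le_trans (le_of_eq ?_) (nrm_le_wnrm contDiff_rho (j := 0) (m := 0) (Nat.zero_le k)
    (Nat.zero_le _) u)
  congr 1
  ext z _
  simp

theorem pairs_mem {n j k : ℕ} (h : j + k ≤ n) : (j, k) ∈ pairs n := by
  simp only [pairs, Finset.mem_filter, Finset.mem_product, Finset.mem_range]
  lia

theorem mem_pairs {n : ℕ} {i : ℕ × ℕ} (h : i ∈ pairs n) : i.1 + i.2 ≤ n := by
  simp only [pairs, Finset.mem_filter] at h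
  exact h.2

theorem nrm_le_sideSup (N : ℝ) (μ : Fin 2) {n j k : ℕ} (h : j + k ≤ n) (u : SmoothRect T) :
    nrm ((Dt ^ (2 * j)) ((Lap N μ ^ k) u)) ≤ sideSup T N μ n u := by
  rw [← supNorm_mixed]
  exact le_ciSup (f := fun i : pairs n => supNorm T (mixed T N μ i.1.1 i.1.2 u.1))
    (Set.finite_range _).bddAbove ⟨(j, k), pairs_mem h⟩

theorem sideSup_nonneg (N : ℝ) (μ : Fin 2) (n : ℕ) (u : SmoothRect T) : 0 ≤ sideSup T N μ n u :=
  (nrm_nonneg _).trans (nrm_le_sideSup N μ (j := 0) (k := 0) (Nat.zero_le n) u)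

theorem sideSup_le {N : ℝ} {μ : Fin 2} {n : ℕ} {u : SmoothRect T} {C : ℝ}
    (h : ∀ j k, j + k ≤ n → nrm ((Dt ^ (2 * j)) ((Lap N μ ^ k) u)) ≤ C) :
    sideSup T N μ n u ≤ C := by
  have : Nonempty (pairs n) := ⟨⟨(0, 0), pairs_mem (Nat.zero_le n)⟩⟩
  refine ciSup_le fun i => ?_
  rw [supNorm_mixed]
  exact h _ _ (mem_pairs i.2)

theorem dom_sideSup {α : Type*} {N : ℝ} {μ : Fin 2} {n : ℕ} {P : α → SmoothRect T} {g : α → ℝ}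
    (h : ∀ j k, j + k ≤ n → Dom (fun b => nrm ((Dt ^ (2 * j)) ((Lap N μ ^ k) (P b)))) g) :
    Dom (fun b => sideSup T N μ n (P b)) g := by
  refine Dom.le_trans (g := fun b => ∑ i ∈ pairs n,
    nrm ((Dt ^ (2 * i.1)) ((Lap N μ ^ i.2) (P b)))) (fun b => sideSup_le fun j k hjk => ?_)
    (Dom.sum fun i hi => h i.1 i.2 (mem_pairs hi))
  exact Finset.single_le_sum
    (f := fun i : ℕ × ℕ => nrm ((Dt ^ (2 * i.1)) ((Lap N μ ^ i.2) (P b))))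
    (fun _ _ => nrm_nonneg _) (pairs_mem hjk)

theorem Dt_pow_Lap_pow (N : ℝ) (μ : Fin 2) (j k : ℕ) (u : SmoothRect T) :
    (Dt ^ j) ((Lap N μ ^ k) u) = (Lap N μ ^ k) ((Dt ^ j) u) :=
  LinearMap.congr_fun ((Dt_Lap N μ).pow_pow j k) u

/-- After the change of variable of its side, a cut-off factor vanishes near `x = 1`. -/
theorem exists_side_cut (c : Cutoff) (μ : Fin 2) : ∃ (φ : ℝ → ℝ) (hφ : ContDiff ℝ ∞ φ),
    (∀ x, 2 / 3 < x → φ x = 0) ∧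
      ∀ u : SmoothRect T, side μ (cut T c μ u) = mulX φ hφ (side μ u) := by
  fin_cases μ
  · exact ⟨c.toFun, c.smooth, fun x hx => c.eq_zero x hx.le, fun u => rfl⟩
  · refine ⟨fun x => 1 - c.toFun (1 - x),
      contDiff_const.sub (c.smooth.comp (contDiff_const.sub contDiff_id)), fun x hx => ?_,
      fun u => rfl⟩
    change 1 - c.toFun (1 - x) = 0
    rw [c.eq_one _ (by linarith), sub_self]

theorem dom_sideSup_cut (N : ℝ) (c : Cutoff) (μ : Fin 2) (n : ℕ) :
    Dom (fun u : SmoothRect T => sideSup T N μ n (cut T c μ u)) (W n) := by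
  obtain ⟨φ, hφ, h0, hcut⟩ := exists_side_cut (T := T) c μ
  refine dom_sideSup fun j k hjk => ?_
  have h1 := (dom_Delta_pow_mulX (T := T) (ord N μ) k hφ h0).comp
    fun u => side μ ((Dt ^ (2 * j)) u)
  refine Dom.le_trans (fun u => le_of_eq ?_) (h1.trans_le fun u => ?_)
  · have hc : (Dt ^ (2 * j)) (cut T c μ u) = cut T c μ ((Dt ^ (2 * j)) u) :=
      LinearMap.congr_fun ((Dt_cut c μ).pow_left (2 * j)) u
    rw [Dt_pow_Lap_pow, hc, Lap_pow, nrm_side, hcut]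
  · rw [V_side]
    exact V_Dt_le_W (by lia) u

theorem dom_V_Lap {N : ℝ} {μ : Fin 2} (hN : 0 < ord N μ) (k : ℕ) :
    Dom (V k) fun u : SmoothRect T => ∑ i ∈ Finset.range (k + 1), nrm ((Lap N μ ^ i) u) :=
  Dom.le_trans (fun u => (V_side μ k u).ge) (((dom_V_Delta hN k).comp (side μ)).trans_le fun u =>
    le_of_eq (Finset.sum_congr rfl fun i _ => by rw [Lap_pow, nrm_side]))

theorem dom_W_sideSup {N : ℝ} {μ : Fin 2} (hN : 0 < ord N μ) (n : ℕ) :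
    Dom (W n) fun u : SmoothRect T => sideSup T N μ n u := by
  refine dom_W (P := fun u => u) fun a k hak => ((dom_V_Lap hN k).comp (Dt ^ a)).trans ?_
  refine Dom.sum fun i hi => ?_
  have hik : i ≤ k := by simpa [Nat.lt_succ_iff] using hi
  simp only [← Dt_pow_Lap_pow]
  rcases Nat.even_or_odd' a with ⟨b, rfl | rfl⟩
  · exact Dom.of_le fun u => nrm_le_sideSup N μ (by lia) u
  · refine Dom.le_trans (fun u => le_of_eq ?_)
      ((dom_nrm_Dt.comp fun u => (Dt ^ (2 * b)) ((Lap N μ ^ i) u)).trans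
      ((Dom.of_le fun u => nrm_le_sideSup N μ (j := b) (k := i) (by lia) u).add
        (Dom.of_le fun u => ?_)))
    · rw [pow_succ', Module.End.mul_apply]
    · have := nrm_le_sideSup N μ (n := n) (j := b + 1) (k := i) (by lia) u
      rwa [show 2 * (b + 1) = 2 * b + 1 + 1 by ring, pow_succ', pow_succ', Module.End.mul_apply,
        Module.End.mul_apply] at this

end SmoothRect

/-! ### Integration over the rectangle -/

/-- The iterated integral over `[0,T] × [0,1]`. -/
def dint (T : ℝ) (F : ℝ × ℝ → ℝ) : ℝ := ∫ t in (0 : ℝ)..T, ∫ x in (0 : ℝ)..1, F (t, x)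

section dint

variable {T : ℝ} [hT : Fact (0 < T)] {F G : ℝ × ℝ → ℝ}

theorem continuousOn_slice (hF : ContinuousOn F (rect T)) {t : ℝ} (ht : t ∈ Icc 0 T) :
    ContinuousOn (fun x => F (t, x)) (Icc 0 1) :=
  hF.comp (continuous_const.prodMk continuous_id).continuousOn fun _ hx => ⟨ht, hx⟩

theorem intervalIntegrable_slice (hF : ContinuousOn F (rect T)) {t : ℝ} (ht : t ∈ Icc 0 T) :
    IntervalIntegrable (fun x => F (t, x)) MeasureTheory.volume 0 1 :=
  (continuousOn_slice hF ht).intervalIntegrable_of_Icc zero_le_one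

theorem continuousOn_integral_slice (hF : ContinuousOn F (rect T)) :
    ContinuousOn (fun t => ∫ x in (0 : ℝ)..1, F (t, x)) (Icc 0 T) := by
  -- the function is extended to the plane by composition with the projection to the rectangle
  set P : ℝ × ℝ → ℝ × ℝ := fun z =>
    (projIcc 0 T hT.out.le z.1, projIcc (0 : ℝ) 1 zero_le_one z.2) with hP
  have hPc : Continuous P := by
    refine Continuous.prodMk ?_ ?_
    · exact continuous_subtype_val.comp (continuous_projIcc.comp continuous_fst)
    · exact continuous_subtype_val.comp (continuous_projIcc.comp continuous_snd)
  have hc : Continuous fun z => F (P z) :=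
    hF.comp_continuous hPc fun z => ⟨Subtype.coe_prop _, Subtype.coe_prop _⟩
  have h1 : Continuous fun t => ∫ x in (0 : ℝ)..1, F (P (t, x)) :=
    intervalIntegral.continuous_parametric_intervalIntegral_of_continuous'
      (f := fun t x => F (P (t, x))) hc 0 1
  refine h1.continuousOn.congr fun t ht => intervalIntegral.integral_congr fun x hx => ?_
  rw [uIcc_of_le zero_le_one] at hx
  simp only [hP, projIcc_of_mem hT.out.le ht, projIcc_of_mem zero_le_one hx]

theorem intervalIntegrable_integral_slice (hF : ContinuousOn F (rect T)) :
    IntervalIntegrable (fun t => ∫ x in (0 : ℝ)..1, F (t, x)) MeasureTheory.volume 0 T :=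
  (continuousOn_integral_slice hF).intervalIntegrable_of_Icc hT.out.le

theorem dint_mono (hF : ContinuousOn F (rect T)) (hG : ContinuousOn G (rect T))
    (h : ∀ z ∈ rect T, F z ≤ G z) : dint T F ≤ dint T G :=
  intervalIntegral.integral_mono_on hT.out.le (intervalIntegrable_integral_slice hF)
    (intervalIntegrable_integral_slice hG) fun _ ht =>
      intervalIntegral.integral_mono_on zero_le_one (intervalIntegrable_slice hF ht)
        (intervalIntegrable_slice hG ht) fun _ hx => h _ ⟨ht, hx⟩

theorem dint_congr (h : ∀ z ∈ rect T, F z = G z) : dint T F = dint T G :=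
  intervalIntegral.integral_congr fun t ht => intervalIntegral.integral_congr fun x hx => by
    rw [uIcc_of_le hT.out.le] at ht
    rw [uIcc_of_le zero_le_one] at hx
    exact h _ ⟨ht, hx⟩

theorem dint_add (hF : ContinuousOn F (rect T)) (hG : ContinuousOn G (rect T)) :
    dint T (fun z => F z + G z) = dint T F + dint T G := by
  rw [dint, dint, dint, ← intervalIntegral.integral_add (intervalIntegrable_integral_slice hF)
    (intervalIntegrable_integral_slice hG)]
  refine intervalIntegral.integral_congr fun t ht => ?_
  rw [uIcc_of_le hT.out.le] at ht
  exact intervalIntegral.integral_add (intervalIntegrable_slice hF ht)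
    (intervalIntegrable_slice hG ht)

theorem dint_const_mul (c : ℝ) (F : ℝ × ℝ → ℝ) : dint T (fun z => c * F z) = c * dint T F := by
  simp only [dint, intervalIntegral.integral_const_mul]

theorem dint_const (c : ℝ) : dint T (fun _ => c) = T * c := by
  simp [dint]

theorem dint_nonneg (h : ∀ z ∈ rect T, 0 ≤ F z) : 0 ≤ dint T F :=
  intervalIntegral.integral_nonneg hT.out.le fun _ ht =>
    intervalIntegral.integral_nonneg zero_le_one fun _ hx => h _ ⟨ht, hx⟩

end dint

/-- If `u' = O(x^{-a})` and `u(1) = 0`, then `u = O(x^{-b})` with `b = max (a - 1/2) 0`. The gain of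
`1/2` rather than `1` in the exponent avoids a logarithm for `a = 1`. -/
theorem abs_le_of_abs_deriv_le {a K : ℝ} (hK : 0 ≤ K) {u u' : ℝ → ℝ}
    (hu : ∀ x ∈ Icc (0 : ℝ) 1, HasDerivWithinAt u (u' x) (Icc 0 1) x) (hu1 : u 1 = 0)
    (h : ∀ x ∈ Ioc (0 : ℝ) 1, |u' x| ≤ K * x ^ (-a)) {x : ℝ} (hx : x ∈ Ioc (0 : ℝ) 1) :
    |u x| ≤ 2 * K * x ^ (-max (a - 1 / 2) 0) := by
  set b := max (a - 1 / 2) 0 with hb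
  have hb0 : 0 ≤ b := le_max_right _ _
  have hb1 : a ≤ b + 1 / 2 := by linarith [le_max_left (a - 1 / 2) 0]
  have key : ∀ v v' : ℝ → ℝ, (∀ x ∈ Icc (0 : ℝ) 1, HasDerivWithinAt v (v' x) (Icc 0 1) x) →
      v 1 = 0 → (∀ x ∈ Ioc (0 : ℝ) 1, |v' x| ≤ K * x ^ (-a)) → v x ≤ 2 * K * x ^ (-b) := by
    intro v v' hv hv1 hv'
    have hsub : Icc x 1 ⊆ Icc 0 1 := Icc_subset_Icc_left hx.1.le
    have hmono : MonotoneOn (fun y => v y + 2 * K * x ^ (-b) * y ^ (1 / 2 : ℝ)) (Icc x 1) := by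
      refine monotoneOn_of_deriv_nonneg (convex_Icc x 1) ?_ ?_ ?_
      · exact ContinuousOn.add (fun y hy => (hv y (hsub hy)).continuousWithinAt.mono hsub)
          (continuousOn_const.mul (Real.continuous_rpow_const (by norm_num)).continuousOn)
      all_goals
        rw [interior_Icc]
        intro y hy
        have hy0 : 0 < y := hx.1.trans hy.1
        have hd : HasDerivAt (fun y => v y + 2 * K * x ^ (-b) * y ^ (1 / 2 : ℝ))
            (v' y + 2 * K * x ^ (-b) * (1 / 2 * y ^ (1 / 2 - 1 : ℝ))) y :=
          ((hv y ⟨hy0.le, hy.2.le⟩).hasDerivAt (Icc_mem_nhds hy0 hy.2)).add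
            ((Real.hasDerivAt_rpow_const (Or.inl hy0.ne')).const_mul _)
      · exact hd.differentiableAt.differentiableWithinAt
      · rw [hd.deriv]
        have h1 : y ^ (-a) ≤ x ^ (-b) * y ^ (1 / 2 - 1 : ℝ) := by
          calc y ^ (-a) ≤ y ^ (-b + (1 / 2 - 1 : ℝ)) :=
                Real.rpow_le_rpow_of_exponent_ge hy0 hy.2.le (by linarith)
            _ = y ^ (-b) * y ^ (1 / 2 - 1 : ℝ) := Real.rpow_add hy0 _ _
            _ ≤ _ := mul_le_mul_of_nonneg_right
                (Real.rpow_le_rpow_of_nonpos hx.1 hy.1.le (by linarith))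
                (Real.rpow_nonneg hy0.le _)
        have h2 := (neg_le_abs (v' y)).trans ((hv' y ⟨hy0, hy.2.le⟩).trans
          (mul_le_mul_of_nonneg_left h1 hK))
        linarith
    have h1 := hmono ⟨le_rfl, hx.2⟩ ⟨hx.2, le_rfl⟩ hx.2
    simp only [hv1, Real.one_rpow, mul_one, zero_add] at h1
    have h2 : 0 ≤ 2 * K * x ^ (-b) * x ^ (1 / 2 : ℝ) := by
      have := Real.rpow_nonneg hx.1.le (-b)
      have := Real.rpow_nonneg hx.1.le (1 / 2)
      positivity
    linarith
  refine abs_le'.2 ⟨key u u' hu hu1 h, key (-u) (-u') (fun y hy => (hu y hy).neg) ?_ ?_⟩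
  · simp [hu1]
  · intro y hy
    simpa using h y hy

namespace SmoothRect

variable {T : ℝ} [hT : Fact (0 < T)]

/-! ### Weighted square norms -/

/-- The product of two functions integrated against the weight `x^{ν-1}`. -/
def l2prod (ν : ℝ) (u v : SmoothRect T) : ℝ :=
  dint T fun z => u.1 z * v.1 z * z.2 ^ (ν - 1)

/-- The `L²` norm with weight `x^{ν-1}`. -/
def l2nrm (ν : ℝ) (u : SmoothRect T) : ℝ := √(l2prod ν u u)

theorem continuous_weight {ν : ℝ} (hν : 1 ≤ ν) :
    Continuous fun z : ℝ × ℝ => z.2 ^ (ν - 1) :=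
  (Real.continuous_rpow_const (sub_nonneg.2 hν)).comp continuous_snd

theorem weight_nonneg (ν : ℝ) {z : ℝ × ℝ} (hz : z ∈ rect T) : 0 ≤ z.2 ^ (ν - 1) :=
  Real.rpow_nonneg hz.2.1 _

theorem weight_le_one {ν : ℝ} (hν : 1 ≤ ν) {z : ℝ × ℝ} (hz : z ∈ rect T) : z.2 ^ (ν - 1) ≤ 1 :=
  Real.rpow_le_one hz.2.1 hz.2.2 (sub_nonneg.2 hν)

theorem continuousOn_l2prod {ν : ℝ} (hν : 1 ≤ ν) (u v : SmoothRect T) :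
    ContinuousOn (fun z => u.1 z * v.1 z * z.2 ^ (ν - 1)) (rect T) :=
  (u.continuousOn.mul v.continuousOn).mul (continuous_weight hν).continuousOn

theorem l2prod_self_nonneg (ν : ℝ) (u : SmoothRect T) : 0 ≤ l2prod ν u u :=
  dint_nonneg fun _ hz => mul_nonneg (mul_self_nonneg _) (weight_nonneg ν hz)

theorem l2prod_add_smul {ν : ℝ} (hν : 1 ≤ ν) (u v : SmoothRect T) (c : ℝ) :
    l2prod ν (u + c • v) (u + c • v) =
      l2prod ν u u + 2 * c * l2prod ν u v + c ^ 2 * l2prod ν v v := by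
  have h1 := continuousOn_l2prod hν u u
  have h2 := continuousOn_l2prod hν u v
  have h3 := continuousOn_l2prod hν v v
  have e2 := dint_add h1 (h2.const_mul (2 * c))
  have e3 := dint_add (h1.add (h2.const_mul (2 * c))) (h3.const_mul (c ^ 2))
  rw [l2prod, l2prod, l2prod, l2prod, ← dint_const_mul (T := T) (2 * c),
    ← dint_const_mul (T := T) (c ^ 2), ← e2]
  refine Eq.trans ?_ e3
  refine dint_congr fun z _ => ?_
  simp only [add_val, smul_val, Pi.add_apply]
  ring

theorem l2nrm_le {ν : ℝ} (hν : 1 ≤ ν) (u : SmoothRect T) : l2nrm ν u ≤ √T * nrm u := by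
  have h : l2prod ν u u ≤ T * nrm u ^ 2 := by
    rw [← dint_const]
    refine dint_mono (continuousOn_l2prod hν u u) continuousOn_const fun z hz => ?_
    have h1 : u.1 z * u.1 z ≤ nrm u ^ 2 := by
      rw [← sq, ← sq_abs]
      exact pow_le_pow_left₀ (abs_nonneg _) (u.abs_le_nrm hz) 2
    calc u.1 z * u.1 z * z.2 ^ (ν - 1) ≤ nrm u ^ 2 * 1 :=
          mul_le_mul h1 (weight_le_one hν hz) (weight_nonneg ν hz) (sq_nonneg _)
      _ = _ := mul_one _
  refine (Real.sqrt_le_sqrt h).trans_eq ?_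
  rw [Real.sqrt_mul hT.out.le, Real.sqrt_sq (nrm_nonneg u)]

theorem dint_abs_le {ν : ℝ} (hν : 1 ≤ ν) (u : SmoothRect T) :
    dint T (fun z => z.2 ^ (ν - 1) * |u.1 z|) ≤ (1 + T) / 2 * l2nrm ν u := by
  have hTp := hT.out
  refine le_of_forall_pos_le_add fun ε hε => ?_
  set δ := l2nrm ν u + ε * (2 / (1 + T)) with hδ
  have hK : 0 ≤ l2nrm ν u := Real.sqrt_nonneg _
  have hε' : 0 < ε * (2 / (1 + T)) := by positivity
  have hδ0 : 0 < δ := by linarith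
  have hle : l2prod ν u u ≤ δ ^ 2 := by
    rw [← Real.sq_sqrt (l2prod_self_nonneg ν u)]
    exact pow_le_pow_left₀ hK (by linarith) 2
  have h1 : dint T (fun z => z.2 ^ (ν - 1) * |u.1 z|) ≤
      dint T fun z => (2 * δ)⁻¹ * (u.1 z * u.1 z * z.2 ^ (ν - 1)) + δ / 2 := by
    refine dint_mono ((continuous_weight hν).continuousOn.mul u.continuousOn.abs)
      (((continuousOn_l2prod hν u u).const_mul _).add continuousOn_const) fun z hz => ?_
    have hw0 := weight_nonneg ν hz
    have hw1 := weight_le_one hν hz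
    have h2 : |u.1 z| ≤ (2 * δ)⁻¹ * (u.1 z * u.1 z) + δ / 2 := by
      rw [← abs_mul_abs_self, ← sub_nonneg]
      have : (2 * δ)⁻¹ * (|u.1 z| * |u.1 z|) + δ / 2 - |u.1 z| =
          (2 * δ)⁻¹ * (|u.1 z| - δ) ^ 2 := by field_simp; ring
      rw [this]
      positivity
    have h3 := mul_le_mul_of_nonneg_left h2 hw0
    have h4 : z.2 ^ (ν - 1) * (δ / 2) ≤ δ / 2 := mul_le_of_le_one_left (by positivity) hw1
    linarith
  rw [dint_add ((continuousOn_l2prod hν u u).const_mul _) continuousOn_const, dint_const_mul,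
    dint_const] at h1
  have h2 : (2 * δ)⁻¹ * l2prod ν u u ≤ δ / 2 := by
    calc (2 * δ)⁻¹ * l2prod ν u u ≤ (2 * δ)⁻¹ * δ ^ 2 :=
          mul_le_mul_of_nonneg_left hle (by positivity)
      _ = δ / 2 := by field_simp
  calc _ ≤ δ / 2 + T * (δ / 2) := h1.trans (add_le_add_left h2 _)
    _ = (1 + T) / 2 * l2nrm ν u + ε := by rw [hδ]; field_simp

/-! ### From square norms to supremum norms -/

/-- This rests on `(x^ν ∂_x u)' = x^{ν-1} (x ∂_x² + ν ∂_x) u`. -/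
theorem rpow_mul_abs_Dx_le {ν : ℝ} (hν : 1 ≤ ν) (u : SmoothRect T) {t x : ℝ}
    (ht : t ∈ Icc 0 T) (hx : x ∈ Icc (0 : ℝ) 1) :
    |x ^ ν * (Dx u).1 (t, x)| ≤ ∫ y in (0 : ℝ)..1, y ^ (ν - 1) * |(Delta ν u).1 (t, y)| := by
  have hcw : Continuous fun y : ℝ => y ^ (ν - 1) := Real.continuous_rpow_const (sub_nonneg.2 hν)
  have hsub : Icc 0 x ⊆ Icc (0 : ℝ) 1 := Icc_subset_Icc_right hx.2
  have hc : ContinuousOn (fun y => y ^ (ν - 1) * (Delta ν u).1 (t, y)) (Icc 0 1) :=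
    hcw.continuousOn.mul ((Delta ν u).continuousOn_x ht)
  have hftc : ∫ y in (0 : ℝ)..x, y ^ (ν - 1) * (Delta ν u).1 (t, y) =
      x ^ ν * (Dx u).1 (t, x) - 0 ^ ν * (Dx u).1 (t, 0) := by
    refine intervalIntegral.integral_eq_sub_of_hasDerivAt_of_le
      (f := fun y => y ^ ν * (Dx u).1 (t, y))
      hx.1 ?_ (fun y hy => ?_) ((hc.mono hsub).intervalIntegrable_of_Icc hx.1)
    · exact (Real.continuous_rpow_const (by linarith)).continuousOn.mul
        (((Dx u).continuousOn_x ht).mono hsub)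
    · have hy1 : y < 1 := hy.2.trans_le hx.2
      have := (Real.hasDerivAt_rpow_const (p := ν) (Or.inl hy.1.ne')).mul
        (((Dx u).hasDerivWithinAt_Dx ht ⟨hy.1.le, hy1.le⟩).hasDerivAt (Icc_mem_nhds hy.1 hy1))
      refine this.congr_deriv ?_
      have e1 : y ^ ν = y ^ (ν - 1) * y := by
        rw [← Real.rpow_add_one hy.1.ne', sub_add_cancel]
      rw [e1, Delta_apply]
      simp only [add_val, smul_val, mulX_val]
      ring
  rw [Real.zero_rpow (by linarith), zero_mul, sub_zero] at hftc
  rw [← hftc]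
  refine (intervalIntegral.abs_integral_le_integral_abs hx.1).trans ?_
  refine le_trans (intervalIntegral.integral_mono_interval (c := 0) (d := 1) le_rfl hx.1 hx.2
    (Filter.Eventually.of_forall fun _ => abs_nonneg _)
    (hc.abs.intervalIntegrable_of_Icc zero_le_one)) (le_of_eq ?_)
  refine intervalIntegral.integral_congr fun y hy => ?_
  rw [uIcc_of_le zero_le_one] at hy
  simp only [abs_mul, abs_of_nonneg (Real.rpow_nonneg hy.1 _)]

/-- The sum of the `L²` norms of `△^k u` and `∂_t² △^k u` for `k ≤ r`. -/
def l2sum (ν : ℝ) (r : ℕ) (u : SmoothRect T) : ℝ :=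
  ∑ k ∈ Finset.range (r + 1),
    (l2nrm ν ((Delta ν ^ k) u) + l2nrm ν (Dt (Dt ((Delta ν ^ k) u))))

theorem l2nrm_nonneg (ν : ℝ) (u : SmoothRect T) : 0 ≤ l2nrm ν u := Real.sqrt_nonneg _

theorem l2sum_nonneg (ν : ℝ) (r : ℕ) (u : SmoothRect T) : 0 ≤ l2sum ν r u :=
  Finset.sum_nonneg fun _ _ => add_nonneg (l2nrm_nonneg _ _) (l2nrm_nonneg _ _)

theorem l2sum_Delta_le (ν : ℝ) (r : ℕ) (u : SmoothRect T) :
    l2sum ν r (Delta ν u) ≤ l2sum ν (r + 1) u := by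
  rw [l2sum, l2sum, Finset.sum_range_succ' _ (r + 1)]
  refine le_add_of_le_of_nonneg (le_of_eq ?_) (add_nonneg (l2nrm_nonneg _ _) (l2nrm_nonneg _ _))
  simp only [pow_apply_self]

/-- The one-dimensional Sobolev inequality in `t`, applied to `x^ν ∂_x u`. -/
theorem dom_rpow_mul_abs_Dx {ν : ℝ} (hν : 1 ≤ ν) :
    ∃ C : ℝ, 0 ≤ C ∧ ∀ u : SmoothRect T, ∀ t ∈ Icc 0 T, ∀ x ∈ Icc (0 : ℝ) 1,
      x ^ ν * |(Dx u).1 (t, x)| ≤ C * l2sum ν 1 u := by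
  have hTp := hT.out
  refine ⟨(18 / T ^ 2 + 1 + 21 / T + T) * ((1 + T) / 2), by positivity, fun u t ht x hx => ?_⟩
  have h := (abs_le_integral_abs_add hT.out (g := fun s => x ^ ν * (Dx u).1 (s, x))
    (fun s hs => ((Dx u).hasDerivWithinAt_Dt hs hx).const_mul _)
    (fun s hs => ((Dt (Dx u)).hasDerivWithinAt_Dt hs hx).const_mul _)
    (((Dt (Dt (Dx u))).continuousOn_t hx).const_mul _) ht).1
  have hint : ∀ v : SmoothRect T, ∫ s in (0 : ℝ)..T, |x ^ ν * (Dx v).1 (s, x)| ≤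
      (1 + T) / 2 * l2nrm ν (Delta ν v) := by
    intro v
    have hF : ContinuousOn (fun z : ℝ × ℝ => z.2 ^ (ν - 1) * |(Delta ν v).1 z|) (rect T) :=
      (continuous_weight hν).continuousOn.mul (Delta ν v).continuousOn.abs
    refine le_trans ?_ (dint_abs_le hν (Delta ν v))
    exact intervalIntegral.integral_mono_on hT.out.le
      ((((Dx v).continuousOn_t hx).const_mul _).abs.intervalIntegrable_of_Icc hT.out.le)
      (intervalIntegrable_integral_slice hF) fun s hs => rpow_mul_abs_Dx_le hν v hs hx
  have h1 := hint u
  have h2 := hint (Dt (Dt u))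
  rw [abs_mul, abs_of_nonneg (Real.rpow_nonneg hx.1 _)] at h
  refine h.trans ?_
  rw [mul_assoc]
  refine mul_le_mul_of_nonneg_left ?_ (by positivity)
  rw [Dt_Dx, Dt_Dx]
  refine (add_le_add h1 h2).trans ?_
  rw [← mul_add]
  refine mul_le_mul_of_nonneg_left ?_ (by positivity)
  rw [← Dt_Delta, ← Dt_Delta, l2sum]
  refine le_trans (le_of_eq ?_) (Finset.single_le_sum (f := fun k =>
    l2nrm ν ((Delta ν ^ k) u) + l2nrm ν (Dt (Dt ((Delta ν ^ k) u))))
    (fun _ _ => add_nonneg (l2nrm_nonneg _ _) (l2nrm_nonneg _ _))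
    (Finset.self_mem_range_succ 1))
  simp

theorem Delta_mem_sideSpace (ν : ℝ) {u : SmoothRect T} (hu : u ∈ sideSpace T 0) :
    Delta ν u ∈ sideSpace T 0 := by
  have hD : ∀ v ∈ sideSpace T 0, Dx v ∈ sideSpace T 0 := by
    intro v hv t x hx
    by_cases ht : t ∈ Icc 0 T
    · have hsub : Icc (5 / 6 : ℝ) 1 ⊆ Icc 0 1 := Icc_subset_Icc_left (by norm_num)
      have h1 := (v.hasDerivWithinAt_Dx ht (hsub hx)).mono hsub
      have h2 : HasDerivWithinAt (fun y => v.1 (t, y)) 0 (Icc (5 / 6) 1) x :=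
        (hasDerivWithinAt_const x _ (0 : ℝ)).congr (fun y hy => hv t y hy) (hv t x hx)
      exact (uniqueDiffOn_Icc (by norm_num) x hx).eq_deriv _ h1 h2
    · exact (Dx v).2.2 _ fun h => ht h.1
  intro t x hx
  rw [Delta_apply, add_val, mulX_val, smul_val, hD _ (hD _ hu) t x hx, hD _ hu t x hx]
  simp

theorem side_mem_sideSpace {μ : Fin 2} {u : SmoothRect T} (hu : u ∈ sideSpace T μ) :
    side μ u ∈ sideSpace T 0 := by
  fin_cases μ
  · exact hu
  · intro t x hx
    exact hu t (1 - x) ⟨by linarith [hx.2], by linarith [hx.1]⟩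

theorem Dt_mem_sideSpace {u : SmoothRect T} (hu : u ∈ sideSpace T 0) : Dt u ∈ sideSpace T 0 := by
  intro t x hx
  have : (fun s => u.1 (s, x)) = fun _ => 0 := funext fun s => hu s x hx
  change derivWithin (fun s => u.1 (s, x)) _ _ = 0
  simp [this]

/-- Each further power of `△` in the square norms improves the pointwise bound by the factor
`x^{1/2}`, until the bound is uniform: if `△ u = O(x^{-a})`, then `∂_x u = O(x^{-a})`, and
`u = O(x^{-max (a - 1/2) 0})` by integration from the edge `x = 1`, where `u` vanishes. -/
theorem exists_abs_le_l2sum {ν : ℝ} (hν : 1 ≤ ν) (i : ℕ) :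
    ∃ C : ℝ, 0 ≤ C ∧ ∀ u ∈ sideSpace T 0, ∀ t ∈ Icc 0 T, ∀ x ∈ Ioc (0 : ℝ) 1,
      |u.1 (t, x)| ≤ C * l2sum ν (i + 1) u * x ^ (-max (ν - (i + 1) / 2) 0) := by
  have h1 : ∀ u ∈ sideSpace T 0, ∀ t, u.1 (t, 1) = 0 := fun u hu t =>
    hu t 1 ⟨by norm_num, le_rfl⟩
  induction i with
  | zero =>
    obtain ⟨C, hC, h⟩ := dom_rpow_mul_abs_Dx (T := T) hν
    refine ⟨2 * C, by positivity, fun u hu t ht x hx => ?_⟩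
    have := abs_le_of_abs_deriv_le (a := ν) (K := C * l2sum ν 1 u)
      (mul_nonneg hC (l2sum_nonneg _ _ _)) (fun y hy => u.hasDerivWithinAt_Dx ht hy) (h1 u hu t)
      (fun y hy => ?_) hx
    · refine this.trans (le_of_eq ?_)
      have e : (((0 : ℕ) : ℝ) + 1) / 2 = 1 / 2 := by norm_num
      rw [e, zero_add]
      ring
    · have hp : 0 < y ^ ν := Real.rpow_pos_of_pos hy.1 _
      have := h u t ht y (Ioc_subset_Icc_self hy)
      rw [Real.rpow_neg hy.1.le, ← div_eq_mul_inv, le_div_iff₀ hp]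
      linarith
  | succ i ih =>
    obtain ⟨C, hC, h⟩ := ih
    set a : ℝ := max (ν - (i + 1) / 2) 0 with ha
    have ha0 : 0 ≤ a := le_max_right _ _
    have haν : a < ν := max_lt (by linarith [(by positivity : (0 : ℝ) < (i + 1) / 2)]) (by linarith)
    have hνa : 0 < ν - a := sub_pos.2 haν
    refine ⟨2 * (C / (ν - a)), by positivity, fun u hu t ht x hx => ?_⟩
    set K := C * l2sum ν (i + 1) (Delta ν u) with hK
    have hK0 : 0 ≤ K := mul_nonneg hC (l2sum_nonneg _ _ _)
    have hder : ∀ y ∈ Ioc (0 : ℝ) 1, |(Dx u).1 (t, y)| ≤ K / (ν - a) * y ^ (-a) := fun y hy =>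
      abs_le_of_abs_mul_add_le (g := fun y => (Dx u).1 (t, y)) ha0 haν
        (fun y hy => (Dx u).hasDerivWithinAt_Dx ht hy)
        (fun y hy => h (Delta ν u) (Delta_mem_sideSpace ν hu) t ht y (Ioo_subset_Ioc_self hy)) hy
    have h2 := abs_le_of_abs_deriv_le (div_nonneg hK0 hνa.le)
      (fun y hy => u.hasDerivWithinAt_Dx ht hy) (h1 u hu t) hder hx
    have hexp : max (a - 1 / 2) 0 = max (ν - ((i + 1 : ℕ) + 1) / 2) 0 := by
      push_cast
      rcases le_total (ν - (i + 1) / 2) 0 with h0 | h0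
      · rw [ha, max_eq_right h0, max_eq_right (by norm_num), max_eq_right (by linarith)]
      · rw [ha, max_eq_left h0]
        congr 1
        ring
    rw [hexp] at h2
    refine h2.trans (mul_le_mul_of_nonneg_right ?_ (Real.rpow_nonneg hx.1.le _))
    rw [hK, mul_div_right_comm, mul_assoc 2]
    exact mul_le_mul_of_nonneg_left (mul_le_mul_of_nonneg_left (l2sum_Delta_le ν (i + 1) u)
      (by positivity)) zero_le_two

theorem exists_nrm_le_l2sum {ν : ℝ} (hν : 1 ≤ ν) :
    ∃ r : ℕ, ∃ C : ℝ, 0 ≤ C ∧ ∀ u ∈ sideSpace T 0, nrm u ≤ C * l2sum ν r u := by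
  obtain ⟨i, hi⟩ := exists_nat_ge (2 * ν)
  obtain ⟨C, hC, h⟩ := exists_abs_le_l2sum (T := T) hν i
  refine ⟨i + 1, C, hC, fun u hu => nrm_le fun t ht x hx => ?_⟩
  rw [max_eq_right (by linarith)] at h
  have hcl : closure (Ioc (0 : ℝ) 1) = Icc 0 1 := closure_Ioc zero_ne_one
  refine le_on_closure (s := Ioc (0 : ℝ) 1) (f := fun x => |u.1 (t, x)|)
    (g := fun _ => C * l2sum ν (i + 1) u) (fun y hy => ?_) ?_ continuousOn_const (by rwa [hcl])
  · simpa using h u hu t ht y hy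
  · rw [hcl]
    exact (u.continuousOn_x ht).abs

end SmoothRect

namespace SmoothRect

variable {T : ℝ} [hT : Fact (0 < T)]

/-! ### Comparison of the gradings -/

theorem Dt_pow_Delta_pow (ν : ℝ) (j k : ℕ) (u : SmoothRect T) :
    (Dt ^ j) ((Delta ν ^ k) u) = (Delta ν ^ k) ((Dt ^ j) u) :=
  LinearMap.congr_fun ((show Commute (Dt : Module.End ℝ (SmoothRect T)) (Delta ν) from
    LinearMap.ext fun u => Dt_Delta ν u).pow_pow j k) u

theorem Dt_pow_side (j : ℕ) (μ : Fin 2) (u : SmoothRect T) :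
    (Dt ^ j) (side μ u) = side μ ((Dt ^ j) u) :=
  LinearMap.congr_fun ((show Commute (Dt : Module.End ℝ (SmoothRect T)) (side μ) from
    LinearMap.ext fun u => Dt_side μ u).pow_left j) u

/-- After the change of variable of the side `μ`, the operators and the weight depend on `μ` only
through the coefficient of `∂_x`. -/
theorem dint_mixed (N : ℝ) (μ : Fin 2) (j k : ℕ) (u : SmoothRect T) :
    (∫ t in (0 : ℝ)..T, ∫ x in (0 : ℝ)..1, |mixed T N μ j k u.1 (t, x)| ^ 2 * weight N μ x) =
      l2prod (ord N μ) ((Dt ^ (2 * j)) ((Delta (ord N μ) ^ k) (side μ u)))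
        ((Dt ^ (2 * j)) ((Delta (ord N μ) ^ k) (side μ u))) := by
  have hsq : ∀ z, |mixed T N μ j k u.1 z| ^ 2 =
      (side μ ((Dt ^ (2 * j)) ((Delta (ord N μ) ^ k) (side μ u)))).1 z ^ 2 := by
    intro z
    rw [← Dt_pow_side, ← Lap_pow, mixed_val, Module.End.mul_apply, pow_mul Dt, sq Dt, sq_abs]
    rcases neg_pow_apply (Lap N μ) k u with h | h <;>
      rcases neg_pow_apply (Dt * Dt) j (((-Lap N μ) ^ k) u) with h' | h' <;> rw [h', h] <;> simp
  simp only [hsq, l2prod, dint]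
  set v := (Dt ^ (2 * j)) ((Delta (ord N μ) ^ k) (side μ u))
  refine intervalIntegral.integral_congr fun t _ => ?_
  fin_cases μ
  · refine intervalIntegral.integral_congr fun x _ => ?_
    have h : (5 / 2 - 1 : ℝ) = 3 / 2 := by norm_num
    simp only [weight, ord, side, h, ← sq]
    rfl
  · have h := intervalIntegral.integral_comp_sub_left (a := 0) (b := 1)
      (fun x => v.1 (t, x) * v.1 (t, x) * x ^ (N / 2 - 1)) 1
    rw [sub_self, sub_zero] at h
    refine Eq.trans ?_ h
    refine intervalIntegral.integral_congr fun x _ => ?_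
    simp only [weight, ← sq]
    rfl

theorem sideL2_eq (N : ℝ) (μ : Fin 2) (n : ℕ) (u : SmoothRect T) :
    sideL2 T N μ n u = √(∑ i ∈ pairs n,
      l2prod (ord N μ) ((Dt ^ (2 * i.1)) ((Delta (ord N μ) ^ i.2) (side μ u)))
        ((Dt ^ (2 * i.1)) ((Delta (ord N μ) ^ i.2) (side μ u)))) := by
  rw [sideL2]
  simp only [dint_mixed]

theorem sideL2_nonneg (N : ℝ) (μ : Fin 2) (n : ℕ) (u : SmoothRect T) : 0 ≤ sideL2 T N μ n u :=
  Real.sqrt_nonneg _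

theorem l2nrm_le_sideL2 (N : ℝ) (μ : Fin 2) {n j k : ℕ} (h : j + k ≤ n) (u : SmoothRect T) :
    l2nrm (ord N μ) ((Dt ^ (2 * j)) ((Delta (ord N μ) ^ k) (side μ u))) ≤ sideL2 T N μ n u := by
  rw [sideL2_eq, l2nrm]
  set f : ℕ × ℕ → ℝ := fun i =>
    l2prod (ord N μ) ((Dt ^ (2 * i.1)) ((Delta (ord N μ) ^ i.2) (side μ u)))
        ((Dt ^ (2 * i.1)) ((Delta (ord N μ) ^ i.2) (side μ u))) with hf
  have hf0 : ∀ i, 0 ≤ f i := fun i => l2prod_self_nonneg _ _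
  have h1 : f (j, k) ≤ ∑ i ∈ pairs n, f i :=
    Finset.single_le_sum (fun i _ => hf0 i) (pairs_mem h)
  exact Real.sqrt_le_sqrt h1

theorem dom_sideL2_sideSup {N : ℝ} {μ : Fin 2} (hN : 1 ≤ ord N μ) (n : ℕ) :
    Dom (fun u : SmoothRect T => sideL2 T N μ n u) fun u => sideSup T N μ n u := by
  refine Dom.le_trans (g := fun u => ∑ i ∈ pairs n,
    l2nrm (ord N μ) ((Dt ^ (2 * i.1)) ((Delta (ord N μ) ^ i.2) (side μ u)))) (fun u => ?_)
    (Dom.sum fun i hi => ⟨√T, Real.sqrt_nonneg _, fun u => ?_⟩)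
  · rw [sideL2_eq]
    refine Real.sqrt_le_iff.2 ⟨Finset.sum_nonneg fun _ _ => l2nrm_nonneg _ _, ?_⟩
    refine le_trans (Finset.sum_le_sum fun i _ => ?_)
      (Finset.sum_sq_le_sq_sum_of_nonneg fun _ _ => l2nrm_nonneg _ _)
    exact (Real.sq_sqrt (l2prod_self_nonneg _ _)).ge
  · refine (l2nrm_le hN _).trans (mul_le_mul_of_nonneg_left ?_ (Real.sqrt_nonneg _))
    rw [← nrm_side μ, ← Dt_pow_side, ← Lap_pow]
    exact nrm_le_sideSup N μ (mem_pairs hi) u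

theorem exists_sideSup_le_sideL2 {N : ℝ} {μ : Fin 2} (hN : 1 ≤ ord N μ) :
    ∃ r : ℕ, ∀ n, ∃ C : ℝ, 0 ≤ C ∧ ∀ u ∈ sideSpace T μ,
      sideSup T N μ n u ≤ C * sideL2 T N μ (n + r) u := by
  obtain ⟨r, C, hC, h⟩ := exists_nrm_le_l2sum (T := T) hN
  refine ⟨r + 1, fun n => ⟨C * ((r + 1) * 2), by positivity, fun u hu => sideSup_le ?_⟩⟩
  intro j k hjk
  have hmem : ∀ i, ∀ v ∈ sideSpace T 0, (Delta (ord N μ) ^ i) v ∈ sideSpace T 0 := by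
    intro i
    induction i with
    | zero => exact fun v hv => hv
    | succ i ih =>
      intro v hv
      rw [← pow_apply_self]
      exact ih _ (Delta_mem_sideSpace _ hv)
  have hmem' : ∀ i, ∀ v ∈ sideSpace T 0, (Dt ^ i) v ∈ sideSpace T 0 := by
    intro i
    induction i with
    | zero => exact fun v hv => hv
    | succ i ih =>
      intro v hv
      rw [← pow_apply_self]
      exact ih _ (Dt_mem_sideSpace hv)
  have h1 := h _ (hmem' (2 * j) _ (hmem k _ (side_mem_sideSpace hu)))
  have h2 : nrm ((Dt ^ (2 * j)) ((Lap N μ ^ k) u)) =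
      nrm ((Dt ^ (2 * j)) ((Delta (ord N μ) ^ k) (side μ u))) := by
    rw [Lap_pow, Dt_pow_side, nrm_side]
  rw [h2]
  refine h1.trans ?_
  rw [mul_assoc]
  refine mul_le_mul_of_nonneg_left ?_ hC
  have h3 : ∀ i ∈ Finset.range (r + 1),
      l2nrm (ord N μ) ((Delta (ord N μ) ^ i) ((Dt ^ (2 * j)) ((Delta (ord N μ) ^ k) (side μ u)))) +
      l2nrm (ord N μ)
        (Dt (Dt ((Delta (ord N μ) ^ i) ((Dt ^ (2 * j)) ((Delta (ord N μ) ^ k) (side μ u)))))) ≤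
      2 * sideL2 T N μ (n + (r + 1)) u := by
    intro i hi
    have hi' := Finset.mem_range.1 hi
    have e : (Delta (ord N μ) ^ i) ((Dt ^ (2 * j)) ((Delta (ord N μ) ^ k) (side μ u))) =
        (Dt ^ (2 * j)) ((Delta (ord N μ) ^ (i + k)) (side μ u)) := by
      rw [← Dt_pow_Delta_pow, pow_add, Module.End.mul_apply]
    have e' : (Dt ^ (2 * (j + 1))) ((Delta (ord N μ) ^ (i + k)) (side μ u)) =
        Dt (Dt ((Dt ^ (2 * j)) ((Delta (ord N μ) ^ (i + k)) (side μ u)))) := by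
      rw [show 2 * (j + 1) = 2 * j + 1 + 1 by ring, pow_succ', pow_succ', Module.End.mul_apply,
        Module.End.mul_apply]
    have h4 := l2nrm_le_sideL2 N μ (n := n + (r + 1)) (j := j) (k := i + k) (by lia) u
    have h5 := l2nrm_le_sideL2 N μ (n := n + (r + 1)) (j := j + 1) (k := i + k) (by lia) u
    rw [e'] at h5
    rw [e, two_mul (sideL2 T N μ (n + (r + 1)) u)]
    exact add_le_add h4 h5
  refine (Finset.sum_le_sum h3).trans (le_of_eq ?_)
  simp
  ring

/-! ### The combined gradings -/

theorem cut_add_cut (c : Cutoff) (u : SmoothRect T) : cut T c 0 u + cut T c 1 u = u := by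
  ext z _
  change c.toFun z.2 * u.1 z + (1 - c.toFun z.2) * u.1 z = u.1 z
  ring

theorem sideSup_le_combSup (N : ℝ) (c : Cutoff) (μ : Fin 2) (n : ℕ) (u : SmoothRect T) :
    sideSup T N μ n (cut T c μ u) ≤ combSup T N c n u :=
  le_ciSup (f := fun μ => sideSup T N μ n (cut T c μ u)) (Set.finite_range _).bddAbove μ

theorem combSup_nonneg (N : ℝ) (c : Cutoff) (n : ℕ) (u : SmoothRect T) : 0 ≤ combSup T N c n u :=
  (sideSup_nonneg _ _ _ _).trans (sideSup_le_combSup N c 0 n u)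

theorem combSup_le {N : ℝ} {c : Cutoff} {n : ℕ} {u : SmoothRect T} {C : ℝ}
    (h : ∀ μ, sideSup T N μ n (cut T c μ u) ≤ C) : combSup T N c n u ≤ C := ciSup_le h

theorem sideL2_le_combL2 (N : ℝ) (c : Cutoff) (μ : Fin 2) (n : ℕ) (u : SmoothRect T) :
    sideL2 T N μ n (cut T c μ u) ≤ combL2 T N c n u := by
  refine Real.le_sqrt_of_sq_le ?_
  exact Finset.single_le_sum (f := fun μ => sideL2 T N μ n (cut T c μ u) ^ 2)
    (fun _ _ => sq_nonneg _) (Finset.mem_univ μ)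

theorem combL2_nonneg (N : ℝ) (c : Cutoff) (n : ℕ) (u : SmoothRect T) : 0 ≤ combL2 T N c n u :=
  Real.sqrt_nonneg _

theorem combL2_le (N : ℝ) (c : Cutoff) (n : ℕ) (u : SmoothRect T) :
    combL2 T N c n u ≤ sideL2 T N 0 n (cut T c 0 u) + sideL2 T N 1 n (cut T c 1 u) := by
  have h0 := sideL2_nonneg N 0 n (cut T c 0 u)
  have h1 := sideL2_nonneg N 1 n (cut T c 1 u)
  refine Real.sqrt_le_iff.2 ⟨add_nonneg h0 h1, ?_⟩
  rw [Fin.sum_univ_two]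
  nlinarith

theorem one_le_ord {N : ℝ} (hN : 4 < N) (μ : Fin 2) : 1 ≤ ord N μ := by
  fin_cases μ
  · change (1 : ℝ) ≤ 5 / 2
    norm_num
  · change 1 ≤ N / 2
    linarith

theorem dom_combSup_W (N : ℝ) (c : Cutoff) (n : ℕ) :
    Dom (combSup T N c n) (W n) :=
  Dom.le_trans (g := fun u => sideSup T N 0 n (cut T c 0 u) + sideSup T N 1 n (cut T c 1 u))
    (fun u => combSup_le fun μ => by
      have h0 := sideSup_nonneg N 0 n (cut T c 0 u)
      have h1 := sideSup_nonneg N 1 n (cut T c 1 u)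
      fin_cases μ
      · exact le_add_of_nonneg_right h1
      · exact le_add_of_nonneg_left h0)
    ((dom_sideSup_cut N c 0 n).add (dom_sideSup_cut N c 1 n))

theorem dom_W_combSup {N : ℝ} (hN : 4 < N) (c : Cutoff) (n : ℕ) :
    Dom (W n) (combSup T N c n) := by
  have h := fun μ : Fin 2 => ((dom_W_sideSup (T := T)
    (zero_lt_one.trans_le (one_le_ord hN μ)) n).comp
    (cut T c μ)).trans_le fun u => sideSup_le_combSup N c μ n u
  refine Dom.le_trans (fun u => ?_) ((h 0).add (h 1))
  conv_lhs => rw [← cut_add_cut c u]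
  exact W_add_le n _ _

theorem dom_combL2_combSup {N : ℝ} (hN : 4 < N) (c : Cutoff) (n : ℕ) :
    Dom (combL2 T N c n) (combSup T N c n) := by
  have h := fun μ : Fin 2 => ((dom_sideL2_sideSup (T := T) (one_le_ord hN μ) n).comp
    (cut T c μ)).trans_le fun u => sideSup_le_combSup N c μ n u
  exact Dom.le_trans (combL2_le N c n) ((h 0).add (h 1))

theorem sideSup_mono (N : ℝ) (μ : Fin 2) (u : SmoothRect T) :
    Monotone fun n => sideSup T N μ n u := fun _ _ h =>
  sideSup_le fun _ _ hjk => nrm_le_sideSup N μ (hjk.trans h) u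

theorem pairs_mono : Monotone pairs := fun _ _ h _ hi => pairs_mem ((mem_pairs hi).trans h)

theorem sideL2_mono (N : ℝ) (μ : Fin 2) (u : SmoothRect T) :
    Monotone fun n => sideL2 T N μ n u := fun n m h => by
  simp only [sideL2_eq]
  exact Real.sqrt_le_sqrt (Finset.sum_le_sum_of_subset_of_nonneg (pairs_mono h)
    fun _ _ _ => l2prod_self_nonneg _ _)

theorem combSup_mono (N : ℝ) (c : Cutoff) (u : SmoothRect T) :
    Monotone fun n => combSup T N c n u := fun _ _ h =>
  combSup_le fun μ => (sideSup_mono N μ _ h).trans (sideSup_le_combSup N c μ _ u)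

theorem combL2_mono (N : ℝ) (c : Cutoff) (u : SmoothRect T) :
    Monotone fun n => combL2 T N c n u := fun _ _ h =>
  Real.sqrt_le_sqrt (Finset.sum_le_sum fun μ _ =>
    pow_le_pow_left₀ (sideL2_nonneg _ _ _ _) (sideL2_mono N μ _ h) 2)

theorem exists_dom_sideSup_sideL2 {N : ℝ} (hN : 4 < N) :
    ∃ r : ℕ, ∀ (μ : Fin 2) (n : ℕ), Dom (fun u : sideSpace T μ => sideSup T N μ n u.1)
      fun u => sideL2 T N μ (n + r) u.1 := by
  obtain ⟨r₀, h₀⟩ := exists_sideSup_le_sideL2 (T := T) (one_le_ord hN 0)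
  obtain ⟨r₁, h₁⟩ := exists_sideSup_le_sideL2 (T := T) (one_le_ord hN 1)
  refine ⟨r₀ + r₁, fun μ n => ?_⟩
  fin_cases μ
  · obtain ⟨C, hC, h⟩ := h₀ n
    exact ⟨C, hC, fun u => (h u.1 u.2).trans
      (mul_le_mul_of_nonneg_left (sideL2_mono N 0 _ (by lia)) hC)⟩
  · obtain ⟨C, hC, h⟩ := h₁ n
    exact ⟨C, hC, fun u => (h u.1 u.2).trans
      (mul_le_mul_of_nonneg_left (sideL2_mono N 1 _ (by lia)) hC)⟩

theorem exists_dom_combSup_combL2 {N : ℝ} (hN : 4 < N) (c : Cutoff) :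
    ∃ r : ℕ, ∀ n, Dom (combSup T N c n) (combL2 T N c (n + r)) := by
  obtain ⟨r, h⟩ := exists_dom_sideSup_sideL2 (T := T) hN
  refine ⟨r, fun n => ?_⟩
  have h' := fun μ : Fin 2 => ((h μ n).comp
    fun u : SmoothRect T => (⟨cut T c μ u, cut_mem T c μ u⟩ : sideSpace T μ)).trans_le
    fun u => sideL2_le_combL2 N c μ (n + r) u
  refine Dom.le_trans (fun u => combSup_le fun μ => ?_) ((h' 0).add (h' 1))
  have h0 := sideSup_nonneg N 0 n (cut T c 0 u)
  have h1 := sideSup_nonneg N 1 n (cut T c 1 u)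
  fin_cases μ
  · exact le_add_of_nonneg_right h1
  · exact le_add_of_nonneg_left h0

theorem tamelyEquivalent_combSup_combL2 {N : ℝ} (hN : 4 < N) (c : Cutoff) :
    TamelyEquivalent (combSup T N c) (combL2 T N c) := by
  obtain ⟨r, h⟩ := exists_dom_combSup_combL2 (T := T) hN c
  refine ⟨r, 0, fun n _ => ?_⟩
  obtain ⟨C, hC, h1⟩ := h n
  obtain ⟨D, hD, h2⟩ := dom_combL2_combSup (T := T) hN c n
  refine ⟨C + D, fun u => ⟨(h1 u).trans ?_, (h2 u).trans ?_⟩⟩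
  · exact mul_le_mul_of_nonneg_right (le_add_of_nonneg_right hD) (combL2_nonneg _ _ _ _)
  · exact mul_le_mul (le_add_of_nonneg_left hC) (combSup_mono N c u (Nat.le_add_right n r))
      (combSup_nonneg _ _ _ _) (add_nonneg hC hD)

theorem sumMap_comp_splitMap (c : Cutoff) : sumMap T ∘ₗ splitMap T c = LinearMap.id :=
  LinearMap.ext fun u => cut_add_cut c u

theorem dom_combSup_sumMap {N : ℝ} (hN : 4 < N) (c : Cutoff) (n : ℕ) :
    Dom (fun u => combSup T N c n (sumMap T u))
      (prodGrading (sideGradingSup T N 0) (sideGradingSup T N 1) n) := by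
  have h := fun μ : Fin 2 => dom_W_sideSup (T := T) (zero_lt_one.trans_le (one_le_ord hN μ)) n
  have h0 := ((h 0).comp fun u : sideSpace T 0 × sideSpace T 1 => u.1.1).trans_le
    (h := prodGrading (sideGradingSup T N 0) (sideGradingSup T N 1) n)
    fun u => le_add_of_nonneg_right (sideSup_nonneg N 1 n u.2.1)
  have h1 := ((h 1).comp fun u : sideSpace T 0 × sideSpace T 1 => u.2.1).trans_le
    (h := prodGrading (sideGradingSup T N 0) (sideGradingSup T N 1) n)
    fun u => le_add_of_nonneg_left (sideSup_nonneg N 0 n u.1.1)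
  exact ((dom_combSup_W N c n).comp (sumMap T)).trans
    (Dom.le_trans (fun u => W_add_le n _ _) (h0.add h1))

theorem isTameDirectSummandVia_combSup {N : ℝ} (hN : 4 < N) (c : Cutoff) :
    IsTameDirectSummandVia (combSup T N c)
      (prodGrading (sideGradingSup T N 0) (sideGradingSup T N 1)) (splitMap T c) (sumMap T) where
  tame_left := ⟨0, 0, fun n _ => ⟨2, fun u => by
    rw [two_mul]
    exact add_le_add (sideSup_le_combSup N c 0 n u) (sideSup_le_combSup N c 1 n u)⟩⟩
  tame_right := ⟨0, 0, fun n _ => by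
    obtain ⟨C, _, h⟩ := dom_combSup_sumMap (T := T) hN c n
    exact ⟨C, h⟩⟩
  comp_eq_id := sumMap_comp_splitMap c

theorem isTameDirectSummandVia_combL2 {N : ℝ} (hN : 4 < N) (c : Cutoff) :
    IsTameDirectSummandVia (combL2 T N c)
      (prodGrading (sideGradingL2 T N 0) (sideGradingL2 T N 1)) (splitMap T c) (sumMap T) where
  tame_left := ⟨0, 0, fun n _ => ⟨2, fun u => by
    rw [two_mul]
    exact add_le_add (sideL2_le_combL2 N c 0 n u) (sideL2_le_combL2 N c 1 n u)⟩⟩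
  tame_right := by
    obtain ⟨r, hr⟩ := exists_dom_sideSup_sideL2 (T := T) hN
    refine ⟨r, 0, fun n _ => ?_⟩
    have h0 := ((hr 0 n).comp fun u : sideSpace T 0 × sideSpace T 1 => u.1).trans_le
      (h := prodGrading (sideGradingL2 T N 0) (sideGradingL2 T N 1) (n + r))
      fun u => le_add_of_nonneg_right (sideL2_nonneg N 1 (n + r) u.2.1)
    have h1 := ((hr 1 n).comp fun u : sideSpace T 0 × sideSpace T 1 => u.2).trans_le
      (h := prodGrading (sideGradingL2 T N 0) (sideGradingL2 T N 1) (n + r))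
      fun u => le_add_of_nonneg_left (sideL2_nonneg N 0 (n + r) u.1.1)
    obtain ⟨C, _, h⟩ := ((dom_combL2_combSup (T := T) hN c n).comp (sumMap T)).trans
      ((dom_combSup_sumMap hN c n).trans (Dom.le_trans (fun u => le_rfl) (h0.add h1)))
    exact ⟨C, h⟩
  comp_eq_id := sumMap_comp_splitMap c

end SmoothRect

/-! ### Topology and completeness -/

/-- Taylor's formula of first order with a bound for the remainder, on a convex set. -/
theorem abs_sub_sub_mul_le {s : Set ℝ} (hs : Convex ℝ s) {f f' f'' : ℝ → ℝ} {M : ℝ}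
    (hf : ∀ x ∈ s, HasDerivWithinAt f (f' x) s x) (hf' : ∀ x ∈ s, HasDerivWithinAt f' (f'' x) s x)
    (hM : ∀ x ∈ s, |f'' x| ≤ M) {x y : ℝ} (hx : x ∈ s) (hy : y ∈ s) :
    |f y - f x - f' x * (y - x)| ≤ M * |y - x| ^ 2 := by
  have hM0 : 0 ≤ M := (abs_nonneg _).trans (hM x hx)
  have hsub : uIcc x y ⊆ s := by
    rw [← segment_eq_uIcc]
    exact hs.segment_subset hx hy
  have h1 : ∀ z ∈ uIcc x y, ‖f' z - f' x‖ ≤ M * |y - x| := by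
    intro z hz
    refine (hs.norm_image_sub_le_of_norm_hasDerivWithin_le hf' hM hx (hsub hz)).trans ?_
    exact mul_le_mul_of_nonneg_left (abs_sub_left_of_mem_uIcc hz) hM0
  have h2 := (convex_uIcc x y).norm_image_sub_le_of_norm_hasDerivWithin_le
    (f := fun z => f z - f' x * z) (f' := fun z => f' z - f' x)
    (fun z hz => ((hf z (hsub hz)).mono hsub).sub
      (by simpa using (hasDerivWithinAt_id z (uIcc x y)).const_mul (f' x)))
    h1 left_mem_uIcc right_mem_uIcc
  rw [Real.norm_eq_abs, Real.norm_eq_abs] at h2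
  calc |f y - f x - f' x * (y - x)| = |f y - f' x * y - (f x - f' x * x)| := by congr 1; ring
    _ ≤ M * |y - x| * |y - x| := h2
    _ = _ := by ring

namespace SmoothRect

variable {T : ℝ} [hT : Fact (0 < T)]

/-- The operators `∂_t^j ∂_x^k`. -/
def D (j k : ℕ) : Module.End ℝ (SmoothRect T) := Dt ^ j * Dx ^ k

theorem Dt_comm_Dx : Commute (Dt : Module.End ℝ (SmoothRect T)) Dx :=
  LinearMap.ext fun u => Dt_Dx u

theorem Dt_D (j k : ℕ) (u : SmoothRect T) : Dt (D j k u) = D (j + 1) k u := by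
  simp only [D, pow_succ' Dt, Module.End.mul_apply]

theorem Dx_D (j k : ℕ) (u : SmoothRect T) : Dx (D j k u) = D j (k + 1) u := by
  have h : (Dx : Module.End ℝ (SmoothRect T)) * (Dt ^ j * Dx ^ k) = Dt ^ j * Dx ^ (k + 1) := by
    rw [pow_succ', ← mul_assoc, ← mul_assoc, (Dt_comm_Dx.pow_left j).eq]
  exact LinearMap.congr_fun h u

theorem D_zero_zero (u : SmoothRect T) : D 0 0 u = u := by simp [D]

/-- The seminorms `‖∂_t^j ∂_x^k u‖_∞`. -/
def derivSeminorm : SeminormFamily ℝ (SmoothRect T) (ℕ × ℕ) := fun i =>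
  Seminorm.of (fun u => nrm (D i.1 i.2 u))
    (fun u v => by rw [map_add]; exact nrm_add_le _ _)
    (fun c u => by rw [map_smul, nrm_smul, Real.norm_eq_abs])

theorem derivSeminorm_apply (i : ℕ × ℕ) (u : SmoothRect T) :
    derivSeminorm i u = nrm (D i.1 i.2 u) := rfl

/-- The derivatives of a function, as a family of functions on the rectangle. -/
def derivs : SmoothRect T →+ (ℕ × ℕ → UniformFun (rect T) ℝ) where
  toFun u i := UniformFun.ofFun fun z : rect T => (D i.1 i.2 u).1 z
  map_zero' := by
    funext i
    simp only [map_zero]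
    rfl
  map_add' u v := by
    funext i
    simp only [map_add]
    rfl

theorem isInducing_derivs : IsInducing (derivs (T := T)) := by
  have h1 : ∀ j (u : SmoothRect T), (dt T)^[j] u.1 = ((Dt ^ j) u).1 := by
    intro j
    induction j with
    | zero => exact fun _ => rfl
    | succ j ih =>
      intro u
      rw [Function.iterate_succ_apply, ← pow_apply_self, ← ih]
      rfl
  have h2 : ∀ j (u : SmoothRect T), dx^[j] u.1 = ((Dx ^ j) u).1 := by
    intro j
    induction j with
    | zero => exact fun _ => rfl
    | succ j ih =>
      intro u
      rw [Function.iterate_succ_apply, ← pow_apply_self, ← ih]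
      rfl
  have h3 : (fun (u : SmoothRect T) (i : ℕ × ℕ) =>
      UniformFun.ofFun fun z : rect T => ((dt T)^[i.1] (dx^[i.2] u.1)) z) =
      (derivs : SmoothRect T → ℕ × ℕ → UniformFun (rect T) ℝ) := by
    funext u i
    rw [h2, h1]
    rfl
  exact ⟨congrArg (fun f => TopologicalSpace.induced f inferInstance) h3⟩

instance : IsTopologicalAddGroup (SmoothRect T) :=
  isInducing_derivs.topologicalAddGroup derivs

theorem withSeminorms_derivSeminorm : WithSeminorms (derivSeminorm (T := T)) := by
  rw [SeminormFamily.withSeminorms_iff_nhds_eq_iInf]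
  have h0 : 𝓝 (0 : SmoothRect T) = comap derivs (𝓝 0) := by
    rw [isInducing_derivs.nhds_eq_comap, map_zero]
  rw [h0, nhds_pi, Filter.pi, comap_iInf]
  refine iInf_congr fun i => ?_
  rw [comap_comap]
  have hb := (UniformFun.hasBasis_nhds_zero_of_basis (α := rect T)
    (Metric.nhds_basis_ball (x := (0 : ℝ)))).comap ((fun f => f i) ∘ derivs (T := T))
  have hb' := (Metric.nhds_basis_ball (x := (0 : ℝ))).comap (derivSeminorm (T := T) i)
  refine le_antisymm ((hb.le_basis_iff hb').2 fun ε hε => ⟨ε / 2, half_pos hε, fun u hu => ?_⟩)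
    ((hb'.le_basis_iff hb).2 fun ε hε => ⟨ε, hε, fun u hu z => ?_⟩)
  · have : nrm (D i.1 i.2 u) ≤ ε / 2 := nrm_le fun t ht x hx => by
      have := hu ⟨(t, x), ht, hx⟩
      rw [mem_ball_zero_iff] at this
      exact this.le
    rw [mem_preimage, mem_ball_zero_iff, derivSeminorm_apply, Real.norm_eq_abs,
      abs_of_nonneg (nrm_nonneg _)]
    linarith
  · rw [mem_preimage, mem_ball_zero_iff, derivSeminorm_apply, Real.norm_eq_abs,
      abs_of_nonneg (nrm_nonneg _)] at hu
    rw [mem_ball_zero_iff]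
    exact ((D i.1 i.2 u).abs_le_nrm z.2).trans_lt hu

theorem abs_taylor_le (u : SmoothRect T) {z w : ℝ × ℝ} (hz : z ∈ rect T) (hw : w ∈ rect T) :
    |u.1 z - u.1 w - ((Dt u).1 w * (z.1 - w.1) + (Dx u).1 w * (z.2 - w.2))| ≤
      (nrm (Dt (Dt u)) + nrm (Dx (Dt u)) + nrm (Dx (Dx u))) * ‖z - w‖ ^ 2 := by
  have h1 : |z.1 - w.1| ≤ ‖z - w‖ := norm_fst_le (z - w)
  have h2 : |z.2 - w.2| ≤ ‖z - w‖ := norm_snd_le (z - w)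
  have e1 := abs_sub_sub_mul_le (convex_Icc 0 T) (fun t ht => u.hasDerivWithinAt_Dt ht hz.2)
    (fun t ht => (Dt u).hasDerivWithinAt_Dt ht hz.2)
    (fun t ht => (Dt (Dt u)).abs_le_nrm (z := (t, z.2)) ⟨ht, hz.2⟩) hw.1 hz.1
  have e2 := abs_sub_sub_mul_le (convex_Icc 0 1) (fun x hx => u.hasDerivWithinAt_Dx hw.1 hx)
    (fun x hx => (Dx u).hasDerivWithinAt_Dx hw.1 hx)
    (fun x hx => (Dx (Dx u)).abs_le_nrm (z := (w.1, x)) ⟨hw.1, hx⟩) hw.2 hz.2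
  have e3 : |(Dt u).1 (w.1, z.2) - (Dt u).1 (w.1, w.2)| ≤ nrm (Dx (Dt u)) * |z.2 - w.2| :=
    (convex_Icc 0 1).norm_image_sub_le_of_norm_hasDerivWithin_le
      (fun x hx => (Dt u).hasDerivWithinAt_Dx hw.1 hx)
      (fun x hx => (Dx (Dt u)).abs_le_nrm (z := (w.1, x)) ⟨hw.1, hx⟩) hw.2 hz.2
  have n1 := nrm_nonneg (Dt (Dt u))
  have n2 := nrm_nonneg (Dx (Dt u))
  have n3 := nrm_nonneg (Dx (Dx u))
  have e : u.1 z - u.1 w - ((Dt u).1 w * (z.1 - w.1) + (Dx u).1 w * (z.2 - w.2)) =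
      (u.1 (z.1, z.2) - u.1 (w.1, z.2) - (Dt u).1 (w.1, z.2) * (z.1 - w.1)) +
      (u.1 (w.1, z.2) - u.1 (w.1, w.2) - (Dx u).1 (w.1, w.2) * (z.2 - w.2)) +
      ((Dt u).1 (w.1, z.2) - (Dt u).1 (w.1, w.2)) * (z.1 - w.1) := by ring
  rw [e]
  refine (abs_add_le _ _).trans ((add_le_add ((abs_add_le _ _).trans (add_le_add e1 e2))
    (le_of_eq (abs_mul _ _))).trans ?_)
  have p1 : |z.1 - w.1| ^ 2 ≤ ‖z - w‖ ^ 2 := pow_le_pow_left₀ (abs_nonneg _) h1 2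
  have p2 : |z.2 - w.2| ^ 2 ≤ ‖z - w‖ ^ 2 := pow_le_pow_left₀ (abs_nonneg _) h2 2
  have p3 : |z.2 - w.2| * |z.1 - w.1| ≤ ‖z - w‖ ^ 2 := by
    rw [sq]; exact mul_le_mul h2 h1 (abs_nonneg _) (norm_nonneg _)
  calc _ ≤ nrm (Dt (Dt u)) * ‖z - w‖ ^ 2 + nrm (Dx (Dx u)) * ‖z - w‖ ^ 2 +
        nrm (Dx (Dt u)) * |z.2 - w.2| * |z.1 - w.1| := by gcongr
    _ ≤ nrm (Dt (Dt u)) * ‖z - w‖ ^ 2 + nrm (Dx (Dx u)) * ‖z - w‖ ^ 2 +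
        nrm (Dx (Dt u)) * ‖z - w‖ ^ 2 := by rw [mul_assoc]; gcongr
    _ = _ := by ring

/-- Completeness: the limits of the derivatives are the derivatives of the limit, since the
remainders in Taylor's formula are bounded along the sequence. -/
theorem exists_tendsto_of_cauchy {f : ℕ → SmoothRect T}
    (hf : ∀ j k, ∀ ε : ℝ, 0 < ε → ∃ K, ∀ m l, K ≤ m → K ≤ l → nrm (D j k (f m - f l)) < ε) :
    ∃ g : SmoothRect T, Tendsto f atTop (𝓝 g) := by
  have hval : ∀ j k m l, ∀ z ∈ rect T,
      |(D j k (f m)).1 z - (D j k (f l)).1 z| ≤ nrm (D j k (f m - f l)) := by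
    intro j k m l z hz
    rw [← sub_val, ← map_sub]
    exact abs_le_nrm _ hz
  have hlim : ∀ j k, ∀ z : ℝ × ℝ, ∃ y : ℝ,
      z ∈ rect T → Tendsto (fun m => (D j k (f m)).1 z) atTop (𝓝 y) := by
    intro j k z
    by_cases hz : z ∈ rect T
    · have : CauchySeq fun m => (D j k (f m)).1 z := by
        refine Metric.cauchySeq_iff.2 fun ε hε => ?_
        obtain ⟨K, hK⟩ := hf j k ε hε
        exact ⟨K, fun m hm l hl => (hval j k m l z hz).trans_lt (hK m l hm hl)⟩
      obtain ⟨y, hy⟩ := cauchySeq_tendsto_of_complete this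
      exact ⟨y, fun _ => hy⟩
    · exact ⟨0, fun h => absurd h hz⟩
  choose g hg using hlim
  -- the derivatives of each order are bounded along the sequence
  have hbdd : ∀ j k, ∃ M : ℝ, 0 ≤ M ∧ ∀ᶠ m in atTop, nrm (D j k (f m)) ≤ M := by
    intro j k
    obtain ⟨K, hK⟩ := hf j k 1 one_pos
    refine ⟨1 + nrm (D j k (f K)), add_nonneg zero_le_one (nrm_nonneg _), ?_⟩
    filter_upwards [eventually_ge_atTop K] with m hm
    have h1 : D j k (f m) = D j k (f m - f K) + D j k (f K) := by rw [map_sub, sub_add_cancel]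
    rw [h1]
    exact (nrm_add_le _ _).trans (add_le_add_left (hK m K hm le_rfl).le _)
  have hder : ∀ j k, ∀ w ∈ rect T, HasFDerivWithinAt (g j k)
      (g (j + 1) k w • ContinuousLinearMap.fst ℝ ℝ ℝ +
        g j (k + 1) w • ContinuousLinearMap.snd ℝ ℝ ℝ)
      (rect T) w := by
    intro j k w hw
    obtain ⟨M₁, h₁, hM₁⟩ := hbdd (j + 1 + 1) k
    obtain ⟨M₂, h₂, hM₂⟩ := hbdd (j + 1) (k + 1)
    obtain ⟨M₃, h₃, hM₃⟩ := hbdd j (k + 1 + 1)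
    have hle : ∀ z ∈ rect T, |g j k z - g j k w -
        (g (j + 1) k w * (z.1 - w.1) + g j (k + 1) w * (z.2 - w.2))| ≤
        (M₁ + M₂ + M₃) * ‖z - w‖ ^ 2 := by
      intro z hz
      have ht := (((hg j k z hz).sub (hg j k w hw)).sub
        (((hg (j + 1) k w hw).mul_const (z.1 - w.1)).add
          ((hg j (k + 1) w hw).mul_const (z.2 - w.2)))).abs
      refine le_of_tendsto ht ?_
      filter_upwards [hM₁, hM₂, hM₃] with m hm₁ hm₂ hm₃
      have := abs_taylor_le (D j k (f m)) hz hw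
      simp only [Dt_D, Dx_D] at this
      exact this.trans (mul_le_mul_of_nonneg_right (by linarith) (sq_nonneg _))
    refine HasFDerivWithinAt.of_isLittleO ?_
    have hO : (fun z => g j k z - g j k w - (g (j + 1) k w • ContinuousLinearMap.fst ℝ ℝ ℝ +
        g j (k + 1) w • ContinuousLinearMap.snd ℝ ℝ ℝ) (z - w)) =O[𝓝[rect T] w]
        fun z => ‖z - w‖ ^ 2 := by
      refine Asymptotics.IsBigO.of_bound (M₁ + M₂ + M₃) ?_
      filter_upwards [self_mem_nhdsWithin] with z hz
      rw [norm_pow, norm_norm]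
      simpa using hle z hz
    refine hO.trans_isLittleO ?_
    have : (fun z : ℝ × ℝ => ‖z - w‖ ^ 2) =o[𝓝 w] fun z => z - w :=
      Asymptotics.isLittleO_pow_sub_sub w one_lt_two
    exact this.mono nhdsWithin_le_nhds
  have hsmooth : ∀ n : ℕ, ∀ j k, ContDiffOn ℝ n (g j k) (rect T) := by
    intro n
    induction n with
    | zero =>
      intro j k
      rw [Nat.cast_zero, contDiffOn_zero]
      exact fun z hz => (hder j k z hz).continuousWithinAt
    | succ n ih =>
      intro j k
      push_cast
      refine contDiffOn_succ_of_fderivWithin (fun z hz => (hder j k z hz).differentiableWithinAt)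
        (by simp) ?_
      refine (((ih (j + 1) k).smul (contDiffOn_const (c := ContinuousLinearMap.fst ℝ ℝ ℝ))).add
        ((ih j (k + 1)).smul (contDiffOn_const (c := ContinuousLinearMap.snd ℝ ℝ ℝ)))).congr
        fun z hz => ?_
      exact (hder j k z hz).fderivWithin (uniqueDiffOn_rect hT.out z hz)
  set G : SmoothRect T := ofContDiffOn (g 0 0) (contDiffOn_infty.2 fun n => hsmooth n 0 0) with hG
  have hGx : ∀ k, ∀ z ∈ rect T, (D 0 k G).1 z = g 0 k z := by
    intro k
    induction k with
    | zero => exact fun z hz => by rw [D_zero_zero, hG, ofContDiffOn_val _ hz]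
    | succ k ih =>
      intro z hz
      rw [← Dx_D]
      refine dx_unique hz ?_
      have := hasDerivWithinAt_snd hz (hder 0 k z hz)
      simp at this
      exact this.congr (fun y hy => ih _ ⟨hz.1, hy⟩) (ih _ hz)
  have hGt : ∀ j k, ∀ z ∈ rect T, (D j k G).1 z = g j k z := by
    intro j
    induction j with
    | zero => exact hGx
    | succ j ih =>
      intro k z hz
      rw [← Dt_D]
      refine dt_unique hz ?_
      have := hasDerivWithinAt_fst hz (hder j k z hz)
      simp at this
      exact this.congr (fun y hy => ih k _ ⟨hy, hz.2⟩) (ih k _ hz)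
  refine ⟨G, (withSeminorms_derivSeminorm.tendsto_nhds_atTop f G).2 fun i ε hε => ?_⟩
  obtain ⟨K, hK⟩ := hf i.1 i.2 (ε / 2) (half_pos hε)
  refine ⟨K, fun m hm => ?_⟩
  have : nrm (D i.1 i.2 (f m - G)) ≤ ε / 2 := nrm_le fun t ht x hx => by
    rw [map_sub, sub_val, hGt _ _ _ ⟨ht, hx⟩]
    refine le_of_tendsto ((tendsto_const_nhds.sub (hg i.1 i.2 (t, x) ⟨ht, hx⟩)).abs) ?_
    filter_upwards [eventually_ge_atTop K] with l hl
    exact (hval _ _ _ _ _ ⟨ht, hx⟩).trans (hK m l hm hl).le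
  rw [derivSeminorm_apply]
  linarith

end SmoothRect

/-! ### The gradings define the topology -/

/-- The triangle inequality for the square root of a nonnegative quadratic form. -/
theorem sqrt_add_le_sqrt_add_sqrt {a b c : ℝ} (h : ∀ s : ℝ, 0 ≤ a + 2 * s * b + s ^ 2 * c) :
    √(a + 2 * 1 * b + 1 ^ 2 * c) ≤ √a + √c := by
  have ha : 0 ≤ a := by simpa using h 0
  have hd : discrim c (2 * b) a ≤ 0 := discrim_le_zero fun s => by linarith [h s]
  have hc : 0 ≤ c := by
    by_contra! hc
    rw [discrim] at hd
    have hb : b = 0 ∧ a = 0 := by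
      constructor
      · nlinarith [mul_nonneg ha (neg_pos.2 hc).le, sq_nonneg b]
      · nlinarith [mul_nonneg ha (neg_pos.2 hc).le, sq_nonneg b]
    have := h 1
    rw [hb.1, hb.2] at this
    linarith
  have hb : b ≤ √a * √c := by
    rw [← Real.sqrt_mul ha]
    refine Real.le_sqrt_of_sq_le ?_
    rw [discrim] at hd
    linarith
  refine Real.sqrt_le_iff.2 ⟨by positivity, ?_⟩
  rw [add_sq, Real.sq_sqrt ha, Real.sq_sqrt hc]
  linarith

namespace SmoothRect

variable {T : ℝ} [hT : Fact (0 < T)]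

theorem dom_derivSeminorm_W (i : ℕ × ℕ) :
    Dom (derivSeminorm i : SmoothRect T → ℝ) (W (i.1 + i.2)) := Dom.of_le fun u => by
  refine le_trans ?_ (V_Dt_le_W (a := i.1) (k := i.2) (by lia) u)
  refine le_trans (le_of_eq ?_) (nrm_le_wnrm contDiff_rho (j := 0) (m := i.2) (Nat.zero_le _)
    le_rfl _)
  rw [derivSeminorm_apply, D, (Dt_comm_Dx.pow_pow i.1 i.2).eq]
  congr 1
  ext z _
  simp

theorem dom_W_derivSeminorm (n : ℕ) : ∃ s : Finset (ℕ × ℕ),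
    Dom (W n) fun u : SmoothRect T => (s.sup derivSeminorm : Seminorm ℝ (SmoothRect T)) u := by
  refine ⟨Finset.range (2 * n + 1) ×ˢ Finset.range (2 * n + 1),
    dom_W fun a k hak => dom_wnrm contDiff_rho fun j hj m hm =>
      ((dom_nrm_mulX (contDiff_rho.pow j)).comp fun u => (Dx ^ m) ((Dt ^ a) u)).trans_le
        fun u => ?_⟩
  have h : nrm ((Dx ^ m) ((Dt ^ a) u)) = derivSeminorm (a, m) u := by
    rw [derivSeminorm_apply, D, (Dt_comm_Dx.pow_pow a m).eq]
    rfl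
  rw [h]
  exact Seminorm.le_finset_sup_apply (by simp; lia)

instance : T2Space (SmoothRect T) := by
  have : T1Space (SmoothRect T) := withSeminorms_derivSeminorm.T1_of_separating fun u hu => by
    refine ⟨(0, 0), fun h => hu (ext fun z hz => ?_)⟩
    rw [derivSeminorm_apply, D_zero_zero] at h
    exact abs_nonpos_iff.1 ((u.abs_le_nrm hz).trans h.le)
  infer_instance

/-- A grading by seminorms that is tamely equivalent to the grading by weighted derivatives
defines the topology of uniform convergence of all derivatives. -/
theorem isGradedFrechet_of_dom {p : ℕ → SmoothRect T → ℝ} (P : SeminormFamily ℝ (SmoothRect T) ℕ)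
    (hP : ∀ n u, P n u = p n u) (hmono : ∀ u, Monotone fun n => p n u)
    (h₁ : ∀ n, Dom (p n) (W n)) {r : ℕ} (h₂ : ∀ n, Dom (W n) (p (n + r))) :
    IsGradedFrechet p where
  monotone := hmono
  defines_topology := by
    refine ⟨P, hP, withSeminorms_derivSeminorm.congr ?_ ?_⟩
    · refine Seminorm.IsBounded.of_real fun n => ?_
      obtain ⟨s, hs⟩ := dom_W_derivSeminorm (T := T) n
      obtain ⟨C, _, h⟩ := (h₁ n).trans hs
      exact ⟨s, C, fun u => (hP n u).trans_le (h u)⟩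
    · refine Seminorm.IsBounded.of_real fun i => ?_
      obtain ⟨C, _, h⟩ := (dom_derivSeminorm_W (T := T) i).trans (h₂ _)
      refine ⟨{i.1 + i.2 + r}, C, fun u => (h u).trans_eq ?_⟩
      rw [Finset.sup_singleton, hP]
  hausdorff := inferInstance
  complete := by
    intro f hf
    refine exists_tendsto_of_cauchy fun j k ε hε => ?_
    obtain ⟨C, hC, h⟩ := (dom_derivSeminorm_W (T := T) (j, k)).trans (h₂ _)
    obtain ⟨K, hK⟩ := hf (j + k + r) (ε / (C + 1)) (by positivity)
    refine ⟨K, fun m l hm hl => (h _).trans_lt ?_⟩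
    have := hK m l hm hl
    rw [lt_div_iff₀ (by positivity)] at this
    have h0 : 0 ≤ p (j + k + r) (f m - f l) := by
      rw [← hP]
      exact apply_nonneg _ _
    nlinarith

theorem sideSup_add_le (N : ℝ) (μ : Fin 2) (n : ℕ) (u v : SmoothRect T) :
    sideSup T N μ n (u + v) ≤ sideSup T N μ n u + sideSup T N μ n v :=
  sideSup_le fun j k hjk => by
    rw [map_add, map_add]
    exact (nrm_add_le _ _).trans
      (add_le_add (nrm_le_sideSup N μ hjk u) (nrm_le_sideSup N μ hjk v))

theorem sideSup_smul_le (N : ℝ) (μ : Fin 2) (n : ℕ) (a : ℝ) (u : SmoothRect T) :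
    sideSup T N μ n (a • u) ≤ |a| * sideSup T N μ n u :=
  sideSup_le fun j k hjk => by
    rw [map_smul, map_smul, nrm_smul]
    exact mul_le_mul_of_nonneg_left (nrm_le_sideSup N μ hjk u) (abs_nonneg a)

theorem combSup_add_le (N : ℝ) (c : Cutoff) (n : ℕ) (u v : SmoothRect T) :
    combSup T N c n (u + v) ≤ combSup T N c n u + combSup T N c n v :=
  combSup_le fun μ => by
    rw [map_add]
    exact (sideSup_add_le N μ n _ _).trans
      (add_le_add (sideSup_le_combSup N c μ n u) (sideSup_le_combSup N c μ n v))

theorem combSup_smul_le (N : ℝ) (c : Cutoff) (n : ℕ) (a : ℝ) (u : SmoothRect T) :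
    combSup T N c n (a • u) ≤ |a| * combSup T N c n u :=
  combSup_le fun μ => by
    rw [map_smul]
    exact (sideSup_smul_le N μ n a _).trans
      (mul_le_mul_of_nonneg_left (sideSup_le_combSup N c μ n u) (abs_nonneg a))

/-- The scalar product behind the norm `‖·‖_n^{(2)}`. -/
def combProd (N : ℝ) (c : Cutoff) (n : ℕ) (u v : SmoothRect T) : ℝ :=
  ∑ μ : Fin 2, ∑ i ∈ pairs n,
    l2prod (ord N μ) ((Dt ^ (2 * i.1)) ((Delta (ord N μ) ^ i.2) (side μ (cut T c μ u))))
      ((Dt ^ (2 * i.1)) ((Delta (ord N μ) ^ i.2) (side μ (cut T c μ v))))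

theorem combL2_eq (N : ℝ) (c : Cutoff) (n : ℕ) (u : SmoothRect T) :
    combL2 T N c n u = √(combProd N c n u u) := by
  rw [combL2, combProd]
  congr 1
  refine Finset.sum_congr rfl fun μ _ => ?_
  rw [sideL2_eq, Real.sq_sqrt (Finset.sum_nonneg fun _ _ => l2prod_self_nonneg _ _)]

theorem combProd_self_nonneg (N : ℝ) (c : Cutoff) (n : ℕ) (u : SmoothRect T) :
    0 ≤ combProd N c n u u :=
  Finset.sum_nonneg fun _ _ => Finset.sum_nonneg fun _ _ => l2prod_self_nonneg _ _

theorem combProd_add_smul {N : ℝ} (hN : 4 < N) (c : Cutoff) (n : ℕ) (u v : SmoothRect T) (s : ℝ) :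
    combProd N c n (u + s • v) (u + s • v) =
      combProd N c n u u + 2 * s * combProd N c n u v + s ^ 2 * combProd N c n v v := by
  simp only [combProd, Finset.mul_sum, ← Finset.sum_add_distrib]
  refine Finset.sum_congr rfl fun μ _ => Finset.sum_congr rfl fun i _ => ?_
  simp only [map_add, map_smul]
  exact l2prod_add_smul (one_le_ord hN μ) _ _ s

theorem combL2_add_le {N : ℝ} (hN : 4 < N) (c : Cutoff) (n : ℕ) (u v : SmoothRect T) :
    combL2 T N c n (u + v) ≤ combL2 T N c n u + combL2 T N c n v := by
  have h := combProd_add_smul hN c n u v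
  have h1 := h 1
  rw [one_smul] at h1
  rw [combL2_eq, combL2_eq, combL2_eq, h1]
  exact sqrt_add_le_sqrt_add_sqrt fun s => (combProd_self_nonneg N c n _).trans_eq (h s)

theorem combL2_smul_le {N : ℝ} (hN : 4 < N) (c : Cutoff) (n : ℕ) (a : ℝ) (u : SmoothRect T) :
    combL2 T N c n (a • u) ≤ |a| * combL2 T N c n u := by
  have h := combProd_add_smul hN c n 0 u a
  have h0 : ∀ v : SmoothRect T, combProd N c n 0 v = 0 := fun v => by
    simp only [combProd, map_zero]
    refine Finset.sum_eq_zero fun μ _ => Finset.sum_eq_zero fun i _ => ?_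
    simp [l2prod, dint]
  rw [zero_add, h0, h0, mul_zero, zero_add, zero_add] at h
  rw [combL2_eq, combL2_eq, h, Real.sqrt_mul (sq_nonneg a), Real.sqrt_sq_eq_abs]

theorem combSup_zero (N : ℝ) (c : Cutoff) (n : ℕ) : combSup T N c n (0 : SmoothRect T) = 0 :=
  le_antisymm (by simpa using combSup_smul_le N c n 0 (0 : SmoothRect T)) (combSup_nonneg _ _ _ _)

theorem combL2_zero {N : ℝ} (hN : 4 < N) (c : Cutoff) (n : ℕ) :
    combL2 T N c n (0 : SmoothRect T) = 0 :=
  le_antisymm (by simpa using combL2_smul_le hN c n 0 (0 : SmoothRect T)) (combL2_nonneg _ _ _ _)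

theorem isGradedFrechet_combSup {N : ℝ} (hN : 4 < N) (c : Cutoff) :
    IsGradedFrechet (combSup T N c) :=
  isGradedFrechet_of_dom (r := 0)
    (fun n => Seminorm.ofSMulLE (combSup T N c n) (combSup_zero N c n) (combSup_add_le N c n)
      (combSup_smul_le N c n)) (fun _ _ => rfl) (combSup_mono N c) (dom_combSup_W N c)
    (dom_W_combSup hN c)

theorem isGradedFrechet_combL2 {N : ℝ} (hN : 4 < N) (c : Cutoff) :
    IsGradedFrechet (combL2 T N c) := by
  obtain ⟨r, hr⟩ := exists_dom_combSup_combL2 (T := T) hN c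
  exact isGradedFrechet_of_dom (r := r)
    (fun n => Seminorm.ofSMulLE (combL2 T N c n) (combL2_zero hN c n) (combL2_add_le hN c n)
      (combL2_smul_le hN c n)) (fun _ _ => rfl) (combL2_mono N c)
    (fun n => (dom_combL2_combSup hN c n).trans (dom_combSup_W N c n))
    fun n => (dom_W_combSup hN c n).trans (hr n)

end SmoothRect

/-! ### Tame spaces from rapidly converging expansions -/

/-- The least natural number `l` with `x ≤ e^l`, for `x ≥ 1`. -/
def level (x : ℝ) : ℕ := ⌈Real.log x⌉₊

theorem le_exp_level {x : ℝ} (hx : 1 ≤ x) : x ≤ Real.exp (level x) :=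
  (Real.log_le_iff_le_exp (zero_lt_one.trans_le hx)).1 (Nat.le_ceil _)

theorem exp_level_le {x : ℝ} (hx : 1 ≤ x) : Real.exp (level x) ≤ Real.exp 1 * x := by
  have h : (level x : ℝ) ≤ 1 + Real.log x := by
    rw [add_comm]
    exact (Nat.ceil_lt_add_one (Real.log_nonneg hx)).le
  calc Real.exp (level x) ≤ Real.exp (1 + Real.log x) := Real.exp_le_exp.2 h
    _ = _ := by rw [Real.exp_add, Real.exp_log (zero_lt_one.trans_le hx)]

theorem exp_mul_nat (n l : ℕ) : Real.exp (n * l) = Real.exp l ^ n := by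
  rw [← Real.exp_nat_mul]

theorem norm_le_expDecNorm {B : Type*} [NormedAddCommGroup B] [NormedSpace ℝ B] (n : ℕ)
    (f : ExpDecSeq B) (l : ℕ) : Real.exp l ^ n * ‖f.1 l‖ ≤ expDecNorm B n f := by
  rw [← exp_mul_nat]
  exact (f.2 n).le_tsum l fun k _ => by positivity

section Expansion

variable {F : Type*} [AddCommGroup F] [Module ℝ F] (c : ℕ → F →ₗ[ℝ] ℝ) (w : ℕ → ℝ)
  (p : ℕ → F → ℝ) (r : ℕ)

/-- The block of level `l` of the coefficients `c i u`: the bounded sequence that agrees with them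
at the indices `i` of level `l` and vanishes elsewhere. -/
def coeffBlock (hc : ∀ u, ∃ C, ∀ i, |c i u| ≤ C) (l : ℕ) (u : F) :
    BoundedContinuousFunction ℕ ℝ :=
  BoundedContinuousFunction.ofNormedAddCommGroupDiscrete
    (fun i => if level (w i) = l then c i u else 0) (hc u).choose fun i => by
      have h := (hc u).choose_spec i
      split_ifs
      · exact h
      · rw [norm_zero]
        exact (abs_nonneg _).trans h

variable {c w p r}

theorem norm_coeffBlock_le {hc : ∀ u, ∃ C, ∀ i, |c i u| ≤ C} (hw : ∀ i, 1 ≤ w i) {n : ℕ} {u : F}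
    {K : ℝ} (hK : ∀ i, w i ^ (n + 1) * |c i u| ≤ K) (l : ℕ) :
    Real.exp (n * l) * ‖coeffBlock c w hc l u‖ ≤ Real.exp 1 ^ (n + 1) * K * Real.exp (-l) := by
  have hK0 : 0 ≤ K := le_trans (mul_nonneg (pow_nonneg (zero_le_one.trans (hw 0)) _)
    (abs_nonneg _)) (hK 0)
  have h : ‖coeffBlock c w hc l u‖ ≤
      Real.exp 1 ^ (n + 1) * K * Real.exp (-l) / Real.exp (n * l) := by
    rw [BoundedContinuousFunction.norm_le (by positivity)]
    intro i
    change ‖if level (w i) = l then c i u else 0‖ ≤ _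
    split_ifs with hl
    · rw [le_div_iff₀ (Real.exp_pos _), Real.exp_neg, ← div_eq_mul_inv,
        le_div_iff₀ (Real.exp_pos _), exp_mul_nat, mul_assoc, ← pow_succ, Real.norm_eq_abs,
        mul_comm]
      have h1 : Real.exp l ^ (n + 1) ≤ (Real.exp 1 * w i) ^ (n + 1) := by
        rw [← hl]
        exact pow_le_pow_left₀ (Real.exp_pos _).le (exp_level_le (hw i)) _
      calc Real.exp l ^ (n + 1) * |c i u| ≤ (Real.exp 1 * w i) ^ (n + 1) * |c i u| :=
            mul_le_mul_of_nonneg_right h1 (abs_nonneg _)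
        _ = Real.exp 1 ^ (n + 1) * (w i ^ (n + 1) * |c i u|) := by ring
        _ ≤ _ := mul_le_mul_of_nonneg_left (hK i) (by positivity)
    · rw [norm_zero]
      positivity
  rw [le_div_iff₀ (Real.exp_pos _)] at h
  linarith

/-- The analysis map `u ↦ (c i u)_i`, the coefficients being sorted by level. -/
def analysisMap (hw : ∀ i, 1 ≤ w i)
    (hc : ∀ n : ℕ, ∃ C : ℝ, 0 ≤ C ∧ ∀ i u, w i ^ n * |c i u| ≤ C * p (n + r) u) :
    F →ₗ[ℝ] ExpDecSeq (BoundedContinuousFunction ℕ ℝ) where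
  toFun u := ⟨fun l => coeffBlock c w (fun u => by
      obtain ⟨C, _, h⟩ := hc 0
      exact ⟨_, fun i => by simpa using h i u⟩) l u, fun n => by
    obtain ⟨C, _, h⟩ := hc (n + 1)
    exact Summable.of_nonneg_of_le (fun _ => by positivity)
      (norm_coeffBlock_le hw fun i => h i u) (Real.summable_exp_neg_nat.mul_left _)⟩
  map_add' u v := by
    refine Subtype.ext (funext fun l => BoundedContinuousFunction.ext fun i => ?_)
    change (if level (w i) = l then c i (u + v) else 0) =
      (if level (w i) = l then c i u else 0) + if level (w i) = l then c i v else 0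
    split_ifs <;> simp
  map_smul' a u := by
    refine Subtype.ext (funext fun l => BoundedContinuousFunction.ext fun i => ?_)
    change (if level (w i) = l then c i (a • u) else 0) =
      a * if level (w i) = l then c i u else 0
    split_ifs <;> simp

variable [TopologicalSpace F]

/-- Synthesis: a series whose terms have summable seminorms converges. -/
theorem IsGradedFrechet.exists_tendsto_sum (hp : IsGradedFrechet p) {f : ℕ → F} {a : ℕ → ℕ → ℝ}
    (ha : ∀ n, Summable (a n)) (hf : ∀ n i, p n (f i) ≤ a n i) :
    ∃ g, Tendsto (fun K => ∑ i ∈ Finset.range K, f i) atTop (𝓝 g) ∧ ∀ n, p n g ≤ ∑' i, a n i := by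
  obtain ⟨P, hP, hPs⟩ := hp.defines_topology
  have ha0 : ∀ n i, 0 ≤ a n i := fun n i => le_trans (by rw [← hP]; exact apply_nonneg _ _) (hf n i)
  have hsum : ∀ n (s : Finset ℕ), p n (∑ i ∈ s, f i) ≤ ∑ i ∈ s, a n i := fun n s => by
    rw [← hP]
    refine (Finset.le_sum_of_subadditive (P n) (map_zero _).le (map_add_le_add _) s f).trans ?_
    exact Finset.sum_le_sum fun i _ => by rw [hP]; exact hf n i
  have hlt : ∀ n (ε : ℝ), 0 < ε → ∃ K, ∀ k l, K ≤ k → k ≤ l →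
      p n (∑ i ∈ Finset.range l, f i - ∑ i ∈ Finset.range k, f i) < ε := by
    intro n ε hε
    obtain ⟨K, hK⟩ := Metric.cauchySeq_iff.1 (ha n).hasSum.tendsto_sum_nat.cauchySeq ε hε
    refine ⟨K, fun k l hk hkl => ?_⟩
    have := hK l (hk.trans hkl) k hk
    rw [Real.dist_eq, ← Finset.sum_Ico_eq_sub _ hkl] at this
    rw [← Finset.sum_Ico_eq_sub _ hkl]
    exact (hsum n _).trans_lt ((le_abs_self _).trans_lt this)
  obtain ⟨g, hg⟩ := hp.complete (fun K => ∑ i ∈ Finset.range K, f i) fun n ε hε => by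
    obtain ⟨K, hK⟩ := hlt n ε hε
    refine ⟨K, fun k l hk hl => ?_⟩
    rcases le_total k l with h | h
    · rw [← hP, map_sub_rev, hP]
      exact hK k l hk h
    · exact hK l k hl h
  refine ⟨g, hg, fun n => ?_⟩
  rw [← hP]
  refine le_of_tendsto (((hPs.continuous_seminorm n).tendsto g).comp hg) (Eventually.of_forall
    fun K => ?_)
  rw [Function.comp_apply, hP]
  exact (hsum n _).trans ((ha n).sum_le_tsum _ fun i _ => ha0 n i)

theorem IsGradedFrechet.smul_le (hp : IsGradedFrechet p) {e : ℕ → F} (hw : ∀ i, 1 ≤ w i)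
    {n s : ℕ} {C : ℝ} (hC : 0 ≤ C) (he : ∀ i, p n (e i) ≤ C * w i ^ (n + r))
    (f : ExpDecSeq (BoundedContinuousFunction ℕ ℝ)) (i : ℕ) :
    p n (f.1 (level (w i)) i • e i) ≤ C * expDecNorm _ (n + r + s) f * (w i ^ s)⁻¹ := by
  obtain ⟨P, hP, -⟩ := hp.defines_topology
  have hw0 : 0 < w i := zero_lt_one.trans_le (hw i)
  rw [← hP, map_smul_eq_mul, hP, Real.norm_eq_abs, ← div_eq_mul_inv, le_div_iff₀ (by positivity)]
  have h1 : |f.1 (level (w i)) i| ≤ ‖f.1 (level (w i))‖ :=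
    (f.1 (level (w i))).norm_coe_le_norm i
  have h2 := norm_le_expDecNorm (n + r + s) f (level (w i))
  have h3 : w i ^ (n + r + s) ≤ Real.exp (level (w i)) ^ (n + r + s) :=
    pow_le_pow_left₀ hw0.le (le_exp_level (hw i)) _
  calc |f.1 (level (w i)) i| * p n (e i) * w i ^ s
      ≤ ‖f.1 (level (w i))‖ * (C * w i ^ (n + r)) * w i ^ s := by
        refine mul_le_mul_of_nonneg_right (mul_le_mul h1 (he i) ?_ (norm_nonneg _)) (by positivity)
        rw [← hP]
        exact apply_nonneg _ _
    _ = C * (w i ^ (n + r + s) * ‖f.1 (level (w i))‖) := by ring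
    _ ≤ C * (Real.exp (level (w i)) ^ (n + r + s) * ‖f.1 (level (w i))‖) := by gcongr
    _ ≤ _ := mul_le_mul_of_nonneg_left h2 hC

/-- A graded Fréchet space is tame if each element has an expansion `∑ c_i(u) e_i` whose
coefficients decrease faster, and whose terms increase slower, than fixed shifts of the powers
of a sequence of weights that increases at least polynomially. It is a tame direct summand of
`Σ(ℓ^∞)`: the coefficients with weight about `e^l` form the `l`-th term of a sequence in `ℓ^∞`, and
the way back sums the series, with the coefficient of `e_i` read off from the term that holds it. -/
theorem IsGradedFrechet.isTameSpace (hp : IsGradedFrechet p) {e : ℕ → F} (hw : ∀ i, 1 ≤ w i)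
    {s : ℕ} (hs : Summable fun i => (w i ^ s)⁻¹)
    (hc : ∀ n : ℕ, ∃ C : ℝ, 0 ≤ C ∧ ∀ i u, w i ^ n * |c i u| ≤ C * p (n + r) u)
    (he : ∀ n : ℕ, ∃ C : ℝ, 0 ≤ C ∧ ∀ i, p n (e i) ≤ C * w i ^ (n + r))
    (hexp : ∀ u, Tendsto (fun K => ∑ i ∈ Finset.range K, c i u • e i) atTop (𝓝 u)) :
    IsTameSpace p := by
  refine ⟨hp, BoundedContinuousFunction ℕ ℝ, inferInstance, inferInstance, inferInstance, ?_⟩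
  obtain ⟨P, hP, hPs⟩ := hp.defines_topology
  have := hp.hausdorff
  have := hPs.topologicalAddGroup
  have := hPs.continuousSMul
  choose C hC0 hC using he
  have hM := fun f : ExpDecSeq (BoundedContinuousFunction ℕ ℝ) => hp.exists_tendsto_sum
    (fun n => hs.mul_left (C n * expDecNorm _ (n + r + s) f))
    (fun n i => hp.smul_le hw (hC0 n) (hC n) f i)
  choose M hM hMp using hM
  let M' : ExpDecSeq (BoundedContinuousFunction ℕ ℝ) →ₗ[ℝ] F :=
    { toFun := M
      map_add' := fun f g => tendsto_nhds_unique (hM (f + g)) <| by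
        refine ((hM f).add (hM g)).congr fun K => ?_
        rw [← Finset.sum_add_distrib]
        exact Finset.sum_congr rfl fun i _ => (add_smul _ _ _).symm
      map_smul' := fun a f => tendsto_nhds_unique (hM (a • f)) <| by
        refine ((hM f).const_smul a).congr fun K => ?_
        rw [Finset.smul_sum]
        exact Finset.sum_congr rfl fun i _ => smul_smul _ _ _ }
  refine ⟨analysisMap hw hc, M', ⟨r + 1, 0, fun n _ => ?_⟩, ⟨r + s, 0, fun n _ => ?_⟩, ?_⟩
  · obtain ⟨D, _, h⟩ := hc (n + 1)
    refine ⟨Real.exp 1 ^ (n + 1) * D * ∑' l : ℕ, Real.exp (-l), fun u => ?_⟩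
    have hb := norm_coeffBlock_le (c := c) (w := w) (hc := fun u => by
      obtain ⟨C, _, h⟩ := hc 0
      exact ⟨_, fun i => by simpa using h i u⟩) hw (n := n) (u := u) fun i => h i u
    have hsum := Real.summable_exp_neg_nat.mul_left
      (Real.exp 1 ^ (n + 1) * (D * p (n + 1 + r) u))
    refine (((analysisMap hw hc u).2 n).tsum_le_tsum hb hsum).trans (le_of_eq ?_)
    rw [tsum_mul_left, show n + (r + 1) = n + 1 + r by ring]
    ring
  · refine ⟨C n * ∑' i, (w i ^ s)⁻¹, fun f => (hMp f n).trans (le_of_eq ?_)⟩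
    rw [tsum_mul_left, ← add_assoc]
    ring
  · refine LinearMap.ext fun u => tendsto_nhds_unique (hM _) ((hexp u).congr fun K => ?_)
    refine Finset.sum_congr rfl fun i _ => ?_
    congr 1
    exact (if_pos rfl).symm

end Expansion

/-! ### Seeley's sequence -/

/-- The Taylor coefficients `d_k` of Euler's product `∏_{j ≥ 0} (1 - 2^{-j} z)`, which vanishes at
all `z = 2^n`. -/
def eulerCoeff : ℕ → ℝ
  | 0 => 1
  | k + 1 => -(eulerCoeff k * (1 / 2) ^ k / (1 - (1 / 2) ^ (k + 1)))

theorem half_le_one_sub (k : ℕ) : (1 / 2 : ℝ) ≤ 1 - (1 / 2) ^ (k + 1) := by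
  have : (1 / 2 : ℝ) ^ k ≤ 1 := pow_le_one₀ (by norm_num) (by norm_num)
  rw [pow_succ]
  linarith

theorem abs_eulerCoeff_succ_le (k : ℕ) :
    |eulerCoeff (k + 1)| ≤ 2 * (1 / 2) ^ k * |eulerCoeff k| := by
  have h := half_le_one_sub k
  have h0 : (0 : ℝ) < 1 - (1 / 2) ^ (k + 1) := by linarith
  rw [eulerCoeff, abs_neg, abs_div, abs_of_pos h0, div_le_iff₀ h0, abs_mul, abs_of_nonneg
    (by positivity : (0 : ℝ) ≤ (1 / 2) ^ k)]
  have : 0 ≤ (1 / 2 : ℝ) ^ k * |eulerCoeff k| := by positivity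
  nlinarith

theorem summable_eulerCoeff (z : ℝ) : Summable fun k => eulerCoeff k * z ^ k := by
  refine summable_of_ratio_norm_eventually_le (r := 1 / 2) (by norm_num) ?_
  have h : Tendsto (fun k : ℕ => 2 * |z| * (1 / 2 : ℝ) ^ k) atTop (𝓝 0) := by
    simpa using (tendsto_pow_atTop_nhds_zero_of_lt_one (by norm_num)
      (by norm_num : (1 / 2 : ℝ) < 1)).const_mul (2 * |z|)
  filter_upwards [h.eventually (gt_mem_nhds (by norm_num : (0 : ℝ) < 1 / 2))] with k hk
  rw [norm_mul, norm_mul, norm_pow, norm_pow, Real.norm_eq_abs, Real.norm_eq_abs, Real.norm_eq_abs]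
  have h1 := abs_eulerCoeff_succ_le k
  calc |eulerCoeff (k + 1)| * |z| ^ (k + 1)
      ≤ 2 * (1 / 2) ^ k * |eulerCoeff k| * |z| ^ (k + 1) :=
        mul_le_mul_of_nonneg_right h1 (by positivity)
    _ = 2 * |z| * (1 / 2) ^ k * (|eulerCoeff k| * |z| ^ k) := by ring
    _ ≤ _ := mul_le_mul_of_nonneg_right hk.le (by positivity)

theorem tsum_eulerCoeff (z : ℝ) :
    ∑' k, eulerCoeff k * z ^ k = (1 - z) * ∑' k, eulerCoeff k * (z / 2) ^ k := by
  have h1 := summable_eulerCoeff z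
  have h2 := summable_eulerCoeff (z / 2)
  have h3 : ∑' k, (eulerCoeff k * z ^ k - eulerCoeff k * (z / 2) ^ k) =
      -z * ∑' k, eulerCoeff k * (z / 2) ^ k := by
    rw [(h1.sub h2).tsum_eq_zero_add, ← tsum_mul_left]
    simp only [pow_zero, sub_self, zero_add]
    refine tsum_congr fun k => ?_
    have h : (1 - (1 / 2 : ℝ) ^ (k + 1)) ≠ 0 := by
      have := half_le_one_sub k
      linarith
    have e : eulerCoeff (k + 1) * (1 - (1 / 2) ^ (k + 1)) = -(eulerCoeff k * (1 / 2) ^ k) := by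
      rw [eulerCoeff, neg_mul, div_mul_cancel₀ _ h]
    calc eulerCoeff (k + 1) * z ^ (k + 1) - eulerCoeff (k + 1) * (z / 2) ^ (k + 1)
        = eulerCoeff (k + 1) * (1 - (1 / 2) ^ (k + 1)) * z ^ (k + 1) := by
          rw [div_eq_mul_one_div z 2, mul_pow]; ring
      _ = _ := by rw [e, div_eq_mul_one_div z 2, mul_pow]; ring
  rw [h1.tsum_sub h2] at h3
  linarith

theorem tsum_eulerCoeff_two_pow (n : ℕ) : ∑' k, eulerCoeff k * (2 ^ n) ^ k = 0 := by
  induction n with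
  | zero => rw [tsum_eulerCoeff]; norm_num
  | succ n ih => rw [tsum_eulerCoeff, pow_succ, mul_div_cancel_right₀ _ two_ne_zero, ih, mul_zero]

/-- The sequence `d_k / (1 + 2^k)`, a multiple of Seeley's sequence: as `∑ d_k 2^{nk} = 0`, its
moments of the orders `n` and `n + 1` differ by the sign only. -/
def seeleyAux (k : ℕ) : ℝ := eulerCoeff k / (1 + 2 ^ k)

theorem eulerCoeff_sign (k : ℕ) : 0 < (-1) ^ k * eulerCoeff k := by
  induction k with
  | zero => simp [eulerCoeff]
  | succ k ih =>
    have h := half_le_one_sub k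
    have h0 : (0 : ℝ) < 1 - (1 / 2) ^ (k + 1) := by linarith
    have e : (-1) ^ (k + 1) * eulerCoeff (k + 1) =
        (-1) ^ k * eulerCoeff k * ((1 / 2) ^ k / (1 - (1 / 2) ^ (k + 1))) := by
      rw [eulerCoeff]; ring
    rw [e]
    positivity

theorem seeleyAux_sign (k : ℕ) : (-1) ^ k * |seeleyAux k| = seeleyAux k := by
  have h := eulerCoeff_sign k
  have h1 : |seeleyAux k| = (-1) ^ k * seeleyAux k := by
    have h2 : 0 ≤ (-1) ^ k * seeleyAux k := by
      rw [seeleyAux, ← mul_div_assoc]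
      positivity
    rw [← abs_of_nonneg h2, abs_mul, abs_pow, abs_neg, abs_one, one_pow, one_mul]
  rw [h1, ← mul_assoc, ← mul_pow]
  simp

theorem summable_seeleyAux (n : ℕ) : Summable fun k => |seeleyAux k| * (2 ^ k) ^ n := by
  refine (summable_eulerCoeff (2 ^ n)).abs.of_nonneg_of_le (fun k => by positivity) fun k => ?_
  rw [abs_mul, abs_of_pos (by positivity : (0 : ℝ) < (2 ^ n) ^ k), ← pow_mul, ← pow_mul, mul_comm k]
  refine mul_le_mul_of_nonneg_right ?_ (by positivity)
  rw [seeleyAux, abs_div]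
  refine div_le_self (abs_nonneg _) ?_
  rw [abs_of_pos (by positivity)]
  exact le_add_of_nonneg_right (by positivity)

theorem summable_seeleyAux' (n : ℕ) : Summable fun k => seeleyAux k * (2 ^ k) ^ n := by
  refine Summable.of_norm ((summable_seeleyAux n).congr fun k => ?_)
  rw [norm_mul, Real.norm_eq_abs, Real.norm_eq_abs, abs_of_pos (a := ((2 : ℝ) ^ k) ^ n)
    (by positivity)]

theorem tsum_seeleyAux_succ (n : ℕ) :
    ∑' k, seeleyAux k * (2 ^ k) ^ (n + 1) = -∑' k, seeleyAux k * (2 ^ k) ^ n := by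
  have h := tsum_eulerCoeff_two_pow n
  have h1 : ∀ k, eulerCoeff k * (2 ^ n) ^ k =
      seeleyAux k * (2 ^ k) ^ (n + 1) + seeleyAux k * (2 ^ k) ^ n := fun k => by
    have : (1 + 2 ^ k : ℝ) ≠ 0 := by positivity
    rw [seeleyAux, ← pow_mul, mul_comm n k, pow_mul]
    field_simp
    ring
  rw [tsum_congr h1, (summable_seeleyAux' _).tsum_add (summable_seeleyAux' n)] at h
  linarith

theorem abs_seeleyAux_antitone : Antitone fun k => |seeleyAux (k + 2)| := by
  refine antitone_nat_of_succ_le fun k => ?_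
  rw [seeleyAux, seeleyAux, abs_div, abs_div]
  have h1 : |eulerCoeff (k + 1 + 2)| ≤ |eulerCoeff (k + 2)| := by
    refine (abs_eulerCoeff_succ_le (k + 2)).trans (mul_le_of_le_one_left (abs_nonneg _) ?_)
    have : (1 / 2 : ℝ) ^ (k + 2) ≤ (1 / 2) ^ 1 :=
      pow_le_pow_of_le_one (by norm_num) (by norm_num) (by lia)
    linarith
  rw [abs_of_pos (by positivity : (0 : ℝ) < 1 + 2 ^ (k + 1 + 2)),
    abs_of_pos (by positivity : (0 : ℝ) < 1 + 2 ^ (k + 2))]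
  refine div_le_div₀ (abs_nonneg _) h1 (by positivity) ?_
  have : (2 : ℝ) ^ (k + 2) ≤ 2 ^ (k + 1 + 2) := pow_le_pow_right₀ one_le_two (by lia)
  linarith

/-- From `k = 2` on the series is alternating with decreasing terms, so that four terms give a lower
bound. -/
theorem tsum_seeleyAux_pos : 0 < ∑' k, seeleyAux k := by
  have hs : Summable seeleyAux := by simpa using summable_seeleyAux' 0
  have h0 := hs.sum_add_tsum_nat_add 2
  have h1 : Tendsto (fun n => ∑ i ∈ Finset.range n, (-1) ^ i * |seeleyAux (i + 2)|) atTop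
      (𝓝 (∑' i, seeleyAux (i + 2))) := by
    have := ((summable_nat_add_iff 2).2 hs).hasSum.tendsto_sum_nat
    refine this.congr fun n => Finset.sum_congr rfl fun i _ => ?_
    conv_lhs => rw [← seeleyAux_sign]
    rw [pow_add]
    norm_num
  have h2 := abs_seeleyAux_antitone.alternating_series_le_tendsto h1 1
  have e : ∀ i, (-1) ^ i * |seeleyAux (i + 2)| = seeleyAux (i + 2) := fun i => by
    conv_rhs => rw [← seeleyAux_sign]
    rw [pow_add]
    norm_num
  simp only [e] at h2
  rw [← h0]
  simp only [Finset.sum_range_succ, Finset.sum_range_zero, mul_one, zero_add, seeleyAux,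
    eulerCoeff] at h2 ⊢
  norm_num at h2 ⊢
  linarith

/-- Seeley's sequence: `∑ a_k 2^{nk} = (-1)^n` for all `n`, the series being absolutely
convergent. -/
theorem exists_seeley : ∃ a : ℕ → ℝ, (∀ n : ℕ, Summable fun k => |a k| * (2 ^ k) ^ n) ∧
    ∀ n : ℕ, ∑' k, a k * (2 ^ k) ^ n = (-1) ^ n := by
  have hpos := tsum_seeleyAux_pos
  refine ⟨fun k => (∑' k, seeleyAux k)⁻¹ * seeleyAux k, fun n => ?_, fun n => ?_⟩
  · refine ((summable_seeleyAux n).mul_left |(∑' k, seeleyAux k)⁻¹|).congr fun k => ?_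
    rw [abs_mul, mul_assoc]
  · simp only [mul_assoc]
    rw [tsum_mul_left]
    induction n with
    | zero => simp [hpos.ne']
    | succ n ih => rw [tsum_seeleyAux_succ, mul_neg, ih, pow_succ]; ring

/-! ### Real Fourier series -/

/-- The functions `trig 0 = cos` and `trig 1 = sin`, and their iterated primitives: `trig (s + 1)`
is a primitive of `trig s`. -/
def trig (s : ℕ) (y : ℝ) : ℝ := Real.cos (y - s * (Real.pi / 2))

theorem trig_zero (y : ℝ) : trig 0 y = Real.cos y := by simp [trig]

theorem trig_one (y : ℝ) : trig 1 y = Real.sin y := by simp [trig, Real.cos_sub_pi_div_two]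

theorem abs_trig_le (s : ℕ) (y : ℝ) : |trig s y| ≤ 1 := Real.abs_cos_le_one _

theorem contDiff_trig (s : ℕ) : ContDiff ℝ ∞ (trig s) :=
  Real.contDiff_cos.comp (contDiff_id.sub contDiff_const)

theorem hasDerivAt_trig (s : ℕ) (y : ℝ) : HasDerivAt (trig (s + 1)) (trig s y) y := by
  have h := (Real.hasDerivAt_cos (y - ↑(s + 1) * (Real.pi / 2))).comp y
    ((hasDerivAt_id y).sub_const (↑(s + 1) * (Real.pi / 2)))
  refine h.congr_deriv ?_
  rw [mul_one, trig, Nat.cast_add, Nat.cast_one, add_mul, one_mul, ← sub_sub,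
    Real.sin_sub_pi_div_two, neg_neg]

theorem fourierCoeff_liftIco_ofReal {L : ℝ} (hL : 0 < L) {f : ℝ → ℝ}
    (hf : ContinuousOn f (Icc (-L) L)) (j : ℤ) :
    haveI : Fact (0 < 2 * L) := ⟨by positivity⟩
    fourierCoeff (AddCircle.liftIco (2 * L) (-L) fun x => (f x : ℂ)) j =
      ((1 / (2 * L) * ∫ s in (-L)..L, f s * trig 0 (Real.pi / L * j * s) : ℝ) : ℂ) -
      ((1 / (2 * L) * ∫ s in (-L)..L, f s * trig 1 (Real.pi / L * j * s) : ℝ) : ℂ) * Complex.I := by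
  have : Fact (0 < 2 * L) := ⟨by positivity⟩
  have e1 : -L + 2 * L = L := by ring
  have e2 : -L + 2 * L - -L = 2 * L := by ring
  rw [fourierCoeff_liftIco_eq, fourierCoeffOn_eq_integral]
  simp only [fourier_coe_apply]
  rw [e2, e1]
  have hc : ∀ s : ℕ, IntervalIntegrable (fun x => f x * trig s (Real.pi / L * j * x))
      MeasureTheory.volume (-L) L := fun s => by
    refine ContinuousOn.intervalIntegrable ?_
    rw [uIcc_of_le (by linarith)]
    exact hf.mul ((contDiff_trig s).continuous.comp
      (continuous_const.mul continuous_id)).continuousOn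
  have key : ∀ x : ℝ,
      Complex.exp (2 * Real.pi * Complex.I * (-j : ℤ) * x / (2 * L : ℝ)) • (f x : ℂ) =
      ((f x * trig 0 (Real.pi / L * j * x) : ℝ) : ℂ) -
        ((f x * trig 1 (Real.pi / L * j * x) : ℝ) : ℂ) * Complex.I := by
    intro x
    have hL' : (L : ℂ) ≠ 0 := Complex.ofReal_ne_zero.2 hL.ne'
    have : (2 * Real.pi * Complex.I * (-j : ℤ) * x / (2 * L : ℝ) : ℂ) =
        ((-(Real.pi / L * j * x) : ℝ) : ℂ) * Complex.I := by
      push_cast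
      field_simp
    rw [this, Complex.exp_mul_I, ← Complex.ofReal_cos, ← Complex.ofReal_sin, Real.cos_neg,
      Real.sin_neg, trig_zero, trig_one, smul_eq_mul]
    push_cast
    ring
  simp only [key]
  have i1 : IntervalIntegrable (fun x => ((f x * trig 0 (Real.pi / L * j * x) : ℝ) : ℂ))
      MeasureTheory.volume (-L) L := ⟨(hc 0).1.ofReal, (hc 0).2.ofReal⟩
  have i2 : IntervalIntegrable (fun x => ((f x * trig 1 (Real.pi / L * j * x) : ℝ) : ℂ) * Complex.I)
      MeasureTheory.volume (-L) L :=
    ⟨(hc 1).1.ofReal.mul_const Complex.I, (hc 1).2.ofReal.mul_const Complex.I⟩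
  have hs := intervalIntegral.integral_sub i1 i2
  rw [intervalIntegral.integral_mul_const] at hs
  refine (congrArg _ hs).trans ?_
  rw [intervalIntegral.integral_ofReal, intervalIntegral.integral_ofReal, smul_sub,
    Complex.ofReal_mul, Complex.ofReal_mul, Complex.real_smul, Complex.real_smul, mul_assoc]

/-- A continuous function with equal values at `±L` and an absolutely convergent Fourier series
is the sum of that series. -/
theorem hasSum_fourier {L : ℝ} (hL : 0 < L) {f : ℝ → ℝ} (hf : ContinuousOn f (Icc (-L) L))
    (hend : f (-L) = f L) {A : ℤ × Fin 2 → ℝ}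
    (hA : ∀ i, A i = 1 / (2 * L) * ∫ s in (-L)..L, f s * trig i.2 (Real.pi / L * i.1 * s))
    (hs : Summable A) {t : ℝ} (ht : t ∈ Icc (-L) L) :
    HasSum (fun i : ℤ × Fin 2 => A i * trig i.2 (Real.pi / L * i.1 * t)) (f t) := by
  have : Fact (0 < 2 * L) := ⟨by positivity⟩
  have e1 : -L + 2 * L = L := by ring
  have hcont : Continuous (AddCircle.liftIco (2 * L) (-L) fun x => (f x : ℂ)) :=
    AddCircle.liftIco_continuous (by rw [e1, hend]) (by
      rw [e1]
      exact Complex.continuous_ofReal.comp_continuousOn hf)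
  have hcoeff : ∀ j : ℤ, fourierCoeff (AddCircle.liftIco (2 * L) (-L) fun x => (f x : ℂ)) j =
      (A (j, 0) : ℂ) - (A (j, 1) : ℂ) * Complex.I := fun j => by
    rw [fourierCoeff_liftIco_ofReal hL hf, hA, hA]
    rfl
  have hs0 : Summable fun j : ℤ => A (j, 0) :=
    hs.comp_injective (i := fun j : ℤ => (j, (0 : Fin 2))) fun _ _ h => (Prod.ext_iff.1 h).1
  have hs1 : Summable fun j : ℤ => A (j, 1) :=
    hs.comp_injective (i := fun j : ℤ => (j, (1 : Fin 2))) fun _ _ h => (Prod.ext_iff.1 h).1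
  have hsum : Summable (fourierCoeff (⟨_, hcont⟩ : C(AddCircle (2 * L), ℂ))) := by
    refine (((Complex.ofRealCLM.summable hs0).sub
      ((Complex.ofRealCLM.summable hs1).mul_right Complex.I))).congr fun j => ?_
    exact (hcoeff j).symm
  have hval :
      AddCircle.liftIco (2 * L) (-L) (fun x => (f x : ℂ)) (t : AddCircle (2 * L)) = f t := by
    rcases ht.2.lt_or_eq with h | h
    · exact AddCircle.liftIco_coe_apply ⟨ht.1, h.trans_eq e1.symm⟩
    · have h1 : ((t : ℝ) : AddCircle (2 * L)) = ((-L : ℝ) : AddCircle (2 * L)) := by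
        rw [h, ← AddCircle.coe_add_period (2 * L) (-L), e1]
      rw [h1, AddCircle.liftIco_coe_apply ⟨le_rfl, by linarith⟩, hend, h]
  have h := has_pointwise_sum_fourier_series_of_summable hsum (t : AddCircle (2 * L))
  have h' := Complex.reCLM.hasSum h
  have hS : Summable fun i : ℤ × Fin 2 => A i * trig i.2 (Real.pi / L * i.1 * t) := by
    refine Summable.of_norm_bounded hs.norm fun i => ?_
    rw [norm_mul]
    exact mul_le_of_le_one_right (norm_nonneg _) (abs_trig_le _ _)
  have h2 := hS.hasSum.prod_fiberwise fun j => hasSum_fintype _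
  have h3 : ∀ j : ℤ, Complex.reCLM (fourierCoeff (⟨_, hcont⟩ : C(AddCircle (2 * L), ℂ)) j •
      fourier j (t : AddCircle (2 * L))) =
      ∑ c : Fin 2, A (j, c) * trig c (Real.pi / L * j * t) := by
    intro j
    have hL' : (L : ℂ) ≠ 0 := Complex.ofReal_ne_zero.2 hL.ne'
    have e : (2 * Real.pi * Complex.I * j * t / (2 * L : ℝ) : ℂ) =
        ((Real.pi / L * j * t : ℝ) : ℂ) * Complex.I := by
      push_cast
      field_simp
    have hc := hcoeff j
    rw [ContinuousMap.coe_mk, hc, fourier_coe_apply, e, Complex.exp_mul_I, ← Complex.ofReal_cos,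
      ← Complex.ofReal_sin, Fin.sum_univ_two]
    change Complex.re _ = A (j, 0) * trig 0 _ + A (j, 1) * trig 1 _
    rw [trig_zero, trig_one]
    generalize Real.cos (Real.pi / L * j * t) = x
    generalize Real.sin (Real.pi / L * j * t) = y
    simp
  simp only [h3] at h'
  have h4 := h'.unique h2
  rw [ContinuousMap.coe_mk, hval] at h4
  rw [show f t = Complex.reCLM (f t : ℂ) from (Complex.ofReal_re _).symm, h4]
  exact hS.hasSum

/-! ### Extension across the end of an interval -/

/-- The moment conditions on a sequence of coefficients under which Seeley's extension is smooth. -/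
structure IsSeeley (a : ℕ → ℝ) : Prop where
  summable : ∀ n : ℕ, Summable fun k => |a k| * (2 ^ k) ^ n
  moment : ∀ n : ℕ, ∑' k, a k * (2 ^ k) ^ n = (-1) ^ n

/-- Seeley's extension of a function on `[0,∞)` to the line. -/
def seeleyExt (a : ℕ → ℝ) (g : ℝ → ℝ) (t : ℝ) : ℝ :=
  if 0 ≤ t then g t else ∑' k, a k * g (2 ^ k * -t)

/-- The kernel that represents the integral of `φ 0` against an extended function as an integral
over `[0,∞)`; if `φ` is a sequence of successive primitives, so is the sequence of kernels. -/
def seeleyKernel (a : ℕ → ℝ) (φ : ℕ → ℝ → ℝ) (n : ℕ) (t : ℝ) : ℝ :=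
  φ n t + ∑' k, a k * ((2 ^ k)⁻¹ * (-2 ^ k) ^ n) * φ n (-((2 ^ k)⁻¹ * t))

/-- The Fourier coefficients on `[-T,T]` of Seeley's extension of a function that vanishes beyond
`T`, written as integrals over `[0,T]`. They are real, and `i.2` selects cosine or sine. -/
def extCoeff (a : ℕ → ℝ) (T : ℝ) (i : ℤ × Fin 2) (g : ℝ → ℝ) : ℝ :=
  1 / (2 * T) * ∫ t in (0 : ℝ)..T, g t *
    seeleyKernel a (fun _ t => trig i.2 (Real.pi / T * i.1 * t)) 0 t

theorem abs_seeley_factor_le (k n : ℕ) : |((2 : ℝ) ^ k)⁻¹ * (-2 ^ k) ^ n| ≤ (2 ^ k) ^ n := by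
  rw [abs_mul, abs_pow, abs_neg, abs_inv, abs_of_pos (by positivity : (0 : ℝ) < 2 ^ k)]
  exact mul_le_of_le_one_left (by positivity) (inv_le_one_of_one_le₀ (one_le_pow₀ one_le_two))

namespace IsSeeley

variable {a : ℕ → ℝ}

theorem summable_abs (ha : IsSeeley a) : Summable fun k => |a k| := by simpa using ha.summable 0

theorem abs_term_le {φ : ℕ → ℝ → ℝ} {n : ℕ} {B : ℝ} (hB : ∀ t, |φ n t| ≤ B) (k : ℕ) (t : ℝ) :
    ‖a k * ((2 ^ k)⁻¹ * (-2 ^ k) ^ n) * φ n (-((2 ^ k)⁻¹ * t))‖ ≤ |a k| * (2 ^ k) ^ n * B := by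
  rw [norm_mul, norm_mul, Real.norm_eq_abs, Real.norm_eq_abs, Real.norm_eq_abs]
  exact mul_le_mul (mul_le_mul_of_nonneg_left (abs_seeley_factor_le k n) (abs_nonneg _)) (hB _)
    (abs_nonneg _) (by positivity)

theorem abs_seeleyKernel_le (ha : IsSeeley a) {φ : ℕ → ℝ → ℝ} {n : ℕ} {B : ℝ}
    (hB : ∀ t, |φ n t| ≤ B) (t : ℝ) :
    |seeleyKernel a φ n t| ≤ (1 + ∑' k, |a k| * (2 ^ k) ^ n) * B := by
  rw [add_mul, one_mul, ← tsum_mul_right]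
  refine (abs_add_le _ _).trans (add_le_add (hB t) ?_)
  exact tsum_of_norm_bounded ((ha.summable n).mul_right B).hasSum fun k => abs_term_le hB k t

theorem hasDerivAt_seeleyKernel (ha : IsSeeley a) {φ : ℕ → ℝ → ℝ} {n : ℕ} {B B' : ℝ}
    (hB : ∀ t, |φ n t| ≤ B)
    (hB' : ∀ t, |φ (n + 1) t| ≤ B') (hφ : ∀ t, HasDerivAt (φ (n + 1)) (φ n t) t) (t : ℝ) :
    HasDerivAt (seeleyKernel a φ (n + 1)) (seeleyKernel a φ n t) t := by
  refine (hφ t).add (hasDerivAt_tsum ((ha.summable n).mul_right B) (fun k y => ?_)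
    (fun k y => abs_term_le hB k y) (y₀ := 0) ?_ t)
  · have h2 : (2 : ℝ) ^ k ≠ 0 := by positivity
    have h := ((hφ (-((2 ^ k)⁻¹ * y))).comp y
      (((hasDerivAt_id y).const_mul ((2 ^ k)⁻¹ : ℝ)).neg)).const_mul
      (a k * ((2 ^ k)⁻¹ * (-2 ^ k) ^ (n + 1)))
    refine h.congr_deriv ?_
    rw [pow_succ]
    field_simp
  · exact Summable.of_norm_bounded ((ha.summable (n + 1)).mul_right B') fun k =>
      abs_term_le hB' k 0

theorem continuous_tsum_kernel (ha : IsSeeley a) {φ : ℕ → ℝ → ℝ} {n : ℕ} {B : ℝ}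
    (hφ : Continuous (φ n)) (hB : ∀ t, |φ n t| ≤ B) :
    Continuous fun t => ∑' k, a k * ((2 ^ k)⁻¹ * (-2 ^ k) ^ n) * φ n (-((2 ^ k)⁻¹ * t)) :=
  continuous_tsum (fun k => continuous_const.mul (hφ.comp (by fun_prop)))
    ((ha.summable n).mul_right B) fun k t => abs_term_le hB k t

theorem continuous_seeleyKernel (ha : IsSeeley a) {φ : ℕ → ℝ → ℝ} {n : ℕ} {B : ℝ}
    (hφ : Continuous (φ n)) (hB : ∀ t, |φ n t| ≤ B) : Continuous (seeleyKernel a φ n) :=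
  hφ.add (ha.continuous_tsum_kernel hφ hB)

theorem seeleyKernel_zero (ha : IsSeeley a) (φ : ℕ → ℝ → ℝ) (n : ℕ) :
    seeleyKernel a φ (n + 1) 0 = 0 := by
  have h : ∀ k, a k * ((2 ^ k)⁻¹ * (-2 ^ k) ^ (n + 1)) * φ (n + 1) (-((2 ^ k)⁻¹ * 0)) =
      -(-1) ^ n * φ (n + 1) 0 * (a k * (2 ^ k) ^ n) := fun k => by
    have h2 : (2 : ℝ) ^ k ≠ 0 := by positivity
    rw [mul_zero, neg_zero, neg_pow, pow_succ, pow_succ]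
    field_simp
  rw [seeleyKernel, tsum_congr h, tsum_mul_left, ha.moment]
  have : ((-1 : ℝ) ^ n) * (-1) ^ n = 1 := by rw [← mul_pow]; simp
  linear_combination (-φ (n + 1) 0) * this

theorem continuous_seeleyExt (ha : IsSeeley a) {g : ℝ → ℝ} {M : ℝ} (hg : ContinuousOn g (Ici 0))
    (hM : ∀ t, 0 ≤ t → |g t| ≤ M) : Continuous (seeleyExt a g) := by
  have h1 : ContinuousOn (seeleyExt a g) (Ici 0) := hg.congr fun t ht => if_pos ht
  have h2 : ContinuousOn (seeleyExt a g) (Iic 0) := by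
    have h : ContinuousOn (fun t => ∑' k, a k * g (2 ^ k * -t)) (Iic 0) := by
      have hmaps : ∀ k : ℕ, MapsTo (fun t : ℝ => 2 ^ k * -t) (Iic 0) (Ici 0) := fun k t ht =>
        mul_nonneg (a := 2 ^ k) (by positivity) (neg_nonneg.2 (mem_Iic.1 ht))
      refine continuousOn_tsum (fun k => continuousOn_const.mul (hg.comp (by fun_prop) (hmaps k)))
        (ha.summable_abs.mul_right M) fun k t ht => ?_
      rw [norm_mul]
      exact mul_le_mul_of_nonneg_left (hM _ (hmaps k ht)) (abs_nonneg _)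
    refine h.congr fun t ht => ?_
    have ht' : t ≤ (0 : ℝ) := ht
    rcases ht'.lt_or_eq with h0 | rfl
    · exact if_neg (not_le.2 h0)
    · have := ha.moment 0
      simp only [pow_zero, mul_one] at this
      simp only [seeleyExt, neg_zero, mul_zero, le_refl, if_true, tsum_mul_right, this, one_mul]
  have h := h2.union_of_isClosed h1 isClosed_Iic isClosed_Ici
  rwa [Iic_union_Ici, continuousOn_univ] at h

theorem integral_seeleyExt (ha : IsSeeley a) {T : ℝ} (hT : 0 < T) {g : ℝ → ℝ} {M B : ℝ}
    (hg : ContinuousOn g (Ici 0)) (hM : ∀ t, 0 ≤ t → |g t| ≤ M) (h0 : ∀ t, T ≤ t → g t = 0)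
    {φ : ℕ → ℝ → ℝ} (hφ : Continuous (φ 0)) (hB : ∀ t, |φ 0 t| ≤ B) :
    ∫ t in (-T)..T, seeleyExt a g t * φ 0 t = ∫ t in (0 : ℝ)..T, g t * seeleyKernel a φ 0 t := by
  have hext := (ha.continuous_seeleyExt hg hM).mul hφ
  have hM0 : 0 ≤ M := (abs_nonneg _).trans (hM 0 le_rfl)
  have hint : ∀ c d, IntervalIntegrable (fun t => seeleyExt a g t * φ 0 t)
      MeasureTheory.volume c d := fun c d => hext.intervalIntegrable c d
  rw [← intervalIntegral.integral_add_adjacent_intervals (hint (-T) 0) (hint 0 T)]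
  have hg' : ContinuousOn g (uIcc 0 T) := hg.mono (by
    rw [uIcc_of_le hT.le]; exact Icc_subset_Ici_self)
  have e1 : ∫ t in (0 : ℝ)..T, seeleyExt a g t * φ 0 t = ∫ t in (0 : ℝ)..T, g t * φ 0 t := by
    refine intervalIntegral.integral_congr fun t ht => ?_
    rw [uIcc_of_le hT.le] at ht
    simp only [seeleyExt, if_pos ht.1]
  have e2 : ∫ t in (-T)..0, seeleyExt a g t * φ 0 t =
      ∫ s in (0 : ℝ)..T, (∑' k, a k * g (2 ^ k * s)) * φ 0 (-s) := by
    have h := intervalIntegral.integral_comp_neg (a := 0) (b := T)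
      (fun t => seeleyExt a g t * φ 0 t)
    rw [neg_zero] at h
    rw [← h]
    refine intervalIntegral.integral_congr_ae (Eventually.of_forall fun s hs => ?_)
    rw [uIoc_of_le hT.le] at hs
    simp only [seeleyExt, if_neg (not_le.2 (neg_neg_of_pos hs.1)), neg_neg]
  have hmaps : ∀ (k : ℕ) {s : ℝ}, 0 ≤ s → 0 ≤ (2 : ℝ) ^ k * s := fun k s hs =>
    mul_nonneg (by positivity) hs
  have s1 : HasSum (fun k => ∫ s in (0 : ℝ)..T, a k * g (2 ^ k * s) * φ 0 (-s))
      (∫ s in (0 : ℝ)..T, (∑' k, a k * g (2 ^ k * s)) * φ 0 (-s)) := by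
    refine intervalIntegral.hasSum_integral_of_dominated_convergence (fun k _ => |a k| * M * B)
      (fun k => ?_) (fun k => Eventually.of_forall fun s hs => ?_)
      (Eventually.of_forall fun s _ => (ha.summable_abs.mul_right M).mul_right B) ?_
      (Eventually.of_forall fun s hs => ?_)
    · refine ContinuousOn.aestronglyMeasurable ?_ measurableSet_uIoc
      rw [uIoc_of_le hT.le]
      exact (continuousOn_const.mul (hg.comp (by fun_prop) fun s hs => hmaps k hs.1.le)).mul
        (hφ.comp continuous_neg).continuousOn
    · rw [uIoc_of_le hT.le] at hs
      rw [norm_mul, norm_mul]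
      exact mul_le_mul (mul_le_mul_of_nonneg_left (hM _ (hmaps k hs.1.le)) (norm_nonneg _)) (hB _)
        (norm_nonneg _) (by positivity)
    · exact intervalIntegrable_const
    · rw [uIoc_of_le hT.le] at hs
      refine (Summable.hasSum ?_).mul_right _
      refine Summable.of_norm_bounded (ha.summable_abs.mul_right M) fun k => ?_
      rw [norm_mul]
      exact mul_le_mul_of_nonneg_left (hM _ (hmaps k hs.1.le)) (abs_nonneg _)
  have s2 : HasSum (fun k => ∫ t in (0 : ℝ)..T,
      g t * (a k * ((2 ^ k)⁻¹ * (-2 ^ k) ^ 0) * φ 0 (-((2 ^ k)⁻¹ * t))))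
      (∫ t in (0 : ℝ)..T,
        g t * ∑' k, a k * ((2 ^ k)⁻¹ * (-2 ^ k) ^ 0) * φ 0 (-((2 ^ k)⁻¹ * t))) := by
    refine intervalIntegral.hasSum_integral_of_dominated_convergence
      (fun k _ => M * (|a k| * (2 ^ k) ^ 0 * B))
      (fun k => ?_) (fun k => Eventually.of_forall fun s hs => ?_)
      (Eventually.of_forall fun s _ => ((ha.summable 0).mul_right B).mul_left M) ?_
      (Eventually.of_forall fun s hs => ?_)
    · refine ContinuousOn.aestronglyMeasurable ?_ measurableSet_uIoc
      exact (hg'.mono uIoc_subset_uIcc).mul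
        (continuousOn_const.mul (hφ.comp (by fun_prop)).continuousOn)
    · rw [uIoc_of_le hT.le] at hs
      rw [norm_mul]
      exact mul_le_mul (hM _ hs.1.le) (abs_term_le hB k s) (norm_nonneg _) hM0
    · exact intervalIntegrable_const
    · refine (Summable.hasSum ?_).mul_left _
      exact Summable.of_norm_bounded ((ha.summable 0).mul_right B) fun k => abs_term_le hB k s
  -- after the substitution `t = 2^k s` only the interval `[0,T]` counts, as `g` vanishes beyond it
  have e3 : ∀ k, ∫ s in (0 : ℝ)..T, a k * g (2 ^ k * s) * φ 0 (-s) =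
      ∫ t in (0 : ℝ)..T, g t * (a k * ((2 ^ k)⁻¹ * (-2 ^ k) ^ 0) * φ 0 (-((2 ^ k)⁻¹ * t))) := by
    intro k
    have h2 : (2 : ℝ) ^ k ≠ 0 := by positivity
    have hle : T ≤ 2 ^ k * T := le_mul_of_one_le_left hT.le (one_le_pow₀ one_le_two)
    have h := intervalIntegral.integral_comp_mul_left (a := 0) (b := T)
      (fun t => a k * g t * φ 0 (-((2 ^ k)⁻¹ * t))) h2
    simp only [inv_mul_cancel_left₀ h2] at h
    have hzero : ∀ t ∈ uIcc T (2 ^ k * T), a k * g t * φ 0 (-((2 ^ k)⁻¹ * t)) = 0 := fun t ht => by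
      rw [uIcc_of_le hle] at ht
      rw [h0 t ht.1, mul_zero, zero_mul]
    have i1 : IntervalIntegrable (fun t => a k * g t * φ 0 (-((2 ^ k)⁻¹ * t)))
        MeasureTheory.volume 0 T :=
      ((continuousOn_const.mul hg').mul (hφ.comp (by fun_prop)).continuousOn).intervalIntegrable
    have i2 : IntervalIntegrable (fun t => a k * g t * φ 0 (-((2 ^ k)⁻¹ * t)))
        MeasureTheory.volume T (2 ^ k * T) :=
      (continuousOn_const.congr hzero).intervalIntegrable
    rw [h, mul_zero, ← intervalIntegral.integral_add_adjacent_intervals i1 i2,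
      intervalIntegral.integral_congr hzero, intervalIntegral.integral_zero, add_zero,
      smul_eq_mul, ← intervalIntegral.integral_const_mul]
    refine intervalIntegral.integral_congr fun t _ => ?_
    simp only [pow_zero, mul_one]
    ring
  simp only [e3] at s1
  have i1 : IntervalIntegrable (fun t => g t * φ 0 t) MeasureTheory.volume 0 T :=
    (hg'.mul hφ.continuousOn).intervalIntegrable
  have i2 : IntervalIntegrable
      (fun t => g t * ∑' k, a k * ((2 ^ k)⁻¹ * (-2 ^ k) ^ 0) * φ 0 (-((2 ^ k)⁻¹ * t)))
      MeasureTheory.volume 0 T :=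
    (hg'.mul (ha.continuous_tsum_kernel hφ hB).continuousOn).intervalIntegrable
  rw [e1, e2, s1.unique s2, add_comm, ← intervalIntegral.integral_add i1 i2]
  refine intervalIntegral.integral_congr fun t _ => ?_
  simp only [seeleyKernel]
  ring

/-- Repeated integration by parts against the kernel: there are no boundary terms at `0` by
the moment conditions, and none at `T` as the function vanishes there. -/
theorem integral_seeleyKernel (ha : IsSeeley a) {T : ℝ} (hT : 0 < T) {g : ℕ → ℝ → ℝ}
    (hg : ∀ n, ∀ t ∈ Icc 0 T, HasDerivWithinAt (g n) (g (n + 1) t) (Icc 0 T) t)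
    (h0 : ∀ n, g n T = 0) {φ : ℕ → ℝ → ℝ} {B : ℕ → ℝ} (hB : ∀ n t, |φ n t| ≤ B n)
    (hφ0 : Continuous (φ 0)) (hφ : ∀ n t, HasDerivAt (φ (n + 1)) (φ n t) t) (n : ℕ) :
    ∫ t in (0 : ℝ)..T, g 0 t * seeleyKernel a φ 0 t =
      (-1) ^ n * ∫ t in (0 : ℝ)..T, g n t * seeleyKernel a φ n t := by
  have hcont : ∀ n, ContinuousOn (g n) (Icc 0 T) := fun n t ht => (hg n t ht).continuousWithinAt
  have hK := fun n t => ha.hasDerivAt_seeleyKernel (hB n) (hB (n + 1)) (hφ n) t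
  have hφc : ∀ n, Continuous (φ n) := fun n => by
    cases n with
    | zero => exact hφ0
    | succ n => exact continuous_iff_continuousAt.2 fun t => (hφ n t).continuousAt
  induction n with
  | zero => simp
  | succ n ih =>
    rw [ih]
    have hi : IntervalIntegrable (seeleyKernel a φ n) MeasureTheory.volume 0 T :=
      (ha.continuous_seeleyKernel (hφc n) (hB n)).intervalIntegrable _ _
    have h := intervalIntegral.integral_mul_deriv_eq_deriv_mul_of_hasDerivWithinAt
      (a := 0) (b := T) (u := g n) (u' := g (n + 1)) (v := seeleyKernel a φ (n + 1))
      (v' := seeleyKernel a φ n)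
      (by rw [uIcc_of_le hT.le]; exact hg n) (fun t _ => (hK n t).hasDerivWithinAt)
      (by
        refine ContinuousOn.intervalIntegrable ?_
        rw [uIcc_of_le hT.le]; exact hcont (n + 1)) hi
    rw [h, h0, ha.seeleyKernel_zero]
    ring

theorem hasSum_extCoeff (ha : IsSeeley a) {T : ℝ} (hT : 0 < T) {g : ℝ → ℝ} {M : ℝ}
    (hg : ContinuousOn g (Ici 0)) (hM : ∀ t, 0 ≤ t → |g t| ≤ M) (h0 : ∀ t, T ≤ t → g t = 0)
    (hs : Summable fun i => extCoeff a T i g) {t : ℝ} (ht : t ∈ Icc 0 T) :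
    HasSum (fun i : ℤ × Fin 2 => extCoeff a T i g * trig i.2 (Real.pi / T * i.1 * t)) (g t) := by
  have h := hasSum_fourier hT (ha.continuous_seeleyExt hg hM).continuousOn
    (A := fun i => extCoeff a T i g) ?_ (fun i => ?_) hs (t := t)
    ⟨(neg_nonpos.2 hT.le).trans ht.1, ht.2⟩
  · rwa [seeleyExt, if_pos ht.1] at h
  · rw [seeleyExt, seeleyExt, if_pos hT.le, if_neg (by linarith), h0 T le_rfl]
    refine (tsum_congr fun k => ?_).trans tsum_zero
    rw [neg_neg, h0 _ (le_mul_of_one_le_left hT.le (one_le_pow₀ one_le_two)), mul_zero]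
  · rw [extCoeff, ← ha.integral_seeleyExt hT hg hM h0
      (φ := fun _ t => trig i.2 (Real.pi / T * i.1 * t))
      ((contDiff_trig _).continuous.comp (by fun_prop)) fun t => abs_trig_le _ _]

/-- The Fourier coefficients of the extension decrease rapidly, with bounds by the derivatives of
the function on `[0,T]` alone. -/
theorem exists_abs_extCoeff_le (ha : IsSeeley a) {T : ℝ} (hT : 0 < T) (n : ℕ) :
    ∃ C : ℝ, 0 ≤ C ∧ ∀ (i : ℤ × Fin 2) (g : ℕ → ℝ → ℝ) (M : ℝ),
      (∀ n, ∀ t ∈ Icc 0 T, HasDerivWithinAt (g n) (g (n + 1) t) (Icc 0 T) t) →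
      (∀ n, g n T = 0) → (∀ t ∈ Icc 0 T, |g n t| ≤ M) →
      |(i.1 : ℝ)| ^ n * |extCoeff a T i (g 0)| ≤ C * M := by
  have hK0 : 0 ≤ 1 + ∑' k, |a k| * (2 ^ k) ^ n :=
    add_nonneg zero_le_one (tsum_nonneg fun k => by positivity)
  refine ⟨1 / (2 * T) * ((1 + ∑' k, |a k| * (2 ^ k) ^ n) * |T / Real.pi| ^ n * T), by positivity,
    fun i g M hg h0 hM => ?_⟩
  have hM0 : 0 ≤ M := (abs_nonneg _).trans (hM 0 ⟨le_rfl, hT.le⟩)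
  have hgen : ∀ (φ : ℝ → ℝ) (B : ℝ), (∀ t, |φ t| ≤ B) →
      |∫ t in (0 : ℝ)..T, g n t * φ t| ≤ M * B * T := by
    intro φ B hB
    have h := intervalIntegral.norm_integral_le_of_norm_le_const (a := 0) (b := T)
      (f := fun t => g n t * φ t) (C := M * B) fun t ht => by
        rw [uIoc_of_le hT.le] at ht
        rw [norm_mul]
        exact mul_le_mul (hM t ⟨ht.1.le, ht.2⟩) (hB t) (norm_nonneg _) hM0
    rwa [sub_zero, abs_of_pos hT] at h
  rw [extCoeff, abs_mul, abs_of_pos (by positivity : (0 : ℝ) < 1 / (2 * T))]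
  by_cases hi : i.1 = 0
  · rcases n with - | n
    · have h := hgen _ _ fun t => ha.abs_seeleyKernel_le (n := 0)
        (φ := fun _ t => trig i.2 (Real.pi / T * i.1 * t)) (B := 1) (fun t => abs_trig_le _ _) t
      rw [pow_zero, pow_zero, one_mul, mul_assoc]
      refine mul_le_mul_of_nonneg_left (h.trans_eq ?_) (by positivity)
      ring
    · rw [hi, Int.cast_zero, abs_zero, zero_pow (Nat.succ_ne_zero n), zero_mul]
      positivity
  · set ν : ℝ := Real.pi / T * i.1 with hν
    have hν0 : ν ≠ 0 := mul_ne_zero (div_ne_zero Real.pi_ne_zero hT.ne') (Int.cast_ne_zero.2 hi)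
    set φ : ℕ → ℝ → ℝ := fun n t => (ν⁻¹) ^ n * trig (n + i.2) (ν * t) with hφ
    have hB : ∀ n t, |φ n t| ≤ |ν⁻¹| ^ n := fun n t => by
      rw [hφ, abs_mul, abs_pow]
      exact mul_le_of_le_one_right (by positivity) (abs_trig_le _ _)
    have hd : ∀ n t, HasDerivAt (φ (n + 1)) (φ n t) t := fun n t => by
      have h := ((hasDerivAt_trig (n + i.2) (ν * t)).comp t
        ((hasDerivAt_id t).const_mul ν)).const_mul (ν⁻¹ ^ (n + 1))
      have e : n + 1 + (i.2 : ℕ) = n + i.2 + 1 := by ring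
      simp only [hφ, e]
      refine h.congr_deriv ?_
      rw [pow_succ]
      field_simp
    have e0 : seeleyKernel a (fun _ t => trig i.2 (ν * t)) 0 = seeleyKernel a φ 0 := by
      funext t
      simp only [seeleyKernel, hφ, pow_zero, one_mul, zero_add]
    have hc : Continuous (φ 0) :=
      continuous_const.mul ((contDiff_trig _).continuous.comp (by fun_prop))
    rw [e0, ha.integral_seeleyKernel hT hg h0 hB hc hd n, abs_mul, abs_pow, abs_neg, abs_one,
      one_pow, one_mul]
    have h := hgen _ _ fun t => ha.abs_seeleyKernel_le (hB n) t
    have e1 : |(i.1 : ℝ)| ^ n * |ν⁻¹| ^ n = |T / Real.pi| ^ n := by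
      rw [← mul_pow, ← abs_mul, hν]
      congr 2
      have := Int.cast_ne_zero (α := ℝ).2 hi
      field_simp
    rw [← e1]
    calc _ ≤ |(i.1 : ℝ)| ^ n *
          (1 / (2 * T) * (M * ((1 + ∑' k, |a k| * (2 ^ k) ^ n) * |ν⁻¹| ^ n) * T)) := by
          gcongr
      _ = _ := by ring

end IsSeeley

/-! ### Chebyshev expansions -/

/-- The change of variable `x = (1 - cos θ) / 2`. -/
def xOf (θ : ℝ) : ℝ := (1 - Real.cos θ) / 2

theorem xOf_mem (θ : ℝ) : xOf θ ∈ Icc (0 : ℝ) 1 := by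
  have h1 := Real.cos_le_one θ
  have h2 := Real.neg_one_le_cos θ
  constructor <;> rw [xOf] <;> linarith

theorem hasDerivAt_xOf (θ : ℝ) : HasDerivAt xOf (Real.sin θ / 2) θ := by
  have h := ((Real.hasDerivAt_cos θ).const_sub 1).div_const 2
  rwa [neg_neg] at h

theorem continuous_xOf : Continuous xOf :=
  continuous_iff_continuousAt.2 fun θ => (hasDerivAt_xOf θ).continuousAt

/-- The Chebyshev coefficients of a function on `[0,1]`, indexed by the integers like the Fourier
coefficients of `v((1 - cos θ) / 2)`. -/
def chebCoeff (m : ℤ) (v : ℝ → ℝ) : ℝ :=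
  1 / (2 * Real.pi) * ∫ θ in (-Real.pi)..Real.pi, v (xOf θ) * Real.cos (m * θ)

theorem continuous_comp_xOf {v : ℝ → ℝ} (hv : ContinuousOn v (Icc 0 1)) :
    Continuous fun θ => v (xOf θ) := hv.comp_continuous continuous_xOf xOf_mem

theorem continuous_chebCoeff {v : ℝ → ℝ} (hv : ContinuousOn v (Icc 0 1)) (m : ℤ) :
    Continuous fun θ => v (xOf θ) * Real.cos (m * θ) :=
  (continuous_comp_xOf hv).mul (by fun_prop)

theorem chebCoeff_sub_sub_mul (m : ℤ) {u v w : ℝ → ℝ} (hu : ContinuousOn u (Icc 0 1))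
    (hv : ContinuousOn v (Icc 0 1)) (hw : ContinuousOn w (Icc 0 1)) (c : ℝ) :
    chebCoeff m (fun x => u x - v x - w x * c) =
      chebCoeff m u - chebCoeff m v - chebCoeff m w * c := by
  have iu := (continuous_chebCoeff hu m).intervalIntegrable (-Real.pi) Real.pi
    (μ := MeasureTheory.volume)
  have iv := (continuous_chebCoeff hv m).intervalIntegrable (-Real.pi) Real.pi
    (μ := MeasureTheory.volume)
  have iw := (continuous_chebCoeff hw m).intervalIntegrable (-Real.pi) Real.pi
    (μ := MeasureTheory.volume)
  simp only [chebCoeff]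
  have e : ∫ θ in (-Real.pi)..Real.pi, (u (xOf θ) - v (xOf θ) - w (xOf θ) * c) * Real.cos (m * θ) =
      ∫ θ in (-Real.pi)..Real.pi, (u (xOf θ) * Real.cos (m * θ) - v (xOf θ) * Real.cos (m * θ) -
        w (xOf θ) * Real.cos (m * θ) * c) :=
    intervalIntegral.integral_congr fun θ _ => by ring
  rw [e, intervalIntegral.integral_sub (iu.sub iv) (iw.mul_const c),
    intervalIntegral.integral_sub iu iv, intervalIntegral.integral_mul_const]
  ring

theorem chebCoeff_add (m : ℤ) {u v : ℝ → ℝ} (hu : ContinuousOn u (Icc 0 1))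
    (hv : ContinuousOn v (Icc 0 1)) :
    chebCoeff m (fun x => u x + v x) = chebCoeff m u + chebCoeff m v := by
  have h := chebCoeff_sub_sub_mul m (u := fun x => u x + v x) (hu.add hv) hv hu 1
  have e : chebCoeff m (fun x => u x + v x - v x - u x * 1) = 0 := by
    simp [chebCoeff]
  linarith

theorem chebCoeff_const_mul (m : ℤ) (c : ℝ) (u : ℝ → ℝ) :
    chebCoeff m (fun x => c * u x) = c * chebCoeff m u := by
  simp only [chebCoeff, mul_assoc c, intervalIntegral.integral_const_mul]
  ring

theorem abs_chebCoeff_le (m : ℤ) {v : ℝ → ℝ} {M : ℝ} (hM : ∀ x ∈ Icc (0 : ℝ) 1, |v x| ≤ M) :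
    |chebCoeff m v| ≤ M := by
  have hπ := Real.pi_pos
  have hM0 : 0 ≤ M := (abs_nonneg _).trans (hM 0 ⟨le_rfl, zero_le_one⟩)
  have h := intervalIntegral.norm_integral_le_of_norm_le_const (a := -Real.pi) (b := Real.pi)
    (f := fun θ => v (xOf θ) * Real.cos (m * θ)) (C := M) fun θ _ => by
      rw [norm_mul]
      exact (mul_le_mul (hM _ (xOf_mem θ)) (Real.abs_cos_le_one _) (abs_nonneg _) hM0).trans_eq
        (mul_one M)
  rw [chebCoeff, abs_mul, abs_of_pos (by positivity : 0 < 1 / (2 * Real.pi))]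
  rw [sub_neg_eq_add, abs_of_pos (by positivity), Real.norm_eq_abs] at h
  calc _ ≤ 1 / (2 * Real.pi) * (M * (Real.pi + Real.pi)) :=
        mul_le_mul_of_nonneg_left h (by positivity)
    _ = M := by field_simp; ring

/-- The operator `x (1 - x) d²/dx² + (1/2 - x) d/dx` is `d²/dθ²`, so it multiplies the coefficients
by `-m²`. -/
theorem chebCoeff_cheb (m : ℤ) {v v' v'' : ℝ → ℝ}
    (hv : ∀ x ∈ Icc (0 : ℝ) 1, HasDerivWithinAt v (v' x) (Icc 0 1) x)
    (hv' : ∀ x ∈ Icc (0 : ℝ) 1, HasDerivWithinAt v' (v'' x) (Icc 0 1) x)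
    (hc : ContinuousOn v'' (Icc 0 1)) :
    chebCoeff m (fun x => SmoothRect.rho x * v'' x + (1 / 2 - x) * v' x) =
      -(m : ℝ) ^ 2 * chebCoeff m v := by
  have hf : ∀ θ, HasDerivAt (fun θ => v (xOf θ)) (v' (xOf θ) * (Real.sin θ / 2)) θ := fun θ =>
    (hv _ (xOf_mem θ)).comp_hasDerivAt θ (hasDerivAt_xOf θ) (Eventually.of_forall xOf_mem)
  have hf' : ∀ θ, HasDerivAt (fun θ => v' (xOf θ) * (Real.sin θ / 2))
      (SmoothRect.rho (xOf θ) * v'' (xOf θ) + (1 / 2 - xOf θ) * v' (xOf θ)) θ := fun θ => by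
    have h := ((hv' _ (xOf_mem θ)).comp_hasDerivAt θ (hasDerivAt_xOf θ)
      (Eventually.of_forall xOf_mem)).mul ((Real.hasDerivAt_sin θ).div_const 2)
    refine h.congr_deriv ?_
    have := Real.sin_sq_add_cos_sq θ
    simp only [xOf, SmoothRect.rho, Function.comp_apply]
    linear_combination (v'' ((1 - Real.cos θ) / 2) / 4) * this
  have hcos : ∀ θ, HasDerivAt (fun θ => Real.cos (m * θ)) (-(m * Real.sin (m * θ))) θ := fun θ => by
    have h := (Real.hasDerivAt_cos (m * θ)).comp θ ((hasDerivAt_id θ).const_mul (m : ℝ))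
    refine h.congr_deriv ?_
    ring
  have hsin : ∀ θ, HasDerivAt (fun θ => Real.sin (m * θ)) (m * Real.cos (m * θ)) θ := fun θ => by
    have h := (Real.hasDerivAt_sin (m * θ)).comp θ ((hasDerivAt_id θ).const_mul (m : ℝ))
    refine h.congr_deriv ?_
    ring
  have c1 : Continuous fun θ => v' (xOf θ) * (Real.sin θ / 2) :=
    continuous_iff_continuousAt.2 fun θ => (hf' θ).continuousAt
  have c2 : Continuous fun θ =>
      SmoothRect.rho (xOf θ) * v'' (xOf θ) + (1 / 2 - xOf θ) * v' (xOf θ) :=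
    ((SmoothRect.contDiff_rho.continuous.comp continuous_xOf).mul (continuous_comp_xOf hc)).add
      ((continuous_const.sub continuous_xOf).mul (continuous_comp_xOf fun x hx =>
        (hv' x hx).continuousWithinAt))
  have h1 := intervalIntegral.integral_deriv_mul_eq_sub_of_hasDerivAt (a := -Real.pi) (b := Real.pi)
    c1.continuousOn (Continuous.continuousOn (f := fun θ : ℝ => Real.cos (m * θ)) (by fun_prop))
    (fun θ _ => hf' θ) (fun θ _ => hcos θ)
    (c2.intervalIntegrable _ _) (Continuous.intervalIntegrable (by fun_prop) _ _)
  have h2 := intervalIntegral.integral_deriv_mul_eq_sub_of_hasDerivAt (a := -Real.pi) (b := Real.pi)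
    (Continuous.continuousOn (f := fun θ => v (xOf θ))
      (continuous_iff_continuousAt.2 fun θ => (hf θ).continuousAt))
    (Continuous.continuousOn (f := fun θ : ℝ => Real.sin (m * θ)) (by fun_prop))
    (fun θ _ => hf θ) (fun θ _ => hsin θ)
    (c1.intervalIntegrable _ _) (Continuous.intervalIntegrable (by fun_prop) _ _)
  rw [Real.sin_neg, Real.sin_pi] at h1
  rw [mul_neg, Real.sin_neg, Real.sin_int_mul_pi] at h2
  have cv : Continuous fun θ => v (xOf θ) :=
    continuous_iff_continuousAt.2 fun θ => (hf θ).continuousAt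
  rw [intervalIntegral.integral_add] at h1 h2
  · have e1 : ∫ θ in (-Real.pi)..Real.pi, v' (xOf θ) * (Real.sin θ / 2) * -(m * Real.sin (m * θ)) =
        -m * ∫ θ in (-Real.pi)..Real.pi, v' (xOf θ) * (Real.sin θ / 2) * Real.sin (m * θ) := by
      rw [← intervalIntegral.integral_const_mul]
      exact intervalIntegral.integral_congr fun θ _ => by ring
    have e2 : ∫ θ in (-Real.pi)..Real.pi, v (xOf θ) * (m * Real.cos (m * θ)) =
        m * ∫ θ in (-Real.pi)..Real.pi, v (xOf θ) * Real.cos (m * θ) := by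
      rw [← intervalIntegral.integral_const_mul]
      exact intervalIntegral.integral_congr fun θ _ => by ring
    rw [e1] at h1
    rw [e2] at h2
    simp only [chebCoeff]
    linear_combination (1 / (2 * Real.pi)) * h1 + (1 / (2 * Real.pi)) * m * h2
  · exact (c1.mul (by fun_prop)).intervalIntegrable _ _
  · exact (cv.mul (by fun_prop)).intervalIntegrable _ _
  · exact (c2.mul (by fun_prop)).intervalIntegrable _ _
  · exact (c1.mul (by fun_prop)).intervalIntegrable _ _

/-- The Chebyshev polynomials `T_m` for all integers `m`, with `T_{-m} = T_m`; on `[0,1]` they are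
evaluated at `1 - 2x`. -/
def chebPoly (m : ℤ) : Polynomial ℝ := Polynomial.Chebyshev.T ℝ m

theorem hasSum_chebCoeff {v : ℝ → ℝ} (hv : ContinuousOn v (Icc 0 1))
    (hs : Summable fun m : ℤ => chebCoeff m v) {x : ℝ} (hx : x ∈ Icc (0 : ℝ) 1) :
    HasSum (fun m : ℤ => chebCoeff m v * (chebPoly m).eval (1 - 2 * x)) (v x) := by
  set θ := Real.arccos (1 - 2 * x) with hθ
  have hcos : Real.cos θ = 1 - 2 * x :=
    Real.cos_arccos (by linarith [hx.2]) (by linarith [hx.1])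
  have hxθ : xOf θ = x := by rw [xOf, hcos]; ring
  have hinj : Function.Injective fun m : ℤ => (m, (0 : Fin 2)) := fun _ _ h => (Prod.ext_iff.1 h).1
  set A : ℤ × Fin 2 → ℝ := fun i => if i.2 = 0 then chebCoeff i.1 v else 0 with hA
  have hA0 : ∀ i ∉ range fun m : ℤ => (m, (0 : Fin 2)), A i = 0 := fun i hi =>
    if_neg fun h => hi ⟨i.1, by rw [← h]⟩
  have h := hasSum_fourier Real.pi_pos (f := fun θ => v (xOf θ)) (A := A)
    (continuous_comp_xOf hv).continuousOn (by simp [xOf]) (fun i => ?_)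
    ((hinj.summable_iff hA0).1 hs) (t := θ)
    ⟨(neg_nonpos.2 Real.pi_pos.le).trans (Real.arccos_nonneg _), Real.arccos_le_pi _⟩
  · rw [hxθ] at h
    rw [← hinj.hasSum_iff fun i hi => by rw [hA0 i hi, zero_mul]] at h
    refine h.congr_fun fun m => ?_
    simp only [hA, Function.comp_apply, if_true, Fin.val_zero, trig_zero,
      div_self Real.pi_ne_zero, one_mul]
    rw [chebPoly, ← hcos, Polynomial.Chebyshev.T_real_cos]
  · obtain ⟨m, c⟩ := i
    fin_cases c
    · simp [hA, chebCoeff, trig_zero]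
    · have h := intervalIntegral.integral_comp_neg (a := -Real.pi) (b := Real.pi)
        fun s => v (xOf s) * Real.sin (m * s)
      rw [neg_neg] at h
      simp only [xOf, Real.cos_neg, mul_neg, Real.sin_neg, intervalIntegral.integral_neg] at h
      have h0 : ∫ s in (-Real.pi)..Real.pi, v (xOf s) * Real.sin (m * s) = 0 := by
        simp only [xOf]
        linarith
      simp [hA, trig_one, h0]

theorem chebPoly_eval_one_nonneg (m : ℤ) (i : ℕ) :
    0 ≤ (Polynomial.derivative^[i] (chebPoly m)).eval 1 :=
  (abs_nonneg _).trans (Polynomial.Chebyshev.abs_iterate_derivative_T_real_le m i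
    (x := 1) (by simp))

theorem chebPoly_eval_one_le (m : ℤ) (i : ℕ) :
    (Polynomial.derivative^[i] (chebPoly m)).eval 1 ≤ ((m : ℝ) ^ 2) ^ i := by
  induction i with
  | zero => simp [chebPoly]
  | succ i ih =>
    have h := Polynomial.Chebyshev.iterate_derivative_T_eval_one_recurrence (R := ℝ) m i
    have h0 := chebPoly_eval_one_nonneg m i
    have h1 := chebPoly_eval_one_nonneg m (i + 1)
    rw [chebPoly] at h0 h1 ih ⊢
    set X := (Polynomial.derivative^[i + 1] (Polynomial.Chebyshev.T ℝ m)).eval 1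
    set Y := (Polynomial.derivative^[i] (Polynomial.Chebyshev.T ℝ m)).eval 1
    have hi : (0 : ℝ) ≤ i := Nat.cast_nonneg i
    have h2 : X ≤ (m : ℝ) ^ 2 * Y := by
      nlinarith [mul_nonneg hi h1, mul_nonneg (sq_nonneg (i : ℝ)) h0]
    calc X ≤ (m : ℝ) ^ 2 * Y := h2
      _ ≤ (m : ℝ) ^ 2 * ((m : ℝ) ^ 2) ^ i := mul_le_mul_of_nonneg_left ih (sq_nonneg _)
      _ = _ := by ring

/-- Weighted bounds for the derivatives of Chebyshev polynomials. At the ends of the interval the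
`i`-th derivative of `T_m` has size `m^{2i}`; Chebyshev's differential equation, differentiated,
lets one trade a factor `1 - y²` for up to two powers of `m`. -/
theorem exists_chebPoly_le (j : ℕ) : ∀ i k : ℕ, i ≤ k + j → i ≤ 2 * k → ∃ C : ℝ, 0 ≤ C ∧
    ∀ (m : ℤ) (y : ℝ), |y| ≤ 1 →
      (1 - y ^ 2) ^ j * |(Polynomial.derivative^[i] (chebPoly m)).eval y| ≤
        C * (1 + (m : ℝ) ^ 2) ^ k := by
  have hle1 : ∀ m : ℤ, (1 : ℝ) ≤ 1 + (m : ℝ) ^ 2 := fun m => by nlinarith [sq_nonneg (m : ℝ)]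
  have hbase : ∀ i k : ℕ, i ≤ k → ∀ (m : ℤ) (y : ℝ), |y| ≤ 1 →
      |(Polynomial.derivative^[i] (chebPoly m)).eval y| ≤ (1 + (m : ℝ) ^ 2) ^ k := by
    intro i k hik m y hy
    refine (Polynomial.Chebyshev.abs_iterate_derivative_T_real_le m i hy).trans
      ((chebPoly_eval_one_le m i).trans ?_)
    exact (pow_le_pow_left₀ (sq_nonneg _) (by linarith) i).trans
      (pow_le_pow_right₀ (hle1 m) hik)
  have hy2 : ∀ y : ℝ, |y| ≤ 1 → 0 ≤ 1 - y ^ 2 ∧ 1 - y ^ 2 ≤ 1 := fun y hy => by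
    have := (sq_le_one_iff_abs_le_one y).2 hy
    exact ⟨by linarith, by linarith [sq_nonneg y]⟩
  induction j with
  | zero =>
    intro i k h1 _
    refine ⟨1, zero_le_one, fun m y hy => ?_⟩
    rw [pow_zero, one_mul, one_mul]
    exact hbase i k h1 m y hy
  | succ j ih =>
    intro i k h1 h2
    by_cases hik : i ≤ k
    · refine ⟨1, zero_le_one, fun m y hy => ?_⟩
      rw [one_mul]
      refine (mul_le_of_le_one_left (abs_nonneg _) (pow_le_one₀ (hy2 y hy).1 (hy2 y hy).2)).trans ?_
      exact hbase i k hik m y hy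
    · obtain ⟨i, rfl⟩ : ∃ i', i = i' + 2 := ⟨i - 2, by lia⟩
      obtain ⟨k, rfl⟩ : ∃ k', k = k' + 1 := ⟨k - 1, by lia⟩
      obtain ⟨C₁, hC₁, H₁⟩ := ih (i + 1) (k + 1) (by lia) (by lia)
      obtain ⟨C₂, hC₂, H₂⟩ := ih i k (by lia) (by lia)
      refine ⟨(2 * i + 1) * C₁ + (1 + (i : ℝ) ^ 2) * C₂, by positivity, fun m y hy => ?_⟩
      have h := Polynomial.Chebyshev.one_sub_X_sq_mul_iterate_derivative_T_eval (R := ℝ) m i y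
      have H₁ := H₁ m y hy
      have H₂ := H₂ m y hy
      rw [chebPoly] at H₁ H₂ ⊢
      set X := (Polynomial.derivative^[i + 2] (Polynomial.Chebyshev.T ℝ m)).eval y
      set Y := (Polynomial.derivative^[i + 1] (Polynomial.Chebyshev.T ℝ m)).eval y
      set Z := (Polynomial.derivative^[i] (Polynomial.Chebyshev.T ℝ m)).eval y
      have hw := pow_nonneg (hy2 y hy).1 j
      have hX : (1 - y ^ 2) * |X| ≤
          (2 * i + 1) * |Y| + (1 + (m : ℝ) ^ 2) * (1 + (i : ℝ) ^ 2) * |Z| := by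
        rw [← abs_of_nonneg (hy2 y hy).1, ← abs_mul, h]
        refine (abs_sub _ _).trans (add_le_add ?_ ?_)
        · rw [abs_mul, abs_mul, abs_of_nonneg (by positivity : (0 : ℝ) ≤ 2 * i + 1)]
          refine mul_le_mul_of_nonneg_right ?_ (abs_nonneg _)
          exact mul_le_of_le_one_right (by positivity) hy
        · rw [abs_mul]
          refine mul_le_mul_of_nonneg_right ?_ (abs_nonneg _)
          rw [abs_le]
          constructor <;> nlinarith [sq_nonneg (m : ℝ), sq_nonneg (i : ℝ),
            mul_nonneg (sq_nonneg (m : ℝ)) (sq_nonneg (i : ℝ))]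
      calc (1 - y ^ 2) ^ (j + 1) * |X| = (1 - y ^ 2) ^ j * ((1 - y ^ 2) * |X|) := by ring
        _ ≤ (1 - y ^ 2) ^ j * ((2 * i + 1) * |Y| + (1 + (m : ℝ) ^ 2) * (1 + (i : ℝ) ^ 2) * |Z|) :=
          mul_le_mul_of_nonneg_left hX hw
        _ = (2 * i + 1) * ((1 - y ^ 2) ^ j * |Y|) +
            (1 + (m : ℝ) ^ 2) * (1 + (i : ℝ) ^ 2) * ((1 - y ^ 2) ^ j * |Z|) := by ring
        _ ≤ (2 * i + 1) * (C₁ * (1 + (m : ℝ) ^ 2) ^ (k + 1)) +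
            (1 + (m : ℝ) ^ 2) * (1 + (i : ℝ) ^ 2) * (C₂ * (1 + (m : ℝ) ^ 2) ^ k) := by
          gcongr
        _ = _ := by ring

namespace SmoothRect

variable {T : ℝ} [hT : Fact (0 < T)]

/-! ### The ends of the interval `[0,T]` -/

/-- Multiplication by a smooth function of `t`. -/
def mulT (φ : ℝ → ℝ) (hφ : ContDiff ℝ ∞ φ) : Module.End ℝ (SmoothRect T) where
  toFun u := ⟨fun z => φ z.1 * u.1 z, (hφ.comp contDiff_fst).contDiffOn.mul u.2.1,
    fun z hz => by simp [u.2.2 z hz]⟩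
  map_add' u v := ext fun z _ => mul_add (φ z.1) (u.1 z) (v.1 z)
  map_smul' c u := ext fun z _ => mul_left_comm (φ z.1) c (u.1 z)

theorem mulT_val (φ : ℝ → ℝ) (hφ) (u : SmoothRect T) (z : ℝ × ℝ) :
    (mulT φ hφ u).1 z = φ z.1 * u.1 z := rfl

theorem mem_rect_flip {z : ℝ × ℝ} : (T - z.1, z.2) ∈ rect T ↔ z ∈ rect T := by
  simp only [rect, mem_prod, mem_Icc]
  constructor <;> rintro ⟨⟨h1, h2⟩, h3⟩ <;> exact ⟨⟨by linarith, by linarith⟩, h3⟩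

/-- The reflection `t ↦ T - t`. -/
def flip : Module.End ℝ (SmoothRect T) where
  toFun u := ⟨fun z => u.1 (T - z.1, z.2),
    u.2.1.comp (t := rect T) ((contDiff_const.sub contDiff_fst).prodMk contDiff_snd).contDiffOn
      fun _ hz => mem_rect_flip.2 hz,
    fun _ hz => u.2.2 _ fun h => hz (mem_rect_flip.1 h)⟩
  map_add' _ _ := rfl
  map_smul' _ _ := rfl

theorem flip_val (u : SmoothRect T) (z : ℝ × ℝ) : (flip u).1 z = u.1 (T - z.1, z.2) := rfl

theorem flip_flip (u : SmoothRect T) : flip (flip u) = u :=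
  ext fun z _ => by rw [flip_val, flip_val, sub_sub_cancel]

theorem Dt_mulT (φ : ℝ → ℝ) (hφ : ContDiff ℝ ∞ φ) (u : SmoothRect T) :
    Dt (mulT φ hφ u) = mulT (deriv φ) (contDiff_deriv hφ) u + mulT φ hφ (Dt u) := by
  refine ext fun z hz => dt_unique hz ?_
  have h1 := (hφ.differentiable (by simp) z.1).hasDerivAt.hasDerivWithinAt (s := Icc 0 T)
  exact h1.mul (u.hasDerivWithinAt_dt hz)

theorem Dx_mulT (φ : ℝ → ℝ) (hφ : ContDiff ℝ ∞ φ) (u : SmoothRect T) :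
    Dx (mulT φ hφ u) = mulT φ hφ (Dx u) :=
  ext fun z hz => dx_unique hz ((u.hasDerivWithinAt_dx hz).const_mul (φ z.1))

theorem Dt_flip (u : SmoothRect T) : Dt (flip u) = -flip (Dt u) := by
  refine ext fun z hz => dt_unique hz ?_
  have h := u.hasDerivWithinAt_dt (mem_rect_flip.2 hz)
  have h1 : HasDerivWithinAt (fun y : ℝ => T - y) (-1) (Icc 0 T) z.1 :=
    (hasDerivWithinAt_id _ _).const_sub T
  have := HasDerivWithinAt.comp (s' := Icc 0 T) z.1 h h1
    (fun y hy => ⟨by linarith [hy.2], by linarith [hy.1]⟩)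
  simpa [Function.comp_def, Dt_val, flip_val] using this

theorem Dx_flip (u : SmoothRect T) : Dx (flip u) = flip (Dx u) :=
  ext fun _ hz => dx_unique hz (u.hasDerivWithinAt_dx (mem_rect_flip.2 hz))

theorem nrm_flip (u : SmoothRect T) : nrm (flip u) = nrm u := by
  have key : ∀ v : SmoothRect T, nrm (flip v) ≤ nrm v := fun v => nrm_le fun t ht x hx =>
    v.abs_le_nrm (z := (T - t, x)) (mem_rect_flip (z := (t, x)).2 ⟨ht, hx⟩)
  refine (key u).antisymm ?_
  simpa only [flip_flip] using key (flip u)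

theorem Dt_pow_flip (a : ℕ) : ∀ u : SmoothRect T,
    (Dt ^ a) (flip u) = (-1 : ℝ) ^ a • flip ((Dt ^ a) u) := by
  induction a with
  | zero => simp
  | succ a ih =>
    intro u
    rw [← pow_apply_self, Dt_flip, map_neg, ih, pow_apply_self, pow_succ (-1 : ℝ), mul_neg_one,
      neg_smul]

theorem Dx_pow_flip (m : ℕ) : ∀ u : SmoothRect T, (Dx ^ m) (flip u) = flip ((Dx ^ m) u) := by
  induction m with
  | zero => simp
  | succ m ih =>
    intro u
    rw [← pow_apply_self, Dx_flip, ih, pow_apply_self]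

theorem nrm_Dt_pow_flip (a : ℕ) (u : SmoothRect T) :
    nrm ((Dt ^ a) (flip u)) = nrm ((Dt ^ a) u) := by
  rw [Dt_pow_flip, nrm_smul, nrm_flip, abs_pow, abs_neg, abs_one, one_pow, one_mul]

theorem V_flip (k : ℕ) (u : SmoothRect T) : V k (flip u) = V k u := by
  refine Finset.sum_congr rfl fun j _ => Finset.sum_congr rfl fun m _ => ?_
  rw [Dx_pow_flip]
  exact nrm_flip (mulX (fun x => rho x ^ j) (contDiff_rho.pow j) ((Dx ^ m) u))

theorem V_smul (k : ℕ) (c : ℝ) (u : SmoothRect T) : V k (c • u) = |c| * V k u :=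
  wnrm_smul contDiff_rho k c u

theorem W_flip (n : ℕ) (u : SmoothRect T) : W n (flip u) = W n u := by
  refine Finset.sum_congr rfl fun a _ => ?_
  rw [Dt_pow_flip, V_smul, V_flip, abs_pow, abs_neg, abs_one, one_pow, one_mul]

theorem dom_nrm_mulT {φ : ℝ → ℝ} (hφ : ContDiff ℝ ∞ φ) :
    Dom (fun u : SmoothRect T => nrm (mulT φ hφ u)) nrm := by
  obtain ⟨C, hC⟩ := isCompact_Icc.exists_bound_of_continuousOn (s := Icc 0 T)
    hφ.continuous.continuousOn
  have hC0 : 0 ≤ C := (norm_nonneg _).trans (hC 0 ⟨le_rfl, hT.out.le⟩)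
  refine ⟨C, hC0, fun u => nrm_le fun t ht x hx => ?_⟩
  rw [mulT_val, abs_mul]
  exact mul_le_mul (hC t ht) (u.abs_le_nrm ⟨ht, hx⟩) (abs_nonneg _) hC0

theorem dom_nrm_Dt_pow_mulT (a : ℕ) : ∀ {φ : ℝ → ℝ} (hφ : ContDiff ℝ ∞ φ),
    Dom (fun u : SmoothRect T => nrm ((Dt ^ a) (mulT φ hφ u)))
      fun u => ∑ b ∈ Finset.range (a + 1), nrm ((Dt ^ b) u) := by
  induction a with
  | zero => exact fun hφ => (dom_nrm_mulT hφ).trans_le fun u => by simp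
  | succ a ih =>
    intro φ hφ
    have h1 := (ih (contDiff_deriv hφ)).trans_le
      (h := fun u => ∑ b ∈ Finset.range (a + 1 + 1), nrm ((Dt ^ b) u))
      fun u => Finset.sum_le_sum_of_subset_of_nonneg
        (Finset.range_mono (Nat.le_succ _)) fun _ _ _ => nrm_nonneg _
    have h2 := ((ih hφ).comp Dt).trans_le
      (h := fun u => ∑ b ∈ Finset.range (a + 1 + 1), nrm ((Dt ^ b) u)) fun u => by
        rw [Finset.sum_range_succ' _ (a + 1)]
        exact le_add_of_le_of_nonneg (le_of_eq (by simp [pow_succ])) (nrm_nonneg _)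
    refine Dom.le_trans (fun u => ?_) (h1.add h2)
    rw [← pow_apply_self, Dt_mulT, map_add]
    exact nrm_add_le _ _

/-- A cut-off function that is `1` on `[0, T/3]` and `0` beyond `2T/3`. -/
def endCut (T t : ℝ) : ℝ := Real.smoothTransition (2 - 3 * t / T)

theorem contDiff_endCut (T : ℝ) : ContDiff ℝ ∞ (endCut T) :=
  Real.smoothTransition.contDiff.comp (by fun_prop)

/-- The two parts of a function that live near `t = 0` and near `t = T`, both moved to the
end `t = 0`. -/
def endPart : Fin 2 → Module.End ℝ (SmoothRect T)
  | 0 => mulT (endCut T) (contDiff_endCut T)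
  | 1 => flip * mulT (fun t => 1 - endCut T t) (contDiff_const.sub (contDiff_endCut T))

/-- The map that moves a part back to its end of the interval. -/
def endMap : Fin 2 → Module.End ℝ (SmoothRect T)
  | 0 => 1
  | 1 => flip

theorem sum_endMap_endPart (u : SmoothRect T) : ∑ q : Fin 2, endMap q (endPart q u) = u := by
  rw [Fin.sum_univ_two]
  change mulT (endCut T) (contDiff_endCut T) u + flip (flip (mulT (fun t => 1 - endCut T t)
    (contDiff_const.sub (contDiff_endCut T)) u)) = u
  rw [flip_flip]
  ext z _
  rw [add_val, mulT_val, mulT_val]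
  ring

theorem W_endMap (q : Fin 2) (n : ℕ) (u : SmoothRect T) : W n (endMap q u) = W n u := by
  fin_cases q
  · rfl
  · exact W_flip n u

theorem endPart_eq_zero (q : Fin 2) (u : SmoothRect T) {t : ℝ} (ht : 2 * T / 3 < t) (x : ℝ) :
    (endPart q u).1 (t, x) = 0 := by
  have hT0 := hT.out
  fin_cases q
  · change endCut T t * u.1 (t, x) = 0
    rw [endCut, Real.smoothTransition.zero_of_nonpos, zero_mul]
    rw [sub_nonpos, le_div_iff₀ hT0]
    linarith
  · change (1 - endCut T (T - t)) * u.1 (T - t, x) = 0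
    rw [endCut, Real.smoothTransition.one_of_one_le, sub_self, zero_mul]
    rw [le_sub_comm, div_le_iff₀ hT0]
    linarith

theorem dom_nrm_Dt_pow_endPart (q : Fin 2) (a : ℕ) :
    Dom (fun u : SmoothRect T => nrm ((Dt ^ a) (endPart q u)))
      fun u => ∑ b ∈ Finset.range (a + 1), nrm ((Dt ^ b) u) := by
  fin_cases q
  · exact dom_nrm_Dt_pow_mulT a (contDiff_endCut T)
  · exact Dom.le_trans (fun u => (nrm_Dt_pow_flip a _).le)
      (dom_nrm_Dt_pow_mulT a (contDiff_const.sub (contDiff_endCut T)))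

/-! ### The expansion of a smooth function on the rectangle -/

/-- The Chebyshev operator `x (1 - x) ∂_x² + (1/2 - x) ∂_x`, with eigenfunctions `T_m (1 - 2x)`. -/
def Cheb : Module.End ℝ (SmoothRect T) :=
  mulX rho contDiff_rho * (Dx * Dx) +
    mulX (fun x => 1 / 2 - x) (contDiff_const.sub contDiff_id) * Dx

theorem Cheb_apply (u : SmoothRect T) : Cheb u = mulX rho contDiff_rho (Dx (Dx u)) +
    mulX (fun x => 1 / 2 - x) (contDiff_const.sub contDiff_id) (Dx u) := rfl

theorem Cheb_endPart (q : Fin 2) (u : SmoothRect T) : Cheb (endPart q u) = endPart q (Cheb u) := by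
  have h1 : ∀ (φ : ℝ → ℝ) (hφ : ContDiff ℝ ∞ φ) (u : SmoothRect T),
      Cheb (mulT φ hφ u) = mulT φ hφ (Cheb u) := fun φ hφ u => by
    rw [Cheb_apply, Cheb_apply, Dx_mulT, Dx_mulT, map_add]
    congr 1 <;> exact ext fun z _ => mul_left_comm _ _ _
  have h2 : ∀ u : SmoothRect T, Cheb (flip u) = flip (Cheb u) := fun u => by
    rw [Cheb_apply, Cheb_apply, Dx_flip, Dx_flip, map_add]
    rfl
  fin_cases q
  · exact h1 _ (contDiff_endCut T) u
  · exact (h2 _).trans (congrArg flip (h1 _ (contDiff_const.sub (contDiff_endCut T)) u))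

theorem dom_V_Cheb (k : ℕ) : Dom (fun u : SmoothRect T => V k (Cheb u)) (V (k + 1)) := by
  have h1 := dom_wnrm_sq (T := T) contDiff_rho k
  have h2 := ((dom_wnrm_mulX (T := T) contDiff_rho k
    (φ := fun x => 1 / 2 - x) (contDiff_const.sub contDiff_id)).comp Dx).trans
    (dom_wnrm_Dx contDiff_rho k)
  exact Dom.le_trans (fun u => wnrm_add_le contDiff_rho k _ _) (h1.add h2)

theorem dom_Cheb_pow (k : ℕ) : Dom (fun u : SmoothRect T => nrm ((Cheb ^ k) u)) (V k) :=
  dom_wnrm_pow contDiff_rho dom_V_Cheb k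

theorem dom_nrm_Dt_pow_W {a n : ℕ} (h : a ≤ 2 * n) :
    Dom (fun u : SmoothRect T => nrm ((Dt ^ a) u)) (W n) :=
  Dom.of_le fun u => (nrm_le_V 0 _).trans (V_Dt_le_W (by lia) u)

theorem dom_endPart_W (q : Fin 2) {a n : ℕ} (h : a ≤ 2 * n) :
    Dom (fun u : SmoothRect T => nrm ((Dt ^ a) (endPart q u))) (W n) :=
  (dom_nrm_Dt_pow_endPart q a).trans <| Dom.sum fun b hb =>
    dom_nrm_Dt_pow_W (by have := Finset.mem_range.1 hb; lia)

theorem Cheb_pow_endPart (q : Fin 2) (n : ℕ) : ∀ u : SmoothRect T,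
    (Cheb ^ n) (endPart q u) = endPart q ((Cheb ^ n) u) := by
  induction n with
  | zero => exact fun u => rfl
  | succ n ih =>
    intro u
    rw [← pow_apply_self, ← pow_apply_self, Cheb_endPart, ih]

theorem dom_Cheb_endPart_W (q : Fin 2) (n : ℕ) :
    Dom (fun u : SmoothRect T => nrm ((Cheb ^ n) (endPart q u))) (W n) := by
  have h1 := (dom_nrm_Dt_pow_endPart (T := T) q 0).comp fun u => (Cheb ^ n) u
  refine Dom.le_trans (fun u => le_of_eq ?_) (h1.trans ?_)
  · rw [Cheb_pow_endPart]
    rfl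
  · refine Dom.le_trans (fun u => le_of_eq ?_) ((dom_Cheb_pow n).trans_le fun u => ?_)
    · simp
    · exact V_Dt_le_W (a := 0) (by lia) u

/-- The coefficients of a function with respect to the products of `cos (π j t / T)` or
`sin (π j t / T)` and `T_m (1 - 2x)`, after Seeley's extension beyond `t = 0`. The index is
`(m, (j, s))`, where `s` selects cosine or sine. -/
def coeff (a : ℕ → ℝ) (i : ℤ × (ℤ × Fin 2)) (u : SmoothRect T) : ℝ :=
  extCoeff a T i.2 fun t => chebCoeff i.1 fun x => u.1 (t, x)

theorem continuousOn_slice_zero (u : SmoothRect T) (t : ℝ) :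
    ContinuousOn (fun x => u.1 (t, x)) (Icc 0 1) := by
  by_cases ht : t ∈ Icc 0 T
  · exact u.continuousOn_x ht
  · exact continuousOn_const.congr fun x _ => u.2.2 _ fun h => ht h.1

/-- Differentiation in `t` under the integral: the remainder in Taylor's formula is uniform in
`x`. -/
theorem hasDerivWithinAt_chebCoeff (m : ℤ) (u : SmoothRect T) {t : ℝ} (ht : t ∈ Icc 0 T) :
    HasDerivWithinAt (fun t => chebCoeff m fun x => u.1 (t, x))
      (chebCoeff m fun x => (Dt u).1 (t, x)) (Icc 0 T) t := by
  refine hasDerivWithinAt_iff_isLittleO.2 ?_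
  have hO : (fun s : ℝ => (chebCoeff m fun x => u.1 (s, x)) - (chebCoeff m fun x => u.1 (t, x)) -
      (s - t) • chebCoeff m fun x => (Dt u).1 (t, x)) =O[𝓝[Icc 0 T] t] fun s => ‖s - t‖ ^ 2 := by
    refine Asymptotics.IsBigO.of_bound (nrm (Dt (Dt u))) ?_
    filter_upwards [self_mem_nhdsWithin] with s hs
    rw [smul_eq_mul, mul_comm (s - t), ← chebCoeff_sub_sub_mul m (u.continuousOn_slice_zero s)
      (u.continuousOn_slice_zero t) ((Dt u).continuousOn_slice_zero t), norm_pow, norm_norm]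
    refine abs_chebCoeff_le m fun x hx => ?_
    exact abs_sub_sub_mul_le (convex_Icc 0 T) (fun t ht => u.hasDerivWithinAt_Dt ht hx)
        (fun t ht => (Dt u).hasDerivWithinAt_Dt ht hx)
        (fun t ht => (Dt (Dt u)).abs_le_nrm (z := (t, x)) ⟨ht, hx⟩) ht hs
  refine hO.trans_isLittleO ?_
  have : (fun s : ℝ => ‖s - t‖ ^ 2) =o[𝓝 t] fun s => s - t :=
    Asymptotics.isLittleO_pow_sub_sub t one_lt_two
  exact this.mono nhdsWithin_le_nhds

theorem chebCoeff_Cheb (m : ℤ) (u : SmoothRect T) {t : ℝ} (ht : t ∈ Icc 0 T) :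
    (chebCoeff m fun x => (Cheb u).1 (t, x)) = -(m : ℝ) ^ 2 * chebCoeff m fun x => u.1 (t, x) :=
  chebCoeff_cheb m (fun _ hx => u.hasDerivWithinAt_Dx ht hx)
    (fun _ hx => (Dx u).hasDerivWithinAt_Dx ht hx) ((Dx (Dx u)).continuousOn_x ht)

theorem coeff_Cheb (a : ℕ → ℝ) (i : ℤ × (ℤ × Fin 2)) (u : SmoothRect T) :
    coeff a i (Cheb u) = -(i.1 : ℝ) ^ 2 * coeff a i u := by
  rw [coeff, coeff, extCoeff, extCoeff, mul_left_comm]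
  refine congrArg (1 / (2 * T) * ·) ((intervalIntegral.integral_congr fun t ht => ?_).trans
    (intervalIntegral.integral_const_mul _ _))
  rw [uIcc_of_le hT.out.le] at ht
  simp only [chebCoeff_Cheb i.1 u ht, mul_assoc]

theorem coeff_Cheb_pow (a : ℕ → ℝ) (i : ℤ × (ℤ × Fin 2)) (k : ℕ) : ∀ u : SmoothRect T,
    coeff a i ((Cheb ^ k) u) = (-(i.1 : ℝ) ^ 2) ^ k * coeff a i u := by
  induction k with
  | zero => simp
  | succ k ih =>
    intro u
    rw [← pow_apply_self, ih, coeff_Cheb, pow_succ]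
    ring

end SmoothRect

theorem summable_inv_one_add_sq : Summable fun m : ℤ => (1 + (m : ℝ) ^ 2)⁻¹ := by
  refine Summable.of_norm_bounded_eventually (g := fun m : ℤ => 1 / (m : ℝ) ^ 2)
    (Real.summable_one_div_int_pow.2 one_lt_two) ?_
  filter_upwards [(finite_singleton (0 : ℤ)).compl_mem_cofinite] with m hm
  have hm0 : (0 : ℝ) < (m : ℝ) ^ 2 := by
    have : (m : ℝ) ≠ 0 := Int.cast_ne_zero.2 hm
    positivity
  rw [Real.norm_eq_abs, abs_of_pos (by positivity), one_div]
  exact inv_anti₀ hm0 (by linarith)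

theorem one_add_add_pow_le {x y : ℝ} (hx : 0 ≤ x) (hy : 0 ≤ y) (n : ℕ) :
    (1 + x + y) ^ n ≤ 3 ^ n * (1 + x ^ n + y ^ n) := by
  have hx' := pow_nonneg hx n
  have hy' := pow_nonneg hy n
  have key : ∀ z, 0 ≤ z → 1 + x + y ≤ 3 * z → z ^ n ≤ 1 + x ^ n + y ^ n →
      (1 + x + y) ^ n ≤ 3 ^ n * (1 + x ^ n + y ^ n) := fun z hz h1 h2 => by
    refine (pow_le_pow_left₀ (by positivity) h1 n).trans ?_
    rw [mul_pow]
    exact mul_le_mul_of_nonneg_left h2 (by positivity)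
  rcases le_total x y with h | h
  · rcases le_total y 1 with h' | h'
    · exact key 1 zero_le_one (by linarith) (by rw [one_pow]; linarith)
    · exact key y hy (by linarith) (by linarith)
  · rcases le_total x 1 with h' | h'
    · exact key 1 zero_le_one (by linarith) (by rw [one_pow]; linarith)
    · exact key x hx (by linarith) (by linarith)

namespace SmoothRect

variable {T : ℝ} [hT : Fact (0 < T)]

/-! ### Bounds for the coefficients and for the terms of the expansion -/

/-- The weight `1 + m² + j²` of an index. -/
def wt (i : ℤ × (ℤ × Fin 2)) : ℝ := 1 + (i.1 : ℝ) ^ 2 + (i.2.1 : ℝ) ^ 2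

theorem one_le_wt (i : ℤ × (ℤ × Fin 2)) : 1 ≤ wt i := by
  rw [wt, add_assoc]
  exact le_add_of_nonneg_right (by positivity)

theorem summable_wt : Summable fun i : ℤ × (ℤ × Fin 2) => (wt i ^ 2)⁻¹ := by
  have h1 : Summable fun i : ℤ × Fin 2 => (1 + (i.1 : ℝ) ^ 2)⁻¹ := by
    have h := summable_inv_one_add_sq.mul_of_nonneg (g := fun _ : Fin 2 => (1 : ℝ))
      (Summable.of_finite) (fun _ => by positivity) fun _ => zero_le_one
    simpa using h
  refine Summable.of_nonneg_of_le (fun i => by positivity [one_le_wt i]) (fun i => ?_)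
    (summable_inv_one_add_sq.mul_of_nonneg h1 (fun _ => by positivity) fun _ => by positivity)
  rw [← mul_inv]
  refine inv_anti₀ (by positivity) ?_
  rw [wt]
  nlinarith [sq_nonneg (i.1 : ℝ), sq_nonneg (i.2.1 : ℝ),
    mul_nonneg (sq_nonneg (i.1 : ℝ)) (sq_nonneg (i.2.1 : ℝ))]

/-- The functions that vanish beyond `t = 2T/3`, and so can be extended by `0` beyond `t = T`. -/
def EndVanish (v : SmoothRect T) : Prop := ∀ t x, 2 * T / 3 < t → v.1 (t, x) = 0

theorem endVanish_endPart (q : Fin 2) (u : SmoothRect T) : EndVanish (endPart q u) :=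
  fun _ x ht => endPart_eq_zero q u ht x

theorem EndVanish.Dt {v : SmoothRect T} (hv : EndVanish v) : EndVanish (Dt v) := by
  intro t x ht
  by_cases hz : (t, x) ∈ rect T
  · refine dt_unique hz ?_
    refine (hasDerivWithinAt_const t (Icc 0 T) (0 : ℝ)).congr_of_eventuallyEq ?_ (hv t x ht)
    filter_upwards [nhdsWithin_le_nhds (Ioi_mem_nhds ht)] with s hs
    exact hv s x hs
  · exact (SmoothRect.Dt v).2.2 _ hz

theorem EndVanish.Dt_pow {v : SmoothRect T} (hv : EndVanish v) (n : ℕ) :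
    EndVanish ((SmoothRect.Dt ^ n) v) := by
  induction n with
  | zero => exact hv
  | succ n ih =>
    rw [pow_succ', Module.End.mul_apply]
    exact ih.Dt

theorem exists_abs_coeff_le {a : ℕ → ℝ} (ha : IsSeeley a) (n : ℕ) : ∃ C : ℝ, 0 ≤ C ∧
    ∀ (i : ℤ × (ℤ × Fin 2)) (v : SmoothRect T), EndVanish v →
      |(i.2.1 : ℝ)| ^ n * |coeff a i v| ≤ C * nrm ((Dt ^ n) v) := by
  obtain ⟨C, hC, h⟩ := ha.exists_abs_extCoeff_le hT.out n
  refine ⟨C, hC, fun i v hv => h i.2 (fun n t => chebCoeff i.1 fun x => ((Dt ^ n) v).1 (t, x)) _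
    (fun n t ht => ?_) (fun n => ?_) fun t ht => ?_⟩
  · have := hasDerivWithinAt_chebCoeff i.1 ((Dt ^ n) v) ht
    rwa [← Module.End.mul_apply, ← pow_succ'] at this
  · have h0 : ∀ x, ((Dt ^ n) v).1 (T, x) = 0 := fun x =>
      hv.Dt_pow n T x (by have := hT.out; linarith)
    simp [h0, chebCoeff]
  · exact abs_chebCoeff_le _ fun x hx => abs_le_nrm _ ⟨ht, hx⟩

/-- The coefficients decrease rapidly with respect to the grading `W`: a factor `j^{2n}` is paid for
by `2n` derivatives in `t`, a factor `m^{2n}` by the `n`-th power of the Chebyshev operator. -/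
theorem exists_wt_pow_mul_abs_coeff_le {a : ℕ → ℝ} (ha : IsSeeley a) (q : Fin 2) (n : ℕ) :
    ∃ C : ℝ, 0 ≤ C ∧ ∀ (i : ℤ × (ℤ × Fin 2)) (u : SmoothRect T),
      wt i ^ n * |coeff a i (endPart q u)| ≤ C * W n u := by
  obtain ⟨C, hC, h⟩ := exists_abs_coeff_le (T := T) ha 0
  obtain ⟨D, hD, h'⟩ := exists_abs_coeff_le (T := T) ha (2 * n)
  obtain ⟨K, hK, k0⟩ := dom_endPart_W (T := T) q (a := 0) (n := n) (Nat.zero_le _)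
  obtain ⟨L, hL, k1⟩ := dom_endPart_W (T := T) q (a := 2 * n) (n := n) le_rfl
  obtain ⟨M, hM, k2⟩ := dom_Cheb_endPart_W (T := T) q n
  refine ⟨3 ^ n * (C * K + C * M + D * L), by positivity, fun i u => ?_⟩
  have e1 := (h i _ (endVanish_endPart q u)).trans (mul_le_mul_of_nonneg_left (k0 u) hC)
  have e2 := (h' i _ (endVanish_endPart q u)).trans (mul_le_mul_of_nonneg_left (k1 u) hD)
  have e3 : ((i.1 : ℝ) ^ 2) ^ n * |coeff a i (endPart q u)| ≤ C * (M * W n u) := by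
    have e := h i ((Cheb ^ n) (endPart q u)) (by
      rw [Cheb_pow_endPart]
      exact endVanish_endPart q _)
    rw [coeff_Cheb_pow, abs_mul, abs_pow, abs_neg, abs_of_nonneg (sq_nonneg (i.1 : ℝ))] at e
    simp only [pow_zero, one_mul, Module.End.one_apply] at e
    exact e.trans (mul_le_mul_of_nonneg_left (k2 u) hC)
  rw [pow_mul, sq_abs] at e2
  rw [pow_zero, one_mul] at e1
  calc wt i ^ n * |coeff a i (endPart q u)|
      ≤ 3 ^ n * (1 + ((i.1 : ℝ) ^ 2) ^ n + ((i.2.1 : ℝ) ^ 2) ^ n) * |coeff a i (endPart q u)| :=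
        mul_le_mul_of_nonneg_right (one_add_add_pow_le (sq_nonneg _) (sq_nonneg _) n) (abs_nonneg _)
    _ = 3 ^ n * (|coeff a i (endPart q u)| + ((i.1 : ℝ) ^ 2) ^ n * |coeff a i (endPart q u)| +
          ((i.2.1 : ℝ) ^ 2) ^ n * |coeff a i (endPart q u)|) := by ring
    _ ≤ 3 ^ n * (C * (K * W n u) + C * (M * W n u) + D * (L * W n u)) := by gcongr
    _ = _ := by ring

theorem contDiff_eval (P : Polynomial ℝ) : ContDiff ℝ ∞ fun y => P.eval y := by
  simpa using P.contDiff_aeval (𝕜 := ℝ) ∞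

/-- The product of a trigonometric function of `t` and a polynomial in `1 - 2x`. -/
def prodFn (s : ℕ) (ν : ℝ) (P : Polynomial ℝ) : SmoothRect T :=
  ofContDiffOn (fun z => trig s (ν * z.1) * P.eval (1 - 2 * z.2))
    (((contDiff_trig s).comp (contDiff_const.mul contDiff_fst)).mul
      ((contDiff_eval P).comp (contDiff_const.sub (contDiff_const.mul contDiff_snd)))).contDiffOn

theorem prodFn_val (s : ℕ) (ν : ℝ) (P : Polynomial ℝ) {z : ℝ × ℝ} (hz : z ∈ rect T) :
    (prodFn s ν P : SmoothRect T).1 z = trig s (ν * z.1) * P.eval (1 - 2 * z.2) :=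
  ofContDiffOn_val _ hz

theorem Dt_prodFn (s : ℕ) (ν : ℝ) (P : Polynomial ℝ) :
    Dt (prodFn s ν P : SmoothRect T) = ν • prodFn (s + 3) ν P := by
  refine ext fun z hz => dt_unique hz ?_
  rw [smul_val, prodFn_val _ _ _ hz]
  have e : trig s = trig (s + 3 + 1) := by
    funext y
    have : y - ((s + 3 + 1 : ℕ) : ℝ) * (Real.pi / 2) = y - s * (Real.pi / 2) - 2 * Real.pi := by
      push_cast; ring
    rw [trig, trig, this, Real.cos_sub_two_pi]
  have h := (((hasDerivAt_trig (s + 3) (ν * z.1)).comp z.1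
    ((hasDerivAt_id z.1).const_mul ν)).mul_const (P.eval (1 - 2 * z.2))).hasDerivWithinAt
    (s := Icc 0 T)
  rw [← e] at h
  refine (h.congr_deriv (by ring)).congr (fun t ht => ?_) ?_
  · exact prodFn_val _ _ _ ⟨ht, hz.2⟩
  · exact prodFn_val _ _ _ hz

theorem Dx_prodFn (s : ℕ) (ν : ℝ) (P : Polynomial ℝ) :
    Dx (prodFn s ν P : SmoothRect T) = (-2 : ℝ) • prodFn s ν (Polynomial.derivative P) := by
  refine ext fun z hz => dx_unique hz ?_
  rw [smul_val, prodFn_val _ _ _ hz]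
  have h := (((P.hasDerivAt (1 - 2 * z.2)).comp z.2
    (((hasDerivAt_id z.2).const_mul 2).const_sub 1)).const_mul (trig s (ν * z.1))).hasDerivWithinAt
    (s := Icc 0 1)
  refine (h.congr_deriv (by ring)).congr (fun t ht => ?_) ?_
  · exact prodFn_val _ _ _ ⟨hz.1, ht⟩
  · exact prodFn_val _ _ _ hz

theorem Dt_pow_prodFn (a : ℕ) : ∀ (s : ℕ) (ν : ℝ) (P : Polynomial ℝ),
    (Dt ^ a) (prodFn s ν P : SmoothRect T) = ν ^ a • prodFn (s + 3 * a) ν P := by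
  induction a with
  | zero => simp
  | succ a ih =>
    intro s ν P
    rw [← pow_apply_self, Dt_prodFn, map_smul, ih, smul_smul, ← pow_succ', mul_add, ← add_assoc,
      add_right_comm]

theorem Dx_pow_prodFn (i : ℕ) : ∀ (s : ℕ) (ν : ℝ) (P : Polynomial ℝ),
    (Dx ^ i) (prodFn s ν P : SmoothRect T) =
      (-2 : ℝ) ^ i • prodFn s ν (Polynomial.derivative^[i] P) := by
  induction i with
  | zero => simp
  | succ i ih =>
    intro s ν P
    rw [← pow_apply_self, Dx_prodFn, map_smul, ih, smul_smul, ← pow_succ',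
      Function.iterate_succ_apply]

theorem dom_V_prodFn (k : ℕ) :
    Dom (fun b : ℕ × ℝ × ℤ => V k (prodFn b.1 b.2.1 (chebPoly b.2.2) : SmoothRect T))
      fun b => (1 + (b.2.2 : ℝ) ^ 2) ^ k := by
  refine dom_wnrm contDiff_rho fun j hj i hi => ?_
  obtain ⟨C, hC, h⟩ := exists_chebPoly_le j i k hi (by lia)
  refine ⟨2 ^ i * C, by positivity, fun b => ?_⟩
  beta_reduce
  rw [Dx_pow_prodFn, map_smul, nrm_smul, abs_pow, abs_neg, abs_two, mul_assoc]
  refine mul_le_mul_of_nonneg_left (nrm_le fun t ht x hx => ?_) (by positivity)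
  have hy : |1 - 2 * x| ≤ 1 := abs_le.2 ⟨by linarith [hx.2], by linarith [hx.1]⟩
  have h1 := h b.2.2 _ hy
  have hr : rho x ≤ 1 - (1 - 2 * x) ^ 2 := by
    have := rho_nonneg hx
    rw [rho] at this ⊢
    nlinarith
  rw [mulX_val, prodFn_val _ _ _ ⟨ht, hx⟩, abs_mul, abs_mul,
    abs_of_nonneg (pow_nonneg (rho_nonneg hx) j)]
  refine le_trans ?_ h1
  refine mul_le_mul (pow_le_pow_left₀ (rho_nonneg hx) hr j) ?_ (by positivity)
    (pow_nonneg ((rho_nonneg hx).trans hr) j)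
  exact mul_le_of_le_one_left (abs_nonneg _) (abs_trig_le _ _)

/-- The terms of the expansion, the products of a cosine or sine in `t` and a Chebyshev polynomial
in `1 - 2x`. -/
def term (T : ℝ) [Fact (0 < T)] (i : ℤ × (ℤ × Fin 2)) : SmoothRect T :=
  prodFn i.2.2 (Real.pi / T * i.2.1) (chebPoly i.1)

theorem dom_W_term (n : ℕ) : Dom (fun i => W n (term T i)) fun i => wt i ^ n := by
  refine dom_W fun a k hak => ?_
  obtain ⟨C, hC, h⟩ := dom_V_prodFn (T := T) k
  refine ⟨|Real.pi / T| ^ a * C, by positivity, fun i => ?_⟩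
  beta_reduce
  rw [term, Dt_pow_prodFn, V_smul, abs_pow, abs_mul, mul_pow, mul_assoc, mul_assoc]
  refine mul_le_mul_of_nonneg_left ?_ (by positivity)
  have h1 := h (i.2.2 + 3 * a, Real.pi / T * i.2.1, i.1)
  refine (mul_le_mul_of_nonneg_left h1 (by positivity)).trans ?_
  rw [mul_left_comm]
  refine mul_le_mul_of_nonneg_left ?_ hC
  have hw := one_le_wt i
  have h2 : (1 + (i.1 : ℝ) ^ 2) ≤ wt i := le_add_of_nonneg_right (sq_nonneg _)
  have h3 : (i.2.1 : ℝ) ^ 2 ≤ wt i := le_add_of_nonneg_left (by positivity)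
  refine le_of_sq_le_sq ?_ (by positivity)
  calc (|(i.2.1 : ℝ)| ^ a * (1 + (i.1 : ℝ) ^ 2) ^ k) ^ 2
      = (|(i.2.1 : ℝ)| ^ 2) ^ a * ((1 + (i.1 : ℝ) ^ 2)) ^ (2 * k) := by ring
    _ ≤ wt i ^ a * wt i ^ (2 * k) := by rw [sq_abs]; gcongr
    _ = wt i ^ (a + 2 * k) := (pow_add _ _ _).symm
    _ ≤ wt i ^ (2 * n) := pow_le_pow_right₀ hw hak
    _ = _ := by ring

end SmoothRect

namespace SmoothRect

variable {T : ℝ} [hT : Fact (0 < T)] {a : ℕ → ℝ}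

/-! ### Convergence of the expansion, and tameness -/

theorem continuousOn_chebCoeff (m : ℤ) (u : SmoothRect T) :
    ContinuousOn (fun t => chebCoeff m fun x => u.1 (t, x)) (Icc 0 T) :=
  fun _ ht => (hasDerivWithinAt_chebCoeff m u ht).continuousWithinAt

theorem summable_chebCoeff (u : SmoothRect T) {t : ℝ} (ht : t ∈ Icc 0 T) :
    Summable fun m : ℤ => chebCoeff m fun x => u.1 (t, x) := by
  refine Summable.of_norm_bounded (summable_inv_one_add_sq.mul_left (nrm u + nrm (Cheb u)))
    fun m => ?_
  have h1 := abs_chebCoeff_le m fun x hx => u.abs_le_nrm (z := (t, x)) ⟨ht, hx⟩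
  have h2 := abs_chebCoeff_le m fun x hx => (Cheb u).abs_le_nrm (z := (t, x)) ⟨ht, hx⟩
  rw [chebCoeff_Cheb m u ht, abs_mul, abs_neg, abs_of_nonneg (sq_nonneg (m : ℝ))] at h2
  rw [← div_eq_mul_inv, le_div_iff₀ (by positivity), Real.norm_eq_abs]
  linarith

theorem EndVanish.continuousOn_chebCoeff_Ici {v : SmoothRect T} (hv : EndVanish v) (m : ℤ) :
    ContinuousOn (fun t => chebCoeff m fun x => v.1 (t, x)) (Ici 0) := by
  intro t ht
  have hT0 := hT.out
  rcases lt_or_ge t T with h | h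
  · refine (continuousOn_chebCoeff m v t ⟨ht, h.le⟩).mono_of_mem_nhdsWithin ?_
    filter_upwards [self_mem_nhdsWithin, nhdsWithin_le_nhds (Iio_mem_nhds h)] with s h1 h2
    exact ⟨h1, le_of_lt h2⟩
  · have h0 : ∀ s, 2 * T / 3 < s → (chebCoeff m fun x => v.1 (s, x)) = 0 := fun s hs => by
      simp [hv s _ hs, chebCoeff]
    refine (continuousWithinAt_const (b := (0 : ℝ))).congr_of_eventuallyEq ?_ (h0 t (by linarith))
    filter_upwards [nhdsWithin_le_nhds (Ioi_mem_nhds (show 2 * T / 3 < t by linarith))] with s hs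
    exact h0 s hs

theorem exists_abs_term_le : ∃ C : ℝ, ∀ (i : ℤ × (ℤ × Fin 2)) {z : ℝ × ℝ}, z ∈ rect T →
    |(term T i).1 z| ≤ C := by
  obtain ⟨C, -, h⟩ := dom_W_term (T := T) 0
  refine ⟨C, fun i z hz => ((term T i).abs_le_nrm hz).trans ?_⟩
  have h1 : W 0 (term T i) ≤ C * wt i ^ 0 := h i
  rw [pow_zero, mul_one] at h1
  exact (nrm_le_V 0 _).trans ((V_Dt_le_W (a := 0) (by lia) (term T i)).trans h1)

/-- Summation over `t`-frequencies first: this is the Fourier expansion of the Chebyshev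
coefficients of the function, and the Chebyshev expansion remains. -/
theorem EndVanish.hasSum_coeff (ha : IsSeeley a) {v : SmoothRect T} (hv : EndVanish v)
    (hs : Summable fun i => coeff a i v) {z : ℝ × ℝ} (hz : z ∈ rect T) :
    HasSum (fun i => coeff a i v * (term T i).1 z) (v.1 z) := by
  obtain ⟨t, x⟩ := z
  obtain ⟨ht, hx⟩ := hz
  obtain ⟨C, hC⟩ := exists_abs_term_le (T := T)
  have hsum : Summable fun i => coeff a i v * (term T i).1 (t, x) := by
    refine Summable.of_norm_bounded (hs.abs.mul_right C) fun i => ?_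
    rw [norm_mul]
    exact mul_le_mul_of_nonneg_left (hC i ⟨ht, hx⟩) (abs_nonneg _)
  have hinner : ∀ m : ℤ, HasSum (fun i : ℤ × Fin 2 => coeff a (m, i) v * (term T (m, i)).1 (t, x))
      ((chebCoeff m fun x => v.1 (t, x)) * (chebPoly m).eval (1 - 2 * x)) := fun m => by
    have h := ha.hasSum_extCoeff hT.out (M := nrm v) (hv.continuousOn_chebCoeff_Ici m)
      (fun s hs => abs_chebCoeff_le m fun y hy => ?_) (fun s hs => ?_) (hs.prod_factor m) ht
    · refine (h.mul_right ((chebPoly m).eval (1 - 2 * x))).congr_fun fun i => ?_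
      rw [term, prodFn_val _ _ _ ⟨ht, hx⟩, ← mul_assoc]
      rfl
    · by_cases hsT : s ≤ T
      · exact v.abs_le_nrm (z := (s, y)) ⟨⟨hs, hsT⟩, hy⟩
      · rw [v.2.2 _ fun h => hsT h.1.2, abs_zero]
        exact nrm_nonneg v
    · have h0 : ∀ y, v.1 (s, y) = 0 := fun y => hv s y (by have := hT.out; linarith)
      simp [h0, chebCoeff]
  have houter := hasSum_chebCoeff (v.continuousOn_slice_zero t) (summable_chebCoeff v ht) hx
  rw [← (hsum.hasSum.prod_fiberwise hinner).unique houter]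
  exact hsum.hasSum

theorem summable_coeff_endPart (ha : IsSeeley a) (q : Fin 2) (u : SmoothRect T) :
    Summable fun i => coeff a i (endPart q u) := by
  obtain ⟨C, -, h⟩ := exists_wt_pow_mul_abs_coeff_le (T := T) ha q 2
  refine Summable.of_norm_bounded (summable_wt.mul_left (C * W 2 u)) fun i => ?_
  have := one_le_wt i
  rw [← div_eq_mul_inv, le_div_iff₀ (by positivity), mul_comm]
  exact h i u

theorem coeff_smul (i : ℤ × (ℤ × Fin 2)) (b : ℝ) (u : SmoothRect T) :
    coeff a i (b • u) = b * coeff a i u := by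
  simp only [coeff, extCoeff, smul_val, chebCoeff_const_mul, mul_assoc b,
    intervalIntegral.integral_const_mul]
  ring

theorem coeff_add (ha : IsSeeley a) (i : ℤ × (ℤ × Fin 2)) (u v : SmoothRect T) :
    coeff a i (u + v) = coeff a i u + coeff a i v := by
  have hK : Continuous (seeleyKernel a (fun _ t => trig i.2.2 (Real.pi / T * i.2.1 * t)) 0) :=
    ha.continuous_seeleyKernel (B := 1) ((contDiff_trig _).continuous.comp (by fun_prop))
      fun t => abs_trig_le _ _
  have hi : ∀ u : SmoothRect T, IntervalIntegrable (fun t => (chebCoeff i.1 fun x => u.1 (t, x)) *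
      seeleyKernel a (fun _ t => trig i.2.2 (Real.pi / T * i.2.1 * t)) 0 t)
      MeasureTheory.volume 0 T := fun u => by
    refine ContinuousOn.intervalIntegrable ?_
    rw [uIcc_of_le hT.out.le]
    exact (continuousOn_chebCoeff i.1 u).mul hK.continuousOn
  have hadd : ∀ t, (chebCoeff i.1 fun x => (u + v).1 (t, x)) =
      (chebCoeff i.1 fun x => u.1 (t, x)) + chebCoeff i.1 fun x => v.1 (t, x) := fun t =>
    chebCoeff_add i.1 (u.continuousOn_slice_zero t) (v.continuousOn_slice_zero t)
  simp only [coeff, extCoeff, hadd, add_mul]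
  rw [intervalIntegral.integral_add (hi u) (hi v), mul_add]

/-- The coefficient of index `i` of the part of a function at the end `q`, as a linear form. -/
def coeffForm (ha : IsSeeley a) (i : Fin 2 × (ℤ × (ℤ × Fin 2))) : SmoothRect T →ₗ[ℝ] ℝ where
  toFun u := coeff a i.2 (endPart i.1 u)
  map_add' u v := by rw [map_add, coeff_add ha]
  map_smul' b u := by rw [map_smul, coeff_smul, RingHom.id_apply, smul_eq_mul]

/-- `endMap q` is the composition with a map of the rectangle to itself. -/
theorem exists_endMap_val_eq (q : Fin 2) {z : ℝ × ℝ} (hz : z ∈ rect T) :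
    ∃ y ∈ rect T, ∀ u : SmoothRect T, (endMap q u).1 z = u.1 y := by
  fin_cases q
  · exact ⟨z, hz, fun u => rfl⟩
  · exact ⟨_, mem_rect_flip.2 hz, fun u => rfl⟩

theorem hasSum_coeffForm (ha : IsSeeley a) (u : SmoothRect T) {z : ℝ × ℝ} (hz : z ∈ rect T) :
    HasSum (fun i => coeffForm ha i u * (endMap i.1 (term T i.2)).1 z) (u.1 z) := by
  have hq : ∀ q : Fin 2, HasSum (fun i => coeff a i (endPart q u) * (endMap q (term T i)).1 z)
      ((endMap q (endPart q u)).1 z) := fun q => by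
    obtain ⟨y, hy, h⟩ := exists_endMap_val_eq (T := T) q hz
    simp only [h]
    exact (endVanish_endPart q u).hasSum_coeff ha (summable_coeff_endPart ha q u) hy
  have hval : u.1 z = ∑ q : Fin 2, (endMap q (endPart q u)).1 z := by
    conv_lhs => rw [← sum_endMap_endPart u]
    rw [Fin.sum_univ_two, Fin.sum_univ_two, add_val]
  have hs : Summable fun i : Fin 2 × (ℤ × (ℤ × Fin 2)) =>
      coeffForm ha i u * (endMap i.1 (term T i.2)).1 z := by
    refine Summable.of_norm ((summable_prod_of_nonneg fun _ => norm_nonneg _).2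
      ⟨fun q => (hq q).summable.norm, Summable.of_finite⟩)
  rw [hval, ← (hs.hasSum.prod_fiberwise hq).unique (hasSum_fintype _)]
  exact hs.hasSum

theorem tendsto_val {u : ℕ → SmoothRect T} {g : SmoothRect T} (h : Tendsto u atTop (𝓝 g))
    {z : ℝ × ℝ} (hz : z ∈ rect T) : Tendsto (fun K => (u K).1 z) atTop (𝓝 (g.1 z)) := by
  have h0 := (withSeminorms_derivSeminorm.tendsto_nhds _ g).1 h (0, 0)
  refine Metric.tendsto_nhds.2 fun ε hε => (h0 ε hε).mono fun K hK => ?_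
  rw [derivSeminorm_apply, D_zero_zero] at hK
  rw [Real.dist_eq]
  exact ((u K - g).abs_le_nrm hz).trans_lt hK

/-- A grading by seminorms that is tamely equivalent to the grading by weighted derivatives is tame:
the expansion by Chebyshev polynomials and trigonometric functions satisfies the conditions of
`IsGradedFrechet.isTameSpace`, with the weights `1 + m² + j²`. -/
theorem isTameSpace_of_dom {p : ℕ → SmoothRect T → ℝ} {r : ℕ} (hp : IsGradedFrechet p)
    (h1 : ∀ n, Dom (p n) (W n)) (h2 : ∀ n, Dom (W n) (p (n + r))) : IsTameSpace p := by
  obtain ⟨a, hsum, hmom⟩ := exists_seeley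
  have ha : IsSeeley a := ⟨hsum, hmom⟩
  obtain ⟨φ⟩ := nonempty_equiv_of_countable (α := ℕ) (β := Fin 2 × (ℤ × (ℤ × Fin 2)))
  have hw : ∀ k, 1 ≤ wt (φ k).2 := fun k => one_le_wt _
  have hs : Summable fun k => (wt (φ k).2 ^ 2)⁻¹ := by
    have h : Summable fun i : Fin 2 × (ℤ × (ℤ × Fin 2)) => (wt i.2 ^ 2)⁻¹ :=
      (summable_prod_of_nonneg fun i => inv_nonneg.2 (sq_nonneg (wt i.2))).2
        ⟨fun _ => summable_wt, Summable.of_finite⟩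
    exact h.comp_injective φ.injective
  have hcW : ∀ n : ℕ, ∃ C : ℝ, 0 ≤ C ∧ ∀ k (u : SmoothRect T),
      wt (φ k).2 ^ n * |coeffForm ha (φ k) u| ≤ C * W n u := fun n => by
    choose C hC0 hC using fun q => exists_wt_pow_mul_abs_coeff_le (T := T) ha q n
    refine ⟨∑ q, C q, Finset.sum_nonneg fun q _ => hC0 q, fun k u =>
      (hC (φ k).1 (φ k).2 u).trans (mul_le_mul_of_nonneg_right ?_ (W_nonneg n u))⟩
    exact Finset.single_le_sum (fun q _ => hC0 q) (Finset.mem_univ _)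
  have he : ∀ n : ℕ, ∃ C : ℝ, 0 ≤ C ∧ ∀ k,
      p n (endMap (φ k).1 (term T (φ k).2)) ≤ C * wt (φ k).2 ^ n := fun n => by
    obtain ⟨C, hC, h⟩ := h1 n
    obtain ⟨D, hD, h'⟩ := dom_W_term (T := T) n
    refine ⟨C * D, by positivity, fun k => (h _).trans ?_⟩
    rw [W_endMap, mul_assoc]
    exact mul_le_mul_of_nonneg_left (h' _) hC
  refine hp.isTameSpace (c := fun k => coeffForm ha (φ k)) (r := r)
    (e := fun k => endMap (φ k).1 (term T (φ k).2)) hw hs (fun n => ?_) (fun n => ?_) fun u => ?_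
  · obtain ⟨C, hC, h⟩ := hcW n
    obtain ⟨D, hD, h'⟩ := h2 n
    refine ⟨C * D, by positivity, fun k u => (h k u).trans ?_⟩
    rw [mul_assoc]
    exact mul_le_mul_of_nonneg_left (h' u) hC
  · obtain ⟨C, hC, h⟩ := he n
    exact ⟨C, hC, fun k => (h k).trans
      (mul_le_mul_of_nonneg_left (pow_le_pow_right₀ (hw k) (Nat.le_add_right n r)) hC)⟩
  · choose C hC0 hC using hcW
    choose D hD0 hD using he
    obtain ⟨P, hP, -⟩ := hp.defines_topology
    obtain ⟨g, hg, -⟩ := hp.exists_tendsto_sum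
      (f := fun k => coeffForm ha (φ k) u • endMap (φ k).1 (term T (φ k).2))
      (fun n => hs.mul_left (C (n + 2) * W (n + 2) u * D n)) fun n k => by
        have hk := hw k
        rw [← hP, map_smul_eq_mul, hP, ← div_eq_mul_inv, le_div_iff₀ (by positivity)]
        calc ‖coeffForm ha (φ k) u‖ * p n (endMap (φ k).1 (term T (φ k).2)) * wt (φ k).2 ^ 2
            ≤ ‖coeffForm ha (φ k) u‖ * (D n * wt (φ k).2 ^ n) * wt (φ k).2 ^ 2 := by
              gcongr
              exact hD n k
          _ = wt (φ k).2 ^ (n + 2) * |coeffForm ha (φ k) u| * D n := by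
              rw [Real.norm_eq_abs]
              ring
          _ ≤ _ := mul_le_mul_of_nonneg_right (hC (n + 2) k u) (hD0 n)
    suffices h : g = u by rwa [h] at hg
    refine ext fun z hz => tendsto_nhds_unique (tendsto_val hg hz) ?_
    have h := ((φ.hasSum_iff (f := fun i => coeffForm ha i u *
      (endMap i.1 (term T i.2)).1 z)).2 (hasSum_coeffForm ha u hz)).tendsto_sum_nat
    refine h.congr fun K => ?_
    induction K with
    | zero => rfl
    | succ K ih => rw [Finset.sum_range_succ, Finset.sum_range_succ, add_val, ih]; rfl

theorem isTameSpace_combSup {N : ℝ} (hN : 4 < N) (c : Cutoff) : IsTameSpace (combSup T N c) :=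
  isTameSpace_of_dom (r := 0) (isGradedFrechet_combSup hN c) (dom_combSup_W N c)
    (dom_W_combSup hN c)

theorem isTameSpace_combL2 {N : ℝ} (hN : 4 < N) (c : Cutoff) : IsTameSpace (combL2 T N c) := by
  obtain ⟨r, hr⟩ := exists_dom_combSup_combL2 (T := T) hN c
  exact isTameSpace_of_dom (isGradedFrechet_combL2 hN c)
    (fun n => (dom_combL2_combSup hN c n).trans (dom_combSup_W N c n))
    fun n => (dom_W_combSup hN c n).trans (hr n)

end SmoothRect

end

theorem proposition2 (T : ℝ) (hT : 0 < T) (N : ℝ) (hN : 4 < N) (ω : Cutoff) :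
    TamelyEquivalent (combSup T N ω) (combL2 T N ω) ∧
    IsTameSpace (combSup T N ω) ∧
    IsTameSpace (combL2 T N ω) ∧
    IsTameDirectSummandVia (combSup T N ω)
      (prodGrading (sideGradingSup T N 0) (sideGradingSup T N 1)) (splitMap T ω) (sumMap T) ∧
    IsTameDirectSummandVia (combL2 T N ω)
      (prodGrading (sideGradingL2 T N 0) (sideGradingL2 T N 1)) (splitMap T ω) (sumMap T) := by
  have : Fact (0 < T) := ⟨hT⟩
  exact ⟨SmoothRect.tamelyEquivalent_combSup_combL2 hN ω, SmoothRect.isTameSpace_combSup hN ω,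
    SmoothRect.isTameSpace_combL2 hN ω, SmoothRect.isTameDirectSummandVia_combSup hN ω,
    SmoothRect.isTameDirectSummandVia_combL2 hN ω⟩
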